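/- Let $N>0$, $\lambda>0$ and $\delta=1-\frac{2}{1+e^{\lambda/N}}$. Let $T_N=\{z:\operatorname{Im} z\ge 0\}/(z\sim z+2\pi N)$ be the closed cylinder of width $N$, with bottom circle $\mathbb T_N=\{\operatorname{Im} z=0\}$. The slit map at $0$ is $S=F_N^{-1}\circ\phi_\delta\circ F_N$, where $F_N(z)=\tan\frac{z}{2N}$ and $\phi_\delta(z)=\sqrt{z^2(1-\delta^2)-\delta^2}$ (the branch mapping the upper half-plane to itself, extended continuously to $\mathbb R\cup\{\infty\}$); it attaches the slit $[0,i\lambda]$ to $\mathbb T_N$. For $x\in(0,2\pi N]$ let $S_x(z)=x+S(z-x)$. Let $(t_1,x_1),(t_2,x_2),\dots$, $0<t_1<t_2<\cdots$, be the points of a Poisson point process of intensity $1$ on $(0,\infty)\times(0,2\pi N]$. The cylindrical Hastings–Levitov(0) process is $\mathcal C_t=S_{x_1}\circ\cdots\circ S_{x_n}$ for $t_n\le t<t_{n+1}$ (with $t_0=0$ and $\mathcal C_t=\mathrm{id}$ for $t<t_1$). The trees at time $t$ are the connected components of $\mathcal C_t(\mathbb T_N)\setminus\mathbb T_N$. The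 $n$-th particle is $\mathcal C_{t_{n-1}}\big((x_n,x_n+i\lambda]\big)$; it is received at time $t_n$ by the tree that contains it. Almost surely exactly one tree receives infinitely many particles. The one-arm domination time $\upsilon_{N,\lambda}$ is the last time at which a particle is received by a tree other than this infinite one (and $0$ if there is no such particle); it is a random variable. **Theorem 1.1.** For every $K>0$ there are constants $c,C>0$, depending only on $K$, such that for all $N>0$ and all $0<\lambda\le KN$, $$\frac{cN^2}{\lambda^3}\le\mathbb E[\upsilon_{N,\lambda}]\le\frac{CN^2}{\lambda^3}.$$ -/

import Mathlib

open MeasureTheory ProbabilityTheory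
open scoped ENNReal

noncomputable section

namespace CHL

/-- The circle `𝕋_N` of length `2πN` times `ℝ`. The closed cylinder of width `N` is the part where
the second coordinate is nonnegative; the point `(x, y)` stands for the class of `x + i y` in
`{z : Im z ≥ 0} / (z ∼ z + 2πN)`. -/
abbrev Cylinder (N : ℝ) : Type := AddCircle (2 * Real.pi * N) × ℝ

/-- The bottom circle `𝕋_N × {0}` of the cylinder. -/
def base (N : ℝ) : Set (Cylinder N) := {p | p.2 = 0}

/-- The parameter `δ(N, ℓ) = 1 - 2 / (1 + e^{ℓ/N})` for which the slit has length `ℓ`. -/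
def slitParam (N ℓ : ℝ) : ℝ := 1 - 2 / (1 + Real.exp (ℓ / N))

/-- The half-plane slit map `z ↦ √(z² (1 - δ²) - δ²)` from the closed upper half-plane to itself.
The root is the one in the closed upper half-plane; where it is real (`z` real, outside
the two preimages of the slit) it has the sign of `z`, which is the continuous extension from the
open half-plane. -/
def halfPlaneSlitMap (δ : ℝ) (z : ℂ) : ℂ :=
  let w : ℂ := z ^ 2 * (1 - (δ : ℂ) ^ 2) - (δ : ℂ) ^ 2
  open Classical in
  if z.im = 0 ∧ 0 < w.re then ((SignType.sign z.re : ℝ) * Real.sqrt w.re : ℝ)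
  else Complex.I * Complex.sqrt (-w)

/-- A lift to `ℂ` of the cylindrical slit map `F_N⁻¹ ∘ φ_δ ∘ F_N`, where `F_N z = tan (z / (2N))`.
It takes values in `-πN < Re ≤ πN`. The only points with `F_N z = ∞` are `z = πN` modulo `2πN`;
since `φ_δ ∞ = ∞`, they are fixed by the slit map. -/
def slitMapLift (N ℓ : ℝ) (z : ℂ) : ℂ :=
  open Classical in
  if Complex.cos (z / (2 * N)) = 0 then ((Real.pi * N : ℝ) : ℂ)
  else 2 * N * Complex.arctan (halfPlaneSlitMap (slitParam N ℓ) (Complex.tan (z / (2 * N))))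

/-- The cylindrical slit map attaching the slit `[0, iℓ]`. As `F_N` has period `2πN`, the value
does not depend on the representative `p.1.out` of `p.1`. -/
def slitMap (N ℓ : ℝ) (p : Cylinder N) : Cylinder N :=
  let z : ℂ := slitMapLift N ℓ (⟨Quotient.out p.1, p.2⟩ : ℂ)
  ((z.re : AddCircle (2 * Real.pi * N)), z.im)

/-- The cylindrical slit map attaching the slit `[x, x + iℓ]`: the conjugate of `slitMap` by the
rotation by `x`. -/
def slitMapAt (N ℓ x : ℝ) (p : Cylinder N) : Cylinder N :=
  let r : Cylinder N := ((x : AddCircle (2 * Real.pi * N)), 0)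
  slitMap N ℓ (p - r) + r

/-- `chl N ℓ x n = S_{x₁} ∘ ⋯ ∘ S_{xₙ}` is the value of the cylindrical Hastings–Levitov(0) process
from the arrival of the `n`-th particle up to the arrival of the next one. Positions are indexed
from `1`; `x 0` is not used. -/
def chl (N ℓ : ℝ) (x : ℕ → ℝ) : ℕ → Cylinder N → Cylinder N
  | 0 => id
  | n + 1 => chl N ℓ x n ∘ slitMapAt N ℓ (x (n + 1))

/-- The grown part of the cluster after `n` particles: the image of the bottom circle, without the
bottom circle itself. Its connected components are the trees. -/
def forest (N ℓ : ℝ) (x : ℕ → ℝ) (n : ℕ) : Set (Cylinder N) :=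
  chl N ℓ x n '' base N \ base N

/-- `T` is one of the trees present after `n` particles. -/
def IsTree (N ℓ : ℝ) (x : ℕ → ℝ) (n : ℕ) (T : Set (Cylinder N)) : Prop :=
  ∃ p ∈ forest N ℓ x n, T = connectedComponentIn (forest N ℓ x n) p

/-- The `(n + 1)`-st particle: the image under the map after `n` particles of the slit (without
its foot) above `x (n + 1)`. -/
def particle (N ℓ : ℝ) (x : ℕ → ℝ) (n : ℕ) : Set (Cylinder N) :=
  chl N ℓ x n '' {p | p.1 = (x (n + 1) : AddCircle (2 * Real.pi * N)) ∧ 0 < p.2 ∧ p.2 ≤ ℓ}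

/-- The `(j + 1)`-st and the `(k + 1)`-st particles belong to the same tree (once both have
arrived; trees only grow as further particles are attached). -/
def SameTree (N ℓ : ℝ) (x : ℕ → ℝ) (j k : ℕ) : Prop :=
  ∃ n T, IsTree N ℓ x n T ∧ particle N ℓ x j ⊆ T ∧ particle N ℓ x k ⊆ T

/-- The tree that receives the `(j + 1)`-st particle receives infinitely many particles. -/
def InInfiniteTree (N ℓ : ℝ) (x : ℕ → ℝ) (j : ℕ) : Prop :=
  {k | SameTree N ℓ x j k}.Infinite

/-- There is exactly one tree that receives infinitely many particles. -/
def UniqueInfiniteTree (N ℓ : ℝ) (x : ℕ → ℝ) : Prop :=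
  ∃ j, InInfiniteTree N ℓ x j ∧ ∀ k, InInfiniteTree N ℓ x k → SameTree N ℓ x j k

/-- The one-arm domination time: the last time at which a particle is received by a tree other
than the infinite one (`0` if there is no such particle). The `(n + 1)`-st particle arrives at
time `t (n + 1)`. -/
def dominationTime (N ℓ : ℝ) (t x : ℕ → ℝ) : ℝ≥0∞ :=
  ⨆ n, ⨆ _ : ¬ InInfiniteTree N ℓ x n, ENNReal.ofReal (t (n + 1))

/-- `(t n, x n)`, `n ≥ 1`, are the points, listed in the order of time, of a Poisson point process of
intensity `1` (with respect to Lebesgue measure `dt dx`) on `(0, ∞) × (0, 2πN]`: with `t 0 = 0`,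
the waiting times `t (n + 1) - t n` are exponential of rate `2πN`, the positions `x (n + 1)` are
uniform on `(0, 2πN]`, and all of these are independent. -/
structure IsPoissonPoints {Ω : Type*} [MeasurableSpace Ω] (N : ℝ) (t x : ℕ → Ω → ℝ)
    (μ : Measure Ω) : Prop where
  zero : ∀ ω, t 0 ω = 0
  indep : iIndepFun (fun (n : ℕ) (ω : Ω) => (t (n + 1) ω - t n ω, x (n + 1) ω)) μ
  law : ∀ n, HasLaw (fun ω => (t (n + 1) ω - t n ω, x (n + 1) ω))
    ((expMeasure (2 * Real.pi * N)).prod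
      (ProbabilityTheory.cond volume (Set.Ioc 0 (2 * Real.pi * N)))) μ

end CHL

end

/-!
Write `δ` for the slit parameter, which is of order `ℓ / N` as `ℓ ≤ K N`. In the coordinate
`cos (z / N)` the slit map is affine (`slitMap_spec`), and the motion `collapse` that it induces on
the bottom circle is an odd map which contracts an arc of length of order `δ` to the foot `0` of the
slit and is injective elsewhere. Following this motion backwards in time, every particle has a
`foot` on the bottom circle, and almost surely two particles are in the same tree exactly when they
have the same foot (`sameTree_iff`, `ae_forall_cosC_ne`). So the trees are governed by
random compositions of rotated copies of `collapse` with independent uniform rotations. The harmonic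
measure of a set `A` of feet, which is the probability that the next particle has its foot in `A`,
is the length of the preimage of `A` under such a composition.

*Upper bound.* The harmonic measure `M` of `A` is a martingale. Since the motion loses half of the
mass close to the slit (`measure_collapse_preimage_add_le`), the variance of one step is at least of
order `δ² min M (1 - M) δ`, uniformly in `A` (`variance_lower_bound`). An optional stopping
argument bounds the probability that `A` and its complement are both hit again by a multiple of
`δ⁻¹ min M (1 - M) δ` (`seqLaw_hit_le`), because a set that is hit jumps to harmonic measure at
least of order `δ`. Comparing the two, the decrease of the potential `M (1 - M)` shows that the
expected number of steps after which `A` and its complement are both still to be hit is at most a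
multiple of `δ⁻³ M (1 - M)` (`sum_bothHit_le`). Summing over the trees, where the `n`-th particle
founds a new one with probability at most `(1 - cδ) ^ n`, the last particle in a finite tree has
expected index at most of order `δ⁻³` (`tsum_finiteHit_le`); this also gives existence and
uniqueness of the infinite tree (`ae_unique_infinite`). The waiting times have mean `1 / (2πN)` and
are independent of the positions, hence the bound `N² / ℓ³`.

*Lower bound.* Let `f` be the first character of the circle. The correlation of `f` at the foot of
the `n`-th particle with `f` at its position is `q ^ n`, where `1 - q` is half of the mean squared
displacement under one slit map, and this is at most `12 δ³` (`exists_correlation`). So for `n` up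
to a small multiple of `δ⁻³` two consecutive particles have feet close to their nearly independent
positions, and they are in different trees with a probability bounded below
(`le_seqLaw_foot_collapse_ne`). By uniqueness, one of these two trees is finite.
-/

namespace CHL

/-! ### The slit map in the coordinate `cos (z / N)` -/

/-- The half-plane slit map is a root of `z² (1 - δ²) - δ²` in the closed upper half-plane that
preserves the sign of the real part. -/
lemma halfPlaneSlitMap_spec {δ : ℝ} (hδ : δ ^ 2 < 1) {z : ℂ} (hz : 0 ≤ z.im) :
    halfPlaneSlitMap δ z ^ 2 = z ^ 2 * (1 - (δ : ℂ) ^ 2) - (δ : ℂ) ^ 2 ∧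
      0 ≤ (halfPlaneSlitMap δ z).im ∧
      (0 ≤ z.re → 0 ≤ (halfPlaneSlitMap δ z).re) ∧
      (z.re ≤ 0 → (halfPlaneSlitMap δ z).re ≤ 0) := by
  have hre : (z ^ 2 * (1 - (δ : ℂ) ^ 2) - (δ : ℂ) ^ 2).re
      = (z.re ^ 2 - z.im ^ 2) * (1 - δ ^ 2) - δ ^ 2 := by
    simp [pow_two]
  have him : (z ^ 2 * (1 - (δ : ℂ) ^ 2) - (δ : ℂ) ^ 2).im
      = 2 * z.re * z.im * (1 - δ ^ 2) := by
    simp only [pow_two, Complex.sub_im, Complex.mul_im, Complex.mul_re, Complex.ofReal_re,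
      Complex.ofReal_im, Complex.sub_re, Complex.one_re, Complex.one_im]
    ring
  unfold halfPlaneSlitMap
  set w : ℂ := z ^ 2 * (1 - (δ : ℂ) ^ 2) - (δ : ℂ) ^ 2 with hw
  by_cases h : z.im = 0 ∧ 0 < w.re
  · simp only [h, and_self, if_true]
    obtain ⟨h1, h2⟩ := h
    have hz0 : z.re ≠ 0 := by
      rintro h0
      rw [hre, h0, h1] at h2
      nlinarith [sq_nonneg δ]
    have hw' : w = ((w.re : ℝ) : ℂ) := by
      apply Complex.ext <;> simp [him, h1]
    refine ⟨?_, ?_, ?_, ?_⟩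
    · have : ((SignType.sign z.re : ℝ)) ^ 2 = 1 := by
        rcases lt_or_gt_of_ne hz0 with h | h <;> simp [h]
      rw [← Complex.ofReal_pow, mul_pow, this, Real.sq_sqrt h2.le, one_mul, ← hw']
    · simp
    · intro h
      rw [Complex.ofReal_re, sign_pos (lt_of_le_of_ne h hz0.symm)]
      simp
    · intro h
      rw [Complex.ofReal_re, sign_neg (lt_of_le_of_ne h hz0)]
      simp
  · rw [if_neg h]
    have hs : Complex.sqrt (-w) ^ 2 = -w := by simp [Complex.sqrt]
    have hsre : 0 ≤ (Complex.sqrt (-w)).re := by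
      rw [Complex.sqrt, Complex.cpow_inv_two_re]; positivity
    have hc : 0 < 1 - δ ^ 2 := by linarith
    refine ⟨?_, ?_, ?_, ?_⟩
    · rw [mul_pow, hs, Complex.I_sq]; ring
    · rwa [Complex.I_mul_im]
    · intro h0
      have hi : (-w).im ≤ 0 := by
        rw [Complex.neg_im, him]; have := mul_nonneg (mul_nonneg h0 hz) hc.le; linarith
      suffices (Complex.sqrt (-w)).im ≤ 0 by simpa using this
      rcases hi.lt_or_eq with hi | hi
      · rw [Complex.sqrt, Complex.cpow_inv_two_im_eq_neg_sqrt hi]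
        have := Real.sqrt_nonneg ((‖-w‖ - (-w).re) / 2); linarith
      · have hr : 0 ≤ (-w).re := by
          rw [Complex.neg_im, him, neg_eq_zero] at hi
          rcases mul_eq_zero.1 hi with hi | hi
          · rcases mul_eq_zero.1 hi with hi | hi
            · have : z.re = 0 := by linarith
              rw [Complex.neg_re, hre, this]
              nlinarith [sq_nonneg δ, mul_nonneg (sq_nonneg z.im) hc.le]
            · rw [Complex.neg_re]
              have := not_and.1 h hi
              linarith
          · exact absurd hi hc.ne'
        have hw2 : -w = (((-w).re : ℝ) : ℂ) := by
          apply Complex.ext <;> simp at hi ⊢; exact hi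
        rw [Complex.sqrt, Complex.cpow_inv_two_im_eq_sqrt hi.ge, hw2]
        simp only [Complex.norm_real, Complex.ofReal_re, Real.norm_of_nonneg hr]
        simp
    · intro h0
      have hi : 0 ≤ (-w).im := by
        rw [Complex.neg_im, him]
        have := mul_nonneg (mul_nonneg (neg_nonneg.2 h0) hz) hc.le; linarith
      suffices 0 ≤ (Complex.sqrt (-w)).im by simpa using this
      rw [Complex.sqrt, Complex.cpow_inv_two_im_eq_sqrt hi]
      exact Real.sqrt_nonneg _

lemma re_cos (w : ℂ) : (Complex.cos w).re = Real.cos w.re * Real.cosh w.im := by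
  rw [Complex.cos_eq]
  simp [Complex.cos_ofReal_re, Complex.cosh_ofReal_re]

lemma im_cos (w : ℂ) : (Complex.cos w).im = -(Real.sin w.re * Real.sinh w.im) := by
  rw [Complex.cos_eq]
  simp [Complex.sin_ofReal_re, Complex.sinh_ofReal_re]

lemma re_sin (w : ℂ) : (Complex.sin w).re = Real.sin w.re * Real.cosh w.im := by
  rw [Complex.sin_eq]
  simp [Complex.sin_ofReal_re, Complex.cosh_ofReal_re]

lemma im_sin (w : ℂ) : (Complex.sin w).im = Real.cos w.re * Real.sinh w.im := by
  rw [Complex.sin_eq]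
  simp [Complex.cos_ofReal_re, Complex.sinh_ofReal_re]

lemma re_tan (w : ℂ) : (Complex.tan w).re
    = Real.sin (2 * w.re) / 2 / Complex.normSq (Complex.cos w) := by
  have h := Real.cosh_sq w.im
  rw [Complex.tan, Complex.div_re, ← add_div, Real.sin_two_mul, re_cos, im_cos, re_sin, im_sin]
  congr 1
  linear_combination (Real.sin w.re * Real.cos w.re) * h

lemma im_tan (w : ℂ) : (Complex.tan w).im
    = Real.sinh w.im * Real.cosh w.im / Complex.normSq (Complex.cos w) := by
  have h := Real.sin_sq_add_cos_sq w.re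
  rw [Complex.tan, Complex.div_im, ← sub_div, re_cos, im_cos, re_sin, im_sin]
  congr 1
  linear_combination (Real.sinh w.im * Real.cosh w.im) * h

/-- The function `cos (x / N)` on the circle of length `2πN`. -/
noncomputable def cosC (N : ℝ) (x : AddCircle (2 * Real.pi * N)) : ℝ :=
  ((AddCircle.toCircle x : Circle) : ℂ).re

/-- The function `sin (x / N)` on the circle of length `2πN`. -/
noncomputable def sinC (N : ℝ) (x : AddCircle (2 * Real.pi * N)) : ℝ :=
  ((AddCircle.toCircle x : Circle) : ℂ).im

lemma coe_toCircle (N : ℝ) (x : AddCircle (2 * Real.pi * N)) :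
    ((AddCircle.toCircle x : Circle) : ℂ) = ⟨cosC N x, sinC N x⟩ := rfl

lemma toCircle_coe_real {N : ℝ} (hN : 0 < N) (x : ℝ) :
    ((AddCircle.toCircle (x : AddCircle (2 * Real.pi * N)) : Circle) : ℂ)
      = Complex.exp ((x / N : ℝ) * Complex.I) := by
  rw [AddCircle.toCircle_apply_mk, Circle.coe_exp]
  congr 3
  field_simp

lemma cosC_coe {N : ℝ} (hN : 0 < N) (x : ℝ) :
    cosC N (x : AddCircle (2 * Real.pi * N)) = Real.cos (x / N) := by
  rw [cosC, toCircle_coe_real hN, Complex.exp_ofReal_mul_I_re]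

lemma sinC_coe {N : ℝ} (hN : 0 < N) (x : ℝ) :
    sinC N (x : AddCircle (2 * Real.pi * N)) = Real.sin (x / N) := by
  rw [sinC, toCircle_coe_real hN, Complex.exp_ofReal_mul_I_im]

lemma continuous_cosC (N : ℝ) : Continuous (cosC N) :=
  Complex.continuous_re.comp (continuous_subtype_val.comp AddCircle.continuous_toCircle)

lemma continuous_sinC (N : ℝ) : Continuous (sinC N) :=
  Complex.continuous_im.comp (continuous_subtype_val.comp AddCircle.continuous_toCircle)

lemma cosC_sq_add_sinC_sq (N : ℝ) (x : AddCircle (2 * Real.pi * N)) :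
    cosC N x ^ 2 + sinC N x ^ 2 = 1 := by
  have := Circle.normSq_coe (AddCircle.toCircle x)
  rw [Complex.normSq_apply] at this
  rw [cosC, sinC]; linarith

lemma circle_ext {N : ℝ} (hN : 0 < N) {x y : AddCircle (2 * Real.pi * N)}
    (h1 : cosC N x = cosC N y) (h2 : sinC N x = sinC N y) : x = y := by
  apply AddCircle.injective_toCircle (by positivity : 2 * Real.pi * N ≠ 0)
  exact Subtype.ext (Complex.ext h1 h2)

@[simp] lemma cosC_zero (N : ℝ) : cosC N 0 = 1 := by simp [cosC]

@[simp] lemma sinC_zero (N : ℝ) : sinC N 0 = 0 := by simp [sinC]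

lemma cosC_neg (N : ℝ) (x : AddCircle (2 * Real.pi * N)) : cosC N (-x) = cosC N x := by
  simp [cosC, AddCircle.toCircle_neg]

lemma sinC_neg (N : ℝ) (x : AddCircle (2 * Real.pi * N)) : sinC N (-x) = -sinC N x := by
  simp [sinC, AddCircle.toCircle_neg]

lemma slitParam_pos {N ℓ : ℝ} (hN : 0 < N) (hℓ : 0 < ℓ) : 0 < slitParam N ℓ := by
  have h : 1 < Real.exp (ℓ / N) := Real.one_lt_exp_iff.2 (by positivity)
  rw [slitParam, sub_pos, div_lt_one (by positivity)]
  linarith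

lemma slitParam_lt_one (N ℓ : ℝ) : slitParam N ℓ < 1 := by
  rw [slitParam]
  have : 0 < 2 / (1 + Real.exp (ℓ / N)) := by positivity
  linarith

lemma slitParam_sq_lt_one {N ℓ : ℝ} (hN : 0 < N) (hℓ : 0 < ℓ) : slitParam N ℓ ^ 2 < 1 := by
  have h1 := slitParam_pos hN hℓ
  have h2 := slitParam_lt_one N ℓ
  nlinarith

/-- The slit map in the coordinate `cos (z / N)` is the affine map that fixes `-1` and has slope
`1 / (1 - δ²)`; moreover it preserves each of the two half-cylinders cut out by the real parts
`0` and `πN`. -/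
lemma slitMap_spec {N ℓ : ℝ} (hN : 0 < N) (hℓ : 0 < ℓ) {p : Cylinder N} (hp : 0 ≤ p.2) :
    0 ≤ (slitMap N ℓ p).2 ∧
    cosC N (slitMap N ℓ p).1 * Real.cosh ((slitMap N ℓ p).2 / N) + 1
      = (cosC N p.1 * Real.cosh (p.2 / N) + 1) / (1 - slitParam N ℓ ^ 2) ∧
    sinC N (slitMap N ℓ p).1 * Real.sinh ((slitMap N ℓ p).2 / N)
      = sinC N p.1 * Real.sinh (p.2 / N) / (1 - slitParam N ℓ ^ 2) ∧
    (0 ≤ sinC N p.1 → 0 ≤ sinC N (slitMap N ℓ p).1) ∧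
    (sinC N p.1 ≤ 0 → sinC N (slitMap N ℓ p).1 ≤ 0) := by
  have hδ := slitParam_sq_lt_one hN hℓ
  set δ := slitParam N ℓ with hδdef
  have hc : (0 : ℝ) < 1 - δ ^ 2 := by linarith
  have hcC : (1 - (δ : ℂ) ^ 2) ≠ 0 := by
    exact_mod_cast hc.ne'
  have hNC : (N : ℂ) ≠ 0 := by exact_mod_cast hN.ne'
  obtain ⟨X, y⟩ := p
  simp only at hp ⊢
  set x : ℝ := Quotient.out X with hx
  have hX : (x : AddCircle (2 * Real.pi * N)) = X := Quotient.out_eq X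
  set z : ℂ := ⟨x, y⟩ with hz
  set u : ℂ := z / (2 * N) with hu
  have hure : u.re = x / (2 * N) := by
    rw [hu, show (2 * (N : ℂ)) = ((2 * N : ℝ) : ℂ) by push_cast; rfl, Complex.div_ofReal_re]
  have huim : u.im = y / (2 * N) := by
    rw [hu, show (2 * (N : ℂ)) = ((2 * N : ℝ) : ℂ) by push_cast; rfl, Complex.div_ofReal_im]
  have hcosX : cosC N X = Real.cos (2 * u.re) := by
    rw [← hX, cosC_coe hN, hure]; congr 1; field_simp
  have hsinX : sinC N X = Real.sin (2 * u.re) := by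
    rw [← hX, sinC_coe hN, hure]; congr 1; field_simp
  have hy2 : y / N = 2 * u.im := by rw [huim]; field_simp
  have huim0 : 0 ≤ u.im := by rw [huim]; positivity
  have hS : slitMap N ℓ (X, y) = (((slitMapLift N ℓ z).re : AddCircle (2 * Real.pi * N)),
    (slitMapLift N ℓ z).im) := rfl
  rw [hS]
  simp only
  rw [cosC_coe hN, sinC_coe hN, hcosX, hsinX, hy2]
  unfold slitMapLift
  rw [← hu, ← hδdef]
  by_cases hcos : Complex.cos u = 0
  · have h1 : Complex.cos (2 * u) = -1 := by rw [Complex.cos_two_mul, hcos]; ring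
    have h1r := congrArg Complex.re h1
    have h1i := congrArg Complex.im h1
    rw [re_cos] at h1r
    rw [im_cos] at h1i
    simp only [Complex.mul_re, Complex.re_ofNat, Complex.im_ofNat, zero_mul, sub_zero,
      Complex.mul_im, add_zero, Complex.neg_re, Complex.one_re, Complex.neg_im, Complex.one_im,
      neg_zero] at h1r h1i
    rw [if_pos hcos]
    simp only [Complex.ofReal_re, Complex.ofReal_im, zero_div, Real.cosh_zero, Real.sinh_zero]
    have : Real.pi * N / N = Real.pi := by field_simp
    rw [this, h1r]
    rw [neg_eq_zero] at h1i
    simp [h1i]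
  · rw [if_neg hcos]
    set T := Complex.tan u with hT
    have hTim : 0 ≤ T.im := by
      rw [hT, im_tan]
      have := Real.sinh_nonneg_iff.2 huim0
      have := Real.cosh_pos u.im
      have := Complex.normSq_nonneg (Complex.cos u)
      positivity
    obtain ⟨k1, k2, k3, k4⟩ := halfPlaneSlitMap_spec hδ hTim
    set h := halfPlaneSlitMap δ T with hh
    set a := Complex.arctan h with ha
    have hTu : (1 + T ^ 2) * Complex.cos u ^ 2 = 1 := by
      rw [hT, Complex.tan, div_pow, add_mul, div_mul_cancel₀ _ (pow_ne_zero 2 hcos), one_mul,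
        Complex.cos_sq_add_sin_sq]
    have h1h : 1 + h ^ 2 = (1 - (δ : ℂ) ^ 2) * (1 + T ^ 2) := by rw [k1]; ring
    have h1h0 : 1 + h ^ 2 ≠ 0 := by
      rw [h1h]
      refine mul_ne_zero hcC ?_
      rintro h0; rw [h0, zero_mul] at hTu; exact zero_ne_one hTu
    have htan : Complex.tan a = h := by
      apply Complex.tan_arctan <;> rintro h0 <;> apply h1h0 <;> rw [h0] <;> simp
    have hcosa : Complex.cos a ≠ 0 := by
      intro h0
      have hh0 : h = 0 := by rw [← htan, Complex.tan, h0, div_zero]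
      have : a = 0 := by rw [ha, hh0]; simp [Complex.arctan]
      rw [this, Complex.cos_zero] at h0
      exact one_ne_zero h0
    have hTa : (1 + h ^ 2) * Complex.cos a ^ 2 = 1 := by
      rw [← htan, Complex.tan, div_pow, add_mul, div_mul_cancel₀ _ (pow_ne_zero 2 hcosa), one_mul,
        Complex.cos_sq_add_sin_sq]
    have hkey : Complex.cos (2 * a) + 1 = (Complex.cos (2 * u) + 1) / ((1 - δ ^ 2 : ℝ) : ℂ) := by
      push_cast
      rw [eq_div_iff hcC, Complex.cos_two_mul, Complex.cos_two_mul]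
      rw [h1h] at hTa
      linear_combination (2 * Complex.cos u ^ 2) * hTa
        - (2 * (1 - (δ : ℂ) ^ 2) * Complex.cos a ^ 2) * hTu
    have hl : 2 * (N : ℂ) * a = ((2 * N : ℝ) : ℂ) * a := by push_cast; rfl
    have hlre : (2 * (N : ℂ) * a).re / N = 2 * a.re := by
      rw [hl, Complex.re_ofReal_mul]; field_simp
    have hlim : (2 * (N : ℂ) * a).im / N = 2 * a.im := by
      rw [hl, Complex.im_ofReal_mul]; field_simp
    have hnsq : 0 < Complex.normSq (Complex.cos a) := Complex.normSq_pos.2 hcosa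
    have hnsu : 0 < Complex.normSq (Complex.cos u) := Complex.normSq_pos.2 hcos
    have haim : 0 ≤ a.im := by
      rw [← htan, im_tan] at k2
      by_contra hneg
      push Not at hneg
      have h1 := Real.sinh_neg_iff.2 hneg
      have h2 := Real.cosh_pos a.im
      have : Real.sinh a.im * Real.cosh a.im / Complex.normSq (Complex.cos a) < 0 :=
        div_neg_of_neg_of_pos (mul_neg_of_neg_of_pos h1 h2) hnsq
      linarith
    have hsre : h.re = Real.sin (2 * a.re) / 2 / Complex.normSq (Complex.cos a) := by
      rw [← htan, re_tan]
    have hTre : T.re = Real.sin (2 * u.re) / 2 / Complex.normSq (Complex.cos u) := re_tan u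
    rw [hlre, hlim]
    have hr := congrArg Complex.re hkey
    have hi := congrArg Complex.im hkey
    rw [Complex.div_ofReal_re] at hr
    rw [Complex.div_ofReal_im] at hi
    rw [Complex.add_re, Complex.add_re, re_cos, re_cos] at hr
    rw [Complex.add_im, Complex.add_im, im_cos, im_cos] at hi
    simp only [Complex.mul_re, Complex.re_ofNat, Complex.im_ofNat, zero_mul, sub_zero,
      Complex.mul_im, add_zero, Complex.one_re, Complex.one_im] at hr hi
    refine ⟨?_, hr, ?_, ?_, ?_⟩
    · rw [hl, Complex.im_ofReal_mul]; positivity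
    · rw [neg_div] at hi; linarith
    · intro h0
      have := k3 (by rw [hTre]; positivity)
      rw [hsre] at this
      by_contra hneg
      push Not at hneg
      have h3 : Real.sin (2 * a.re) / 2 / Complex.normSq (Complex.cos a) < 0 :=
        div_neg_of_neg_of_pos (by linarith) hnsq
      linarith
    · intro h0
      have := k4 (by
        rw [hTre]; exact div_nonpos_of_nonpos_of_nonneg (by linarith) hnsu.le)
      rw [hsre] at this
      by_contra hneg
      push Not at hneg
      have h3 : 0 < Real.sin (2 * a.re) / 2 / Complex.normSq (Complex.cos a) :=
        div_pos (by linarith) hnsq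
      linarith

/-! ### Injectivity, surjectivity and continuity of the slit map -/

lemma sqrt_ellipse_add {c s C S : ℝ} (hc : c ^ 2 + s ^ 2 = 1) (hC : 1 ≤ C)
    (hS : C ^ 2 - S ^ 2 = 1) : √((c * C + 1) ^ 2 + (s * S) ^ 2) = C + c := by
  rw [show (c * C + 1) ^ 2 + (s * S) ^ 2 = (C + c) ^ 2 by
    linear_combination (C ^ 2 - 1) * hc - s ^ 2 * hS, Real.sqrt_sq]
  nlinarith [sq_nonneg s]

lemma sqrt_ellipse_sub {c s C S : ℝ} (hc : c ^ 2 + s ^ 2 = 1) (hC : 1 ≤ C)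
    (hS : C ^ 2 - S ^ 2 = 1) : √((c * C - 1) ^ 2 + (s * S) ^ 2) = C - c := by
  rw [show (c * C - 1) ^ 2 + (s * S) ^ 2 = (C - c) ^ 2 by
    linear_combination (C ^ 2 - 1) * hc - s ^ 2 * hS, Real.sqrt_sq]
  nlinarith [sq_nonneg s]

/-- The real part of `cos (z / N)` on the cylinder. -/
noncomputable def reCos (N : ℝ) (p : Cylinder N) : ℝ := cosC N p.1 * Real.cosh (p.2 / N)

/-- The imaginary part of `-cos (z / N)` on the cylinder. -/
noncomputable def imCos (N : ℝ) (p : Cylinder N) : ℝ := sinC N p.1 * Real.sinh (p.2 / N)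

/-- The confocal coordinates: the distances of `cos (z / N)` from `-1` and `1` are
`cosh (y / N) ± cos (x / N)`. -/
lemma cosh_add_cosC (N : ℝ) (p : Cylinder N) :
    Real.cosh (p.2 / N) + cosC N p.1 = √((reCos N p + 1) ^ 2 + imCos N p ^ 2) :=
  (sqrt_ellipse_add (cosC_sq_add_sinC_sq N p.1) (Real.one_le_cosh _)
    (Real.cosh_sq_sub_sinh_sq _)).symm

lemma cosh_sub_cosC (N : ℝ) (p : Cylinder N) :
    Real.cosh (p.2 / N) - cosC N p.1 = √((reCos N p - 1) ^ 2 + imCos N p ^ 2) :=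
  (sqrt_ellipse_sub (cosC_sq_add_sinC_sq N p.1) (Real.one_le_cosh _)
    (Real.cosh_sq_sub_sinh_sq _)).symm

lemma cosh_div_inj {N : ℝ} (hN : 0 < N) {a b : ℝ} (ha : 0 ≤ a) (hb : 0 ≤ b)
    (h : Real.cosh (a / N) = Real.cosh (b / N)) : a = b := by
  have := Real.cosh_injOn (by simp; positivity : a / N ∈ Set.Ici 0) (by simp; positivity) h
  field_simp at this
  exact this

section
variable {N ℓ : ℝ} (hN : 0 < N) (hℓ : 0 < ℓ)
include hN

/-- The coordinate `cos (z / N)` is injective on the cylinder up to the reflection `x ↦ -x` of the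
bottom circle. -/
lemma eq_of_reCos_imCos {p q : Cylinder N} (hp : 0 ≤ p.2) (hq : 0 ≤ q.2)
    (h1 : reCos N p = reCos N q) (h2 : imCos N p = imCos N q) :
    p.2 = q.2 ∧ cosC N p.1 = cosC N q.1 ∧ (0 < p.2 → p = q) := by
  have e1 := cosh_add_cosC N p
  have e2 := cosh_sub_cosC N p
  rw [h1, h2, ← cosh_add_cosC] at e1
  rw [h1, h2, ← cosh_sub_cosC] at e2
  have hy : p.2 = q.2 := cosh_div_inj hN hp hq (by linarith)
  have hc : cosC N p.1 = cosC N q.1 := by linarith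
  refine ⟨hy, hc, fun h => ?_⟩
  refine Prod.ext (circle_ext hN hc ?_) hy
  have : 0 < Real.sinh (p.2 / N) := Real.sinh_pos_iff.2 (by positivity)
  unfold imCos at h2
  rw [← hy] at h2
  exact mul_right_cancel₀ this.ne' h2

include hℓ

lemma slitMap_snd_nonneg {p : Cylinder N} (hp : 0 ≤ p.2) : 0 ≤ (slitMap N ℓ p).2 :=
  (slitMap_spec hN hℓ hp).1

lemma reCos_slitMap {p : Cylinder N} (hp : 0 ≤ p.2) :
    reCos N (slitMap N ℓ p) = (reCos N p + 1) / (1 - slitParam N ℓ ^ 2) - 1 :=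
  eq_sub_of_add_eq (slitMap_spec hN hℓ hp).2.1

lemma imCos_slitMap {p : Cylinder N} (hp : 0 ≤ p.2) :
    imCos N (slitMap N ℓ p) = imCos N p / (1 - slitParam N ℓ ^ 2) :=
  (slitMap_spec hN hℓ hp).2.2.1

/-- The coordinate `cos (z / N)` and the choice of the half-cylinder determine the value of the
slit map. -/
lemma slitMap_unique {p q : Cylinder N} (hp : 0 ≤ p.2) (hq : 0 ≤ q.2)
    (h1 : reCos N q = (reCos N p + 1) / (1 - slitParam N ℓ ^ 2) - 1)
    (h2 : imCos N q = imCos N p / (1 - slitParam N ℓ ^ 2))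
    (h3 : 0 ≤ sinC N p.1 → 0 ≤ sinC N q.1) (h4 : sinC N p.1 ≤ 0 → sinC N q.1 ≤ 0) :
    slitMap N ℓ p = q := by
  obtain ⟨k1, -, -, k4, k5⟩ := slitMap_spec hN hℓ hp
  obtain ⟨hy, hc, -⟩ := eq_of_reCos_imCos hN k1 hq
    ((reCos_slitMap hN hℓ hp).trans h1.symm) ((imCos_slitMap hN hℓ hp).trans h2.symm)
  refine Prod.ext (circle_ext hN hc ?_) hy
  have e1 := cosC_sq_add_sinC_sq N (slitMap N ℓ p).1
  have e2 := cosC_sq_add_sinC_sq N q.1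
  rw [hc] at e1
  rcases le_total 0 (sinC N p.1) with h | h
  · exact (sq_eq_sq₀ (k4 h) (h3 h)).1 (by linarith)
  · have := (sq_eq_sq₀ (neg_nonneg.2 (k5 h)) (neg_nonneg.2 (h4 h))).1 (by nlinarith)
    linarith

lemma slitMap_snd_pos {p : Cylinder N} (hp : 0 < p.2) : 0 < (slitMap N ℓ p).2 := by
  refine lt_of_le_of_ne (slitMap_snd_nonneg hN hℓ hp.le) fun h0 => hp.ne ?_
  have hδ := slitParam_sq_lt_one hN hℓ
  have h1 := reCos_slitMap hN hℓ hp.le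
  have h2 := imCos_slitMap hN hℓ hp.le
  have hc : (0 : ℝ) < 1 - slitParam N ℓ ^ 2 := by linarith
  have hb : imCos N p = 0 := by
    have : imCos N (slitMap N ℓ p) = 0 := by rw [imCos, ← h0]; simp
    rw [this, eq_comm, div_eq_zero_iff] at h2
    exact h2.resolve_right hc.ne'
  have ha : reCos N p = (1 - slitParam N ℓ ^ 2) * (cosC N (slitMap N ℓ p).1 + 1) - 1 := by
    have : reCos N (slitMap N ℓ p) = cosC N (slitMap N ℓ p).1 := by rw [reCos, ← h0]; simp
    rw [this] at h1
    field_simp at h1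
    linarith
  have hcs := cosC_sq_add_sinC_sq N (slitMap N ℓ p).1
  have hcs1 : cosC N (slitMap N ℓ p).1 ≤ 1 := by nlinarith [sq_nonneg (sinC N (slitMap N ℓ p).1)]
  have hcs2 : -1 ≤ cosC N (slitMap N ℓ p).1 := by
    nlinarith [sq_nonneg (sinC N (slitMap N ℓ p).1)]
  have e1 := cosh_add_cosC N p
  have e2 := cosh_sub_cosC N p
  have hle1 : 0 ≤ reCos N p + 1 := by rw [ha]; nlinarith
  have hle2 : reCos N p - 1 ≤ 0 := by
    rw [ha]; nlinarith [sq_nonneg (slitParam N ℓ)]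
  rw [hb, zero_pow two_ne_zero, add_zero, Real.sqrt_sq hle1] at e1
  rw [hb, zero_pow two_ne_zero, add_zero, Real.sqrt_sq_eq_abs, abs_of_nonpos hle2] at e2
  have : Real.cosh (p.2 / N) = Real.cosh (0 / N) := by simp; linarith
  exact (cosh_div_inj hN hp.le le_rfl this).symm

lemma slitMap_eq_slitMap {p q : Cylinder N} (hp : 0 ≤ p.2) (hq : 0 ≤ q.2)
    (h : slitMap N ℓ p = slitMap N ℓ q) : p = q ∨ (p.2 = 0 ∧ q.2 = 0) := by
  have hδ := slitParam_sq_lt_one hN hℓ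
  have hc : (1 - slitParam N ℓ ^ 2) ≠ 0 := by linarith
  have h1 : reCos N p = reCos N q := by
    have := reCos_slitMap hN hℓ hp
    rw [h, reCos_slitMap hN hℓ hq] at this
    field_simp at this
    linarith
  have h2 : imCos N p = imCos N q := by
    have := imCos_slitMap hN hℓ hp
    rw [h, imCos_slitMap hN hℓ hq] at this
    field_simp at this
    linarith
  obtain ⟨e1, -, e3⟩ := eq_of_reCos_imCos hN hp hq h1 h2
  rcases hp.lt_or_eq with h | h
  · exact Or.inl (e3 h)
  · exact Or.inr ⟨h.symm, by rw [← e1, ← h]⟩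

lemma cosh_length : Real.cosh (ℓ / N) = 2 / (1 - slitParam N ℓ ^ 2) - 1 := by
  have hδ := slitParam_sq_lt_one hN hℓ
  have hc : (1 - slitParam N ℓ ^ 2) ≠ 0 := by linarith
  rw [eq_sub_iff_add_eq, eq_div_iff hc, Real.cosh_eq, Real.exp_neg, slitParam]
  have : 0 < Real.exp (ℓ / N) := Real.exp_pos _
  field_simp
  ring

/-- The slit map sends the bottom circle to its union with the slit above `0`. -/
lemma slitMap_base {p : Cylinder N} (hp : p.2 = 0) :
    (slitMap N ℓ p).2 = 0 ∨
      ((slitMap N ℓ p).1 = 0 ∧ 0 < (slitMap N ℓ p).2 ∧ (slitMap N ℓ p).2 ≤ ℓ) := by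
  have hδ := slitParam_sq_lt_one hN hℓ
  have hc : (0 : ℝ) < 1 - slitParam N ℓ ^ 2 := by linarith
  have h1 := reCos_slitMap hN hℓ hp.ge
  have h2 := imCos_slitMap hN hℓ hp.ge
  have hn := slitMap_snd_nonneg hN hℓ hp.ge
  set q := slitMap N ℓ p with hq
  rcases hn.lt_or_eq with hlt | h0
  swap
  · exact Or.inl h0.symm
  right
  have hb : imCos N p = 0 := by rw [imCos, hp]; simp
  have ha : reCos N p = cosC N p.1 := by rw [reCos, hp]; simp
  have hsinh : 0 < Real.sinh (q.2 / N) := Real.sinh_pos_iff.2 (by positivity)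
  have hs : sinC N q.1 = 0 := by
    rw [hb, zero_div, imCos] at h2
    exact (mul_eq_zero.1 h2).resolve_right hsinh.ne'
  have hcs := cosC_sq_add_sinC_sq N p.1
  have hcs1 : cosC N p.1 ≤ 1 := by nlinarith [sq_nonneg (sinC N p.1)]
  have hcs2 : -1 ≤ cosC N p.1 := by nlinarith [sq_nonneg (sinC N p.1)]
  have hcosh : 1 < Real.cosh (q.2 / N) := Real.one_lt_cosh.2 (by positivity)
  have hcq := cosC_sq_add_sinC_sq N q.1
  rw [hs] at hcq
  have hc1 : cosC N q.1 = 1 := by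
    have : (cosC N q.1 - 1) * (cosC N q.1 + 1) = 0 := by linarith
    rcases mul_eq_zero.1 this with h | h
    · linarith
    · exfalso
      have h3 : cosC N q.1 = -1 := by linarith
      rw [ha, reCos, h3] at h1
      have : 0 ≤ (cosC N p.1 + 1) / (1 - slitParam N ℓ ^ 2) := by
        apply div_nonneg _ hc.le; linarith
      linarith
  refine ⟨circle_ext hN (by simpa using hc1) (by simpa using hs), hlt, ?_⟩
  rw [ha, reCos, hc1, one_mul] at h1
  have h4 : Real.cosh (q.2 / N) ≤ Real.cosh (ℓ / N) := by
    rw [h1, cosh_length hN hℓ]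
    gcongr
    linarith
  rw [Real.cosh_le_cosh, abs_of_nonneg (by positivity), abs_of_nonneg (by positivity)] at h4
  exact (div_le_div_iff_of_pos_right hN).1 h4

omit hℓ in
lemma exists_circle {c s : ℝ} (h : c ^ 2 + s ^ 2 = 1) :
    ∃ x : AddCircle (2 * Real.pi * N), cosC N x = c ∧ sinC N x = s := by
  set z : ℂ := ⟨c, s⟩
  have hz : ‖z‖ = 1 := by
    rw [← sq_eq_sq₀ (norm_nonneg _) zero_le_one, Complex.sq_norm, Complex.normSq_mk]; linarith
  have e : Complex.exp (z.arg * Complex.I) = z := by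
    have := Complex.norm_mul_exp_arg_mul_I z
    rwa [hz, Complex.ofReal_one, one_mul] at this
  refine ⟨((N * z.arg : ℝ) : AddCircle (2 * Real.pi * N)), ?_⟩
  have h2 := toCircle_coe_real hN (N * z.arg)
  rw [show N * z.arg / N = z.arg by field_simp, e, coe_toCircle] at h2
  exact ⟨congrArg Complex.re h2, congrArg Complex.im h2⟩

/-- The whole slit is in the image of the bottom circle. -/
lemma exists_slitMap_eq_slit {y : ℝ} (h0 : 0 ≤ y) (h1 : y ≤ ℓ) :
    ∃ p : Cylinder N, p.2 = 0 ∧ slitMap N ℓ p = (0, y) := by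
  have hδ := slitParam_sq_lt_one hN hℓ
  have hc : (0 : ℝ) < 1 - slitParam N ℓ ^ 2 := by linarith
  have hle : Real.cosh (y / N) ≤ Real.cosh (ℓ / N) := by
    rw [Real.cosh_le_cosh, abs_of_nonneg (by positivity), abs_of_nonneg (by positivity)]
    gcongr
  rw [cosh_length hN hℓ, le_sub_iff_add_le, le_div_iff₀ hc] at hle
  have hge := Real.one_le_cosh (y / N)
  set c := (1 - slitParam N ℓ ^ 2) * (Real.cosh (y / N) + 1) - 1 with hcdef
  have hc1 : c ≤ 1 := by rw [hcdef]; linarith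
  have hc2 : -1 ≤ c := by rw [hcdef]; nlinarith
  obtain ⟨x, hx1, hx2⟩ := exists_circle hN (c := c) (s := √(1 - c ^ 2)) (by
    rw [Real.sq_sqrt (by nlinarith)]; ring)
  refine ⟨(x, 0), rfl, slitMap_unique hN hℓ le_rfl h0 ?_ ?_ ?_ ?_⟩
  · simp [reCos, hx1, hcdef]; field_simp; ring
  · simp [imCos]
  · simp
  · simp

/-- The whole bottom circle is in the image of the bottom circle. -/
lemma exists_slitMap_eq_base (x : AddCircle (2 * Real.pi * N)) :
    ∃ p : Cylinder N, p.2 = 0 ∧ slitMap N ℓ p = (x, 0) := by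
  have hδ := slitParam_sq_lt_one hN hℓ
  have hc : (0 : ℝ) < 1 - slitParam N ℓ ^ 2 := by linarith
  have hcs := cosC_sq_add_sinC_sq N x
  have hcs1 : cosC N x ≤ 1 := by nlinarith [sq_nonneg (sinC N x)]
  have hcs2 : -1 ≤ cosC N x := by nlinarith [sq_nonneg (sinC N x)]
  set c := (1 - slitParam N ℓ ^ 2) * (cosC N x + 1) - 1 with hcdef
  have hc1 : c ≤ 1 := by rw [hcdef]; nlinarith [sq_nonneg (slitParam N ℓ)]
  have hc2 : -1 ≤ c := by rw [hcdef]; nlinarith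
  have key : ∀ s, c ^ 2 + s ^ 2 = 1 → (0 ≤ s → 0 ≤ sinC N x) → (s ≤ 0 → sinC N x ≤ 0) →
      ∃ p : Cylinder N, p.2 = 0 ∧ slitMap N ℓ p = (x, 0) := by
    intro s hs h1 h2
    obtain ⟨x', hx1, hx2⟩ := exists_circle hN hs
    refine ⟨(x', 0), rfl, slitMap_unique hN hℓ le_rfl le_rfl ?_ ?_ ?_ ?_⟩
    · simp [reCos, hx1, hcdef]; field_simp; ring
    · simp [imCos]
    · simpa [hx2] using h1
    · simpa [hx2] using h2
  have hcc : 0 ≤ 1 - c ^ 2 := by nlinarith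
  -- as `c < 1`, the preimage has vanishing sine only where `cos x = -1`
  have hzero : c ^ 2 = 1 → sinC N x = 0 := by
    intro h
    have hcne : c ≠ 1 := by
      have := slitParam_pos hN hℓ
      rw [hcdef]; intro h; nlinarith [sq_nonneg (slitParam N ℓ), mul_pos this this]
    have : (c - 1) * (c + 1) = 0 := by linarith
    have h3 := (mul_eq_zero.1 this).resolve_left (sub_ne_zero.2 hcne)
    have h4 : (1 - slitParam N ℓ ^ 2) * (cosC N x + 1) = 0 := by linarith
    have h5 := (mul_eq_zero.1 h4).resolve_left hc.ne'
    have h6 : cosC N x = -1 := by linarith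
    rw [h6] at hcs
    exact pow_eq_zero_iff two_ne_zero |>.1 (by linarith)
  rcases le_total 0 (sinC N x) with h | h
  · refine key (√(1 - c ^ 2)) (by rw [Real.sq_sqrt hcc]; ring) (fun _ => h) fun h' => ?_
    have := Real.sqrt_eq_zero hcc |>.1 (le_antisymm h' (Real.sqrt_nonneg _))
    exact (hzero (by linarith)).le
  · refine key (-√(1 - c ^ 2)) (by rw [neg_sq, Real.sq_sqrt hcc]; ring) (fun h' => ?_) (fun _ => h)
    have := Real.sqrt_eq_zero hcc |>.1 (le_antisymm (by linarith) (Real.sqrt_nonneg _))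
    exact (hzero (by linarith)).ge

/-- The slit map is continuous on the closed cylinder: both real coordinates of
`cos (z / N)` are, and on each closed half-cylinder they determine the point continuously. -/
lemma continuousOn_slitMap : ContinuousOn (slitMap N ℓ) {p : Cylinder N | 0 ≤ p.2} := by
  have hδ := slitParam_sq_lt_one hN hℓ
  have hc : (1 - slitParam N ℓ ^ 2) ≠ 0 := by linarith
  set D := {p : Cylinder N | 0 ≤ p.2} with hD
  have hre : Continuous (reCos N) :=
    ((continuous_cosC N).comp continuous_fst).mul
      (Real.continuous_cosh.comp (continuous_snd.div_const N))
  have him : Continuous (imCos N) :=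
    ((continuous_sinC N).comp continuous_fst).mul
      (Real.continuous_sinh.comp (continuous_snd.div_const N))
  have hreS : ContinuousOn (fun p => reCos N (slitMap N ℓ p)) D := by
    refine ContinuousOn.congr (f := fun p => (reCos N p + 1) / (1 - slitParam N ℓ ^ 2) - 1) ?_
      fun p hp => reCos_slitMap hN hℓ hp
    exact (((hre.add continuous_const).div_const _).sub continuous_const).continuousOn
  have himS : ContinuousOn (fun p => imCos N (slitMap N ℓ p)) D := by
    refine ContinuousOn.congr (f := fun p => imCos N p / (1 - slitParam N ℓ ^ 2)) ?_
      fun p hp => imCos_slitMap hN hℓ hp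
    exact (him.div_const _).continuousOn
  have h1 : ContinuousOn (fun p => Real.cosh ((slitMap N ℓ p).2 / N) + cosC N (slitMap N ℓ p).1)
      D := by
    simp_rw [cosh_add_cosC]
    exact (((hreS.add continuousOn_const).pow 2).add (himS.pow 2)).sqrt
  have h2 : ContinuousOn (fun p => Real.cosh ((slitMap N ℓ p).2 / N) - cosC N (slitMap N ℓ p).1)
      D := by
    simp_rw [cosh_sub_cosC]
    exact (((hreS.sub continuousOn_const).pow 2).add (himS.pow 2)).sqrt
  have hcosh : ContinuousOn (fun p => Real.cosh ((slitMap N ℓ p).2 / N)) D := by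
    refine ((h1.add h2).div_const 2).congr fun p _ => ?_
    simp only [Pi.add_apply]; ring
  have hcos : ContinuousOn (fun p => cosC N (slitMap N ℓ p).1) D := by
    refine ((h1.sub h2).div_const 2).congr fun p _ => ?_
    simp only [Pi.sub_apply]; ring
  have hsnd : ContinuousOn (fun p => (slitMap N ℓ p).2) D := by
    have := (Real.continuousOn_arcosh.comp hcosh fun p _ => Real.one_le_cosh _).const_mul N
    refine this.congr fun p hp => ?_
    have := slitMap_snd_nonneg hN hℓ hp
    simp only [Function.comp]
    rw [Real.arcosh_cosh (by positivity)]
    field_simp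
  have hsq : ContinuousOn (fun p => √(1 - cosC N (slitMap N ℓ p).1 ^ 2)) D :=
    (continuousOn_const.sub (hcos.pow 2)).sqrt
  have hsin : ContinuousOn (fun p => sinC N (slitMap N ℓ p).1) D := by
    have hsplit : D = (D ∩ {p | 0 ≤ sinC N p.1}) ∪ (D ∩ {p | sinC N p.1 ≤ 0}) := by
      rw [← Set.inter_union_distrib_left]
      exact (Set.inter_eq_left.2 fun p _ => le_total 0 (sinC N p.1)).symm
    have hDc : IsClosed D := isClosed_le continuous_const continuous_snd
    have hs1 : Continuous fun p : Cylinder N => sinC N p.1 :=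
      (continuous_sinC N).comp continuous_fst
    rw [hsplit]
    refine ContinuousOn.union_of_isClosed ?_ ?_
      (hDc.inter (isClosed_le continuous_const hs1)) (hDc.inter (isClosed_le hs1 continuous_const))
    · refine (hsq.mono Set.inter_subset_left).congr fun p hp => ?_
      have h := (slitMap_spec hN hℓ hp.1).2.2.2.1 hp.2
      have := cosC_sq_add_sinC_sq N (slitMap N ℓ p).1
      simp only
      rw [show 1 - cosC N (slitMap N ℓ p).1 ^ 2 = sinC N (slitMap N ℓ p).1 ^ 2 by linarith,
        Real.sqrt_sq h]
    · refine (hsq.mono Set.inter_subset_left).neg.congr fun p hp => ?_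
      have h := (slitMap_spec hN hℓ hp.1).2.2.2.2 hp.2
      have := cosC_sq_add_sinC_sq N (slitMap N ℓ p).1
      simp only [Pi.neg_apply]
      rw [show 1 - cosC N (slitMap N ℓ p).1 ^ 2 = (-sinC N (slitMap N ℓ p).1) ^ 2 by linarith,
        Real.sqrt_sq (by linarith), neg_neg]
  have hfst : ContinuousOn (fun p => (slitMap N ℓ p).1) D := by
    have : Fact (0 < 2 * Real.pi * N) := ⟨by positivity⟩
    have hemb : Topology.IsInducing (fun x : AddCircle (2 * Real.pi * N) => (cosC N x, sinC N x)) :=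
      (((continuous_cosC N).prodMk (continuous_sinC N)).isClosedEmbedding fun x y h =>
        circle_ext hN (congrArg Prod.fst h) (congrArg Prod.snd h)).isInducing
    rw [hemb.continuousOn_iff]
    exact hcos.prodMk hsin
  exact hfst.prodMk hsnd

end

/-! ### Trees and their feet -/

/-- The conjugate by the rotation by `x` of a self-map `φ` of the circle. -/
def rot {G : Type*} [AddGroup G] (φ : G → G) (x y : G) : G := φ (y - x) + x

/-- The composition `rot φ (s 0) ∘ ⋯ ∘ rot φ (s (n - 1))`. -/
def footMap {G : Type*} [AddGroup G] (φ : G → G) (s : ℕ → G) : ℕ → G → G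
  | 0 => id
  | n + 1 => footMap φ s n ∘ rot φ (s n)

/-- The point of the bottom circle at which the tree of the `(n + 1)`-st particle is rooted, when
the particles arrive at `s 0, s 1, …` and `φ` is the motion of the circle under one slit map. -/
def foot {G : Type*} [AddGroup G] (φ : G → G) (s : ℕ → G) (n : ℕ) : G := footMap φ s n (s n)

/-- The motion of the bottom circle under the slit map, where all points that are mapped to the slit
are sent to its foot `0`. -/
noncomputable def collapse (N ℓ : ℝ) (y : AddCircle (2 * Real.pi * N)) :
    AddCircle (2 * Real.pi * N) := (slitMap N ℓ (y, 0)).1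

/-- The sequence of positions on the circle, indexed from `0`. -/
noncomputable def positions (N : ℝ) (x : ℕ → ℝ) (n : ℕ) : AddCircle (2 * Real.pi * N) :=
  (x (n + 1) : ℝ)

section
variable {N ℓ : ℝ} (hN : 0 < N) (hℓ : 0 < ℓ) (x : ℕ → ℝ)

lemma slitMapAt_snd (a : ℝ) (p : Cylinder N) :
    (slitMapAt N ℓ a p).2 = (slitMap N ℓ (p.1 - (a : AddCircle (2 * Real.pi * N)), p.2)).2 := by
  have : p - ((a : AddCircle (2 * Real.pi * N)), (0 : ℝ)) = (p.1 - a, p.2) :=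
    Prod.ext rfl (sub_zero _)
  simp only [slitMapAt, this, Prod.snd_add, add_zero]

lemma slitMapAt_fst (a : ℝ) (p : Cylinder N) : (slitMapAt N ℓ a p).1
      = (slitMap N ℓ (p.1 - (a : AddCircle (2 * Real.pi * N)), p.2)).1 + a := by
  have : p - ((a : AddCircle (2 * Real.pi * N)), (0 : ℝ)) = (p.1 - a, p.2) :=
    Prod.ext rfl (sub_zero _)
  simp only [slitMapAt, this, Prod.fst_add]

lemma slitMapAt_base_fst (a : ℝ) (y : AddCircle (2 * Real.pi * N)) :
    (slitMapAt N ℓ a (y, 0)).1 = rot (collapse N ℓ) a y := by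
  rw [slitMapAt_fst]; rfl

include hN hℓ

lemma continuous_collapse : Continuous (collapse N ℓ) := by
  have := (continuousOn_slitMap hN hℓ).comp_continuous
    (f := fun y : AddCircle (2 * Real.pi * N) => (y, (0 : ℝ))) (by fun_prop) (by simp)
  exact continuous_fst.comp this

lemma slitMapAt_snd_nonneg (a : ℝ) {p : Cylinder N} (hp : 0 ≤ p.2) :
    0 ≤ (slitMapAt N ℓ a p).2 := by
  rw [slitMapAt_snd]; exact slitMap_snd_nonneg hN hℓ hp

lemma slitMapAt_snd_pos (a : ℝ) {p : Cylinder N} (hp : 0 < p.2) :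
    0 < (slitMapAt N ℓ a p).2 := by
  rw [slitMapAt_snd]; exact slitMap_snd_pos hN hℓ hp

lemma slitMapAt_eq_slitMapAt (a : ℝ) {p q : Cylinder N} (hp : 0 ≤ p.2) (hq : 0 ≤ q.2)
    (h : slitMapAt N ℓ a p = slitMapAt N ℓ a q) : p = q ∨ (p.2 = 0 ∧ q.2 = 0) := by
  have h' := add_right_cancel h
  rcases slitMap_eq_slitMap hN hℓ (by simpa using hp) (by simpa using hq) h' with h | h
  · exact Or.inl (sub_left_inj.1 h)
  · exact Or.inr (by simpa using h)

/-- A point of the bottom circle is sent to the bottom circle or to the slit above `a`. -/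
lemma slitMapAt_base (a : ℝ) (y : AddCircle (2 * Real.pi * N)) :
    slitMapAt N ℓ a (y, 0) = (rot (collapse N ℓ) a y, 0) ∨
      (rot (collapse N ℓ) a y = a ∧ (slitMapAt N ℓ a (y, 0)).1 = a ∧
        0 < (slitMapAt N ℓ a (y, 0)).2 ∧ (slitMapAt N ℓ a (y, 0)).2 ≤ ℓ) := by
  have h1 := slitMapAt_base_fst (N := N) (ℓ := ℓ) a y
  have h2 := slitMapAt_snd (N := N) (ℓ := ℓ) a (y, 0)
  have h3 := slitMapAt_fst (N := N) (ℓ := ℓ) a (y, 0)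
  rcases slitMap_base hN hℓ (p := (y - (a : AddCircle (2 * Real.pi * N)), (0 : ℝ))) rfl
    with h | ⟨h, h', h''⟩
  · exact Or.inl (Prod.ext h1 (h2.trans h))
  · right
    rw [← h1, h2, h3, h]
    simp [h', h'']

lemma exists_slitMapAt_eq_slit (a : ℝ) {q : Cylinder N}
    (h0 : q.1 = (a : AddCircle (2 * Real.pi * N))) (h1 : 0 ≤ q.2) (h2 : q.2 ≤ ℓ) :
    ∃ y, slitMapAt N ℓ a (y, 0) = q := by
  obtain ⟨⟨y, z⟩, hz, h⟩ := exists_slitMap_eq_slit hN hℓ h1 h2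
  simp only at hz
  subst hz
  refine ⟨y + a, Prod.ext ?_ ?_⟩
  · rw [slitMapAt_fst]; simp [h, h0]
  · rw [slitMapAt_snd]; simp [h]

lemma exists_slitMapAt_eq_base (a : ℝ) (z : AddCircle (2 * Real.pi * N)) :
    ∃ y, slitMapAt N ℓ a (y, 0) = (z, 0) := by
  obtain ⟨⟨y, w⟩, hw, h⟩ := exists_slitMap_eq_base hN hℓ (z - a)
  simp only at hw
  subst hw
  refine ⟨y + a, Prod.ext ?_ ?_⟩
  · rw [slitMapAt_fst]; simp [h]
  · rw [slitMapAt_snd]; simp [h]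

lemma continuousOn_slitMapAt (a : ℝ) :
    ContinuousOn (slitMapAt N ℓ a) {p : Cylinder N | 0 ≤ p.2} := by
  refine ((continuousOn_slitMap hN hℓ).comp (by fun_prop) fun p hp => ?_).add continuousOn_const
  simpa using hp

lemma chl_snd_pos (n : ℕ) {p : Cylinder N} (hp : 0 < p.2) : 0 < (chl N ℓ x n p).2 := by
  induction n generalizing p with
  | zero => exact hp
  | succ n ih => exact ih (slitMapAt_snd_pos hN hℓ _ hp)

lemma continuousOn_chl (n : ℕ) : ContinuousOn (chl N ℓ x n) {p : Cylinder N | 0 ≤ p.2} := by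
  induction n with
  | zero => exact continuousOn_id
  | succ n ih =>
    exact ih.comp (continuousOn_slitMapAt hN hℓ _) fun p hp => slitMapAt_snd_nonneg hN hℓ _ hp

lemma continuous_footMap (s : ℕ → AddCircle (2 * Real.pi * N)) (n : ℕ) :
    Continuous (footMap (collapse N ℓ) s n) := by
  induction n with
  | zero => exact continuous_id
  | succ n ih =>
    refine ih.comp (((continuous_collapse hN hℓ).comp ?_).add continuous_const)
    fun_prop

/-- The process identifies only points of the bottom circle, and only such with the same foot. -/
lemma chl_eq_chl (n : ℕ) {p q : Cylinder N} (hp : 0 ≤ p.2) (hq : 0 ≤ q.2)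
    (h : chl N ℓ x n p = chl N ℓ x n q) :
    p = q ∨ (p.2 = 0 ∧ q.2 = 0 ∧ footMap (collapse N ℓ) (positions N x) n p.1
      = footMap (collapse N ℓ) (positions N x) n q.1) := by
  induction n generalizing p q with
  | zero => exact Or.inl h
  | succ n ih =>
    rcases ih (slitMapAt_snd_nonneg hN hℓ _ hp) (slitMapAt_snd_nonneg hN hℓ _ hq) h
      with h1 | ⟨h1, h2, h3⟩
    · rcases slitMapAt_eq_slitMapAt hN hℓ _ hp hq h1 with h2 | ⟨h2, h3⟩
      · exact Or.inl h2
      · right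
        refine ⟨h2, h3, congrArg (footMap _ _ n) ?_⟩
        obtain ⟨p1, p2⟩ := p
        obtain ⟨q1, q2⟩ := q
        simp only at h2 h3
        subst h2 h3
        have h4 := congrArg Prod.fst h1
        rw [slitMapAt_base_fst, slitMapAt_base_fst] at h4
        exact h4
    · right
      have hp0 : p.2 = 0 := by
        by_contra h0
        exact (slitMapAt_snd_pos hN hℓ _ (lt_of_le_of_ne hp (Ne.symm h0))).ne' h1
      have hq0 : q.2 = 0 := by
        by_contra h0
        exact (slitMapAt_snd_pos hN hℓ _ (lt_of_le_of_ne hq (Ne.symm h0))).ne' h2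
      refine ⟨hp0, hq0, ?_⟩
      obtain ⟨p1, p2⟩ := p
      obtain ⟨q1, q2⟩ := q
      simp only at hp0 hq0
      subst hp0 hq0
      rw [slitMapAt_base_fst, slitMapAt_base_fst] at h3
      exact h3

/-- Every point of the grown cluster lies on a particle with the same foot. -/
lemma exists_particle (n : ℕ) (y : AddCircle (2 * Real.pi * N))
    (h : (chl N ℓ x n (y, 0)).2 ≠ 0) :
    ∃ i < n, chl N ℓ x n (y, 0) ∈ particle N ℓ x i ∧
      footMap (collapse N ℓ) (positions N x) n y = foot (collapse N ℓ) (positions N x) i := by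
  induction n generalizing y with
  | zero => exact absurd rfl h
  | succ n ih =>
    rcases slitMapAt_base hN hℓ (x (n + 1)) y with h1 | ⟨h1, h2, h3, h4⟩
    · change (chl N ℓ x n (slitMapAt N ℓ (x (n + 1)) (y, 0))).2 ≠ 0 at h
      rw [h1] at h
      obtain ⟨i, hi, h2, h3⟩ := ih _ h
      refine ⟨i, by omega, ?_, h3⟩
      change chl N ℓ x n (slitMapAt N ℓ (x (n + 1)) (y, 0)) ∈ _
      rw [h1]; exact h2
    · exact ⟨n, by omega, ⟨_, ⟨h2, h3, h4⟩, rfl⟩, congrArg (footMap _ _ n) h1⟩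

/-- The image of the bottom circle only grows, and the feet are kept. -/
lemma exists_chl_eq_of_le {n m : ℕ} (hnm : n ≤ m) (y : AddCircle (2 * Real.pi * N)) :
    ∃ z, chl N ℓ x m (z, 0) = chl N ℓ x n (y, 0) ∧
      footMap (collapse N ℓ) (positions N x) m z
        = footMap (collapse N ℓ) (positions N x) n y := by
  induction m, hnm using Nat.le_induction with
  | base => exact ⟨y, rfl, rfl⟩
  | succ m _ ih =>
    obtain ⟨z, h1, h2⟩ := ih
    obtain ⟨w, hw⟩ := exists_slitMapAt_eq_base hN hℓ (x (m + 1)) z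
    refine ⟨w, ?_, ?_⟩
    · rw [← h1, ← hw]; rfl
    · rw [← h2]
      refine congrArg (footMap _ _ m) ?_
      have := slitMapAt_base_fst (N := N) (ℓ := ℓ) (x (m + 1)) w
      rw [hw] at this
      exact this.symm

/-- A particle stays in the cluster at all later times, above the same foot. -/
lemma exists_of_mem_particle {n k : ℕ} (hk : k < n) {q : Cylinder N}
    (hq : q ∈ particle N ℓ x k) :
    0 < q.2 ∧ ∃ y, chl N ℓ x n (y, 0) = q ∧ footMap (collapse N ℓ) (positions N x) n y
      = foot (collapse N ℓ) (positions N x) k := by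
  obtain ⟨p, ⟨h1, h2, h3⟩, rfl⟩ := hq
  refine ⟨chl_snd_pos hN hℓ x k h2, ?_⟩
  obtain ⟨y, hy⟩ := exists_slitMapAt_eq_slit hN hℓ (x (k + 1)) h1 h2.le h3
  obtain ⟨z, hz1, hz2⟩ := exists_chl_eq_of_le hN hℓ x (Nat.succ_le_of_lt hk) y
  refine ⟨z, ?_, ?_⟩
  · rw [hz1, ← hy]; rfl
  · rw [hz2]
    refine congrArg (footMap _ _ k) ?_
    have := slitMapAt_base_fst (N := N) (ℓ := ℓ) (x (k + 1)) y
    rw [hy, h1] at this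
    exact this.symm

omit hN hℓ in
lemma mem_forest_iff {n : ℕ} {q : Cylinder N} :
    q ∈ forest N ℓ x n ↔ q.2 ≠ 0 ∧ ∃ y, chl N ℓ x n (y, 0) = q := by
  constructor
  · rintro ⟨⟨⟨y, z⟩, hz, rfl⟩, h⟩
    simp only [base, Set.mem_ofPred_eq] at hz
    subst hz
    exact ⟨h, y, rfl⟩
  · rintro ⟨h, y, rfl⟩
    exact ⟨⟨(y, 0), rfl, rfl⟩, h⟩

lemma forest_mono {n m : ℕ} (hnm : n ≤ m) : forest N ℓ x n ⊆ forest N ℓ x m := by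
  intro q hq
  rw [mem_forest_iff] at hq ⊢
  obtain ⟨h, y, rfl⟩ := hq
  obtain ⟨z, hz, -⟩ := exists_chl_eq_of_le hN hℓ x hnm y
  exact ⟨h, z, hz⟩

lemma particle_subset_forest {n k : ℕ} (hk : k < n) : particle N ℓ x k ⊆ forest N ℓ x n := by
  intro q hq
  obtain ⟨h, y, hy, -⟩ := exists_of_mem_particle hN hℓ x hk hq
  exact (mem_forest_iff x).2 ⟨h.ne', y, hy⟩

omit hN in
lemma particle_nonempty (k : ℕ) : (particle N ℓ x k).Nonempty :=
  ⟨_, ⟨((x (k + 1) : ℝ), ℓ), ⟨rfl, hℓ, le_rfl⟩, rfl⟩⟩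

/-- Particles in the same tree have the same foot: the points of the cluster above a given foot
form a compact set, and those above different feet are disjoint. -/
lemma foot_eq_of_sameTree {j k : ℕ} (h : SameTree N ℓ x j k) :
    foot (collapse N ℓ) (positions N x) j = foot (collapse N ℓ) (positions N x) k := by
  have : Fact (0 < 2 * Real.pi * N) := ⟨by positivity⟩
  obtain ⟨n, T, ⟨p, hp, rfl⟩, hj, hk⟩ := h
  set Φ := footMap (collapse N ℓ) (positions N x)
  set r := foot (collapse N ℓ) (positions N x)
  set m := max n (max (j + 1) (k + 1)) with hm
  have hjm : j < m := by omega
  have hkm : k < m := by omega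
  have hT : connectedComponentIn (forest N ℓ x n) p ⊆ connectedComponentIn (forest N ℓ x m) p :=
    connectedComponentIn_mono p (forest_mono hN hℓ x (by omega))
  set T := connectedComponentIn (forest N ℓ x m) p
  have hcont : Continuous fun y : AddCircle (2 * Real.pi * N) => chl N ℓ x m (y, 0) :=
    (continuousOn_chl hN hℓ x m).comp_continuous (by fun_prop) (by simp)
  set above : AddCircle (2 * Real.pi * N) → Set (Cylinder N) :=
    fun a => (fun y => chl N ℓ x m (y, 0)) '' {y | Φ m y = a} with habove
  have hclosed : ∀ a, IsClosed (above a) := fun a =>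
    ((isClosed_singleton.preimage (continuous_footMap hN hℓ _ m)).isCompact.image hcont).isClosed
  by_contra hne
  have hpre : IsPreconnected T := isPreconnected_connectedComponentIn
  rw [isPreconnected_closed_iff] at hpre
  obtain ⟨a, ha⟩ := particle_nonempty hℓ x j
  obtain ⟨b, hb⟩ := particle_nonempty hℓ x k
  have hfin : IsClosed (⋃ i ∈ {i ∈ Finset.range m | r i ≠ r j}, above (r i)) :=
    isClosed_biUnion_finset fun i _ => hclosed _
  obtain ⟨q, hqT, ⟨y, hy, hyq⟩, hq2⟩ := hpre (above (r j)) _ (hclosed _) hfin (by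
      intro q hq
      have := connectedComponentIn_subset _ _ hq
      obtain ⟨h1, y, rfl⟩ := (mem_forest_iff x).1 this
      obtain ⟨i, hi, -, h3⟩ := exists_particle hN hℓ x m y h1
      by_cases hij : r i = r j
      · exact Or.inl ⟨y, h3.trans hij, rfl⟩
      · right
        simp only [Set.mem_iUnion]
        exact ⟨i, by simp [hi, hij], y, h3, rfl⟩)
    (by
      obtain ⟨-, y, hy1, hy2⟩ := exists_of_mem_particle hN hℓ x hjm ha
      exact ⟨a, hT (hj ha), y, hy2, hy1⟩)
    (by
      obtain ⟨-, y, hy1, hy2⟩ := exists_of_mem_particle hN hℓ x hkm hb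
      refine ⟨b, hT (hk hb), ?_⟩
      simp only [Set.mem_iUnion]
      exact ⟨k, by simp [hkm, Ne.symm hne], y, hy2, hy1⟩)
  simp only [Set.mem_iUnion] at hq2
  obtain ⟨i, hi, z, hz, hzq⟩ := hq2
  simp only [Finset.mem_range, Finset.mem_filter] at hi
  apply hi.2
  rw [← show Φ m y = r j from hy, ← show Φ m z = r i from hz]
  rcases chl_eq_chl hN hℓ x m (p := (y, 0)) (q := (z, 0)) le_rfl le_rfl (hyq.trans hzq.symm)
    with h | ⟨-, -, h⟩
  · rw [show y = z from congrArg Prod.fst h]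
  · exact h.symm

/-- The position sequence is generic: a particle that is attached to an old foot is attached to the
tree above it, and not to the foot itself. -/
def Generic (N ℓ : ℝ) (x : ℕ → ℝ) : Prop :=
  ∀ n, ∀ k < n, foot (collapse N ℓ) (positions N x) k = foot (collapse N ℓ) (positions N x) n →
    (chl N ℓ x n (positions N x n, 0)).2 ≠ 0

lemma isPreconnected_slit_image (n : ℕ) :
    IsPreconnected (chl N ℓ x n '' {p | p.1 = positions N x n ∧ 0 ≤ p.2 ∧ p.2 ≤ ℓ}) := by
  have h : {p : Cylinder N | p.1 = positions N x n ∧ 0 ≤ p.2 ∧ p.2 ≤ ℓ}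
      = (fun t : ℝ => (positions N x n, t)) '' Set.Icc 0 ℓ := by
    ext ⟨a, b⟩
    simp only [Set.mem_ofPred_eq, Set.mem_image, Set.mem_Icc, Prod.mk.injEq]
    constructor
    · rintro ⟨rfl, h⟩; exact ⟨b, h, rfl, rfl⟩
    · rintro ⟨t, h, rfl, rfl⟩; exact ⟨rfl, h⟩
  refine IsPreconnected.image ?_ _ ((continuousOn_chl hN hℓ x n).mono fun p hp => hp.2.1)
  rw [h]
  exact isPreconnected_Icc.image _ (by fun_prop)

lemma isPreconnected_particle (n : ℕ) : IsPreconnected (particle N ℓ x n) := by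
  have h : {p : Cylinder N | p.1 = positions N x n ∧ 0 < p.2 ∧ p.2 ≤ ℓ}
      = (fun t : ℝ => (positions N x n, t)) '' Set.Ioc 0 ℓ := by
    ext ⟨a, b⟩
    simp only [Set.mem_ofPred_eq, Set.mem_image, Set.mem_Ioc, Prod.mk.injEq]
    constructor
    · rintro ⟨rfl, h⟩; exact ⟨b, h, rfl, rfl⟩
    · rintro ⟨t, h, rfl, rfl⟩; exact ⟨rfl, h⟩
  refine IsPreconnected.image ?_ _ ((continuousOn_chl hN hℓ x n).mono fun p hp => hp.2.1.le)
  change IsPreconnected {p : Cylinder N | p.1 = positions N x n ∧ 0 < p.2 ∧ p.2 ≤ ℓ}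
  rw [h]
  exact isPreconnected_Ioc.image _ (by fun_prop)

/-- Two particles with the same foot are joined by a connected part of the cluster: by genericity
the slit of a later particle grows, foot included, out of an earlier particle with this foot. -/
lemma exists_preconnected (hg : Generic N ℓ x) (n : ℕ) : ∀ j < n, ∀ k < n,
    foot (collapse N ℓ) (positions N x) j = foot (collapse N ℓ) (positions N x) k →
    ∃ D ⊆ forest N ℓ x n, IsPreconnected D ∧ particle N ℓ x j ⊆ D ∧ particle N ℓ x k ⊆ D := by
  induction n with
  | zero => intro j hj; omega
  | succ n ih =>
    have key : ∀ k < n, foot (collapse N ℓ) (positions N x) k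
        = foot (collapse N ℓ) (positions N x) n →
        ∃ D ⊆ forest N ℓ x (n + 1), IsPreconnected D ∧ particle N ℓ x n ⊆ D ∧
          particle N ℓ x k ⊆ D := by
      intro k hk hkn
      have he := hg n k hk hkn
      obtain ⟨i, hi, h1, h2⟩ := exists_particle hN hℓ x n _ he
      obtain ⟨D, hD, hDc, hDi, hDk⟩ := ih i hi k hk (h2.symm.trans hkn.symm)
      refine ⟨D ∪ chl N ℓ x n '' {p | p.1 = positions N x n ∧ 0 ≤ p.2 ∧ p.2 ≤ ℓ},
        Set.union_subset (hD.trans (forest_mono hN hℓ x n.le_succ)) ?_,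
        hDc.union _ (hDi h1) ⟨_, ⟨rfl, le_rfl, hℓ.le⟩, rfl⟩ (isPreconnected_slit_image hN hℓ x n),
        ?_, hDk.trans Set.subset_union_left⟩
      · rintro _ ⟨p, ⟨hp1, hp2, hp3⟩, rfl⟩
        rcases hp2.lt_or_eq with h | h
        · exact particle_subset_forest hN hℓ x n.lt_succ_self ⟨p, ⟨hp1, h, hp3⟩, rfl⟩
        · have : p = (positions N x n, 0) := Prod.ext hp1 h.symm
          rw [this]
          exact forest_mono hN hℓ x n.le_succ ((mem_forest_iff x).2 ⟨he, _, rfl⟩)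
      · rintro _ ⟨p, ⟨hp1, hp2, hp3⟩, rfl⟩
        exact Or.inr ⟨p, ⟨hp1, hp2.le, hp3⟩, rfl⟩
    intro j hj k hk hjk
    rcases Nat.lt_succ_iff_lt_or_eq.1 hj with hj | rfl <;>
      rcases Nat.lt_succ_iff_lt_or_eq.1 hk with hk | rfl
    · obtain ⟨D, hD, h⟩ := ih j hj k hk hjk
      exact ⟨D, hD.trans (forest_mono hN hℓ x n.le_succ), h⟩
    · obtain ⟨D, hD, h1, h2, h3⟩ := key j hj hjk
      exact ⟨D, hD, h1, h3, h2⟩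
    · exact key k hk hjk.symm
    · exact ⟨_, particle_subset_forest hN hℓ x hj, isPreconnected_particle hN hℓ x _,
        subset_rfl, subset_rfl⟩

/-- The trees of a generic cluster are classified by their feet. -/
lemma sameTree_iff (hg : Generic N ℓ x) {j k : ℕ} : SameTree N ℓ x j k ↔
    foot (collapse N ℓ) (positions N x) j = foot (collapse N ℓ) (positions N x) k := by
  refine ⟨foot_eq_of_sameTree hN hℓ x, fun h => ?_⟩
  obtain ⟨D, hD, hDc, hj, hk⟩ := exists_preconnected hN hℓ x hg (max j k + 1) j (by omega) k
    (by omega) h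
  obtain ⟨a, ha⟩ := particle_nonempty hℓ x j
  have := hDc.subset_connectedComponentIn (hj ha) hD
  exact ⟨_, _, ⟨a, hD (hj ha), rfl⟩, hj.trans this, hk.trans this⟩

end

/-! ### Sequences of independent positions -/

/-- The sequence with first entry `q.1` followed by the entries of `q.2`. -/
def consSeq {G : Type*} (q : G × (ℕ → G)) : ℕ → G
  | 0 => q.1
  | n + 1 => q.2 n

section
variable {G : Type*} [AddCommGroup G] (φ : G → G)

lemma footMap_succ_shift (s : ℕ → G) (n : ℕ) (y : G) :
    footMap φ s (n + 1) y = rot φ (s 0) (footMap φ (fun i => s (i + 1)) n y) := by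
  induction n generalizing y with
  | zero => rfl
  | succ n ih => exact ih (rot φ (s (n + 1)) y)

lemma foot_consSeq_zero (q : G × (ℕ → G)) : foot φ (consSeq q) 0 = q.1 := rfl

lemma foot_consSeq_succ (q : G × (ℕ → G)) (n : ℕ) :
    foot φ (consSeq q) (n + 1) = rot φ q.1 (foot φ q.2 n) :=
  footMap_succ_shift φ _ n _

variable [MeasurableSpace G]

omit [AddCommGroup G] in
lemma measurable_consSeq : Measurable (consSeq : G × (ℕ → G) → ℕ → G) := by
  refine measurable_pi_iff.2 fun n => ?_
  cases n with
  | zero => exact measurable_fst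
  | succ n => exact (measurable_pi_apply n).comp measurable_snd

variable (m : Measure G) [IsProbabilityMeasure m]

/-- The law of a sequence of independent random variables with law `m`. -/
noncomputable abbrev seqLaw {G : Type*} [MeasurableSpace G] (m : Measure G)
    [IsProbabilityMeasure m] : Measure (ℕ → G) := Measure.infinitePi fun _ : ℕ => m

omit [AddCommGroup G] in
lemma measurePreserving_consSeq :
    MeasurePreserving (consSeq : G × (ℕ → G) → ℕ → G) (m.prod (seqLaw m)) (seqLaw m) := by
  refine ⟨measurable_consSeq, Measure.eq_infinitePi _ fun s t ht => ?_⟩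
  classical
  obtain ⟨n, hn⟩ := s.exists_nat_subset_range
  set t' : ℕ → Set G := fun i => if i ∈ s then t i else Set.univ with ht'
  have ht'm : ∀ i, MeasurableSet (t' i) := by
    intro i; simp only [ht']; split_ifs
    exacts [ht i, MeasurableSet.univ]
  have h1 : Set.pi (s : Set ℕ) t = Set.pi (Finset.range (n + 1) : Set ℕ) t' := by
    ext f
    simp only [Set.mem_pi, Finset.mem_coe, ht']
    constructor
    · intro h i _
      split_ifs with hi
      exacts [h i hi, trivial]
    · intro h i hi
      have := h i (Finset.range_mono n.le_succ (hn hi))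
      rwa [if_pos hi] at this
  have h2 : ∏ i ∈ s, m (t i) = ∏ i ∈ Finset.range (n + 1), m (t' i) := by
    rw [← Finset.prod_subset (hn.trans (Finset.range_mono n.le_succ))]
    · exact Finset.prod_congr rfl fun i hi => by simp [ht', hi]
    · intro i _ hi; simp [ht', hi]
  rw [h1, h2, Measure.map_apply measurable_consSeq
    (MeasurableSet.pi (Set.to_countable _) fun i _ => ht'm i)]
  have h3 : (consSeq : G × (ℕ → G) → ℕ → G) ⁻¹' Set.pi (Finset.range (n + 1) : Set ℕ) t'
      = t' 0 ×ˢ Set.pi (Finset.range n : Set ℕ) (fun i => t' (i + 1)) := by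
    ext ⟨x, s⟩
    simp only [Set.mem_preimage, Set.mem_pi, Finset.coe_range, Set.mem_Iio, Set.mem_prod]
    constructor
    · intro h
      exact ⟨h 0 (by omega), fun i hi => h (i + 1) (by omega)⟩
    · rintro ⟨h0, h⟩ i hi
      cases i with
      | zero => exact h0
      | succ i => exact h i (by omega)
  rw [h3, Measure.prod_prod, Measure.infinitePi_pi _ fun i _ => ht'm _, Finset.prod_range_succ',
    mul_comm]

omit [AddCommGroup G] in
lemma seqLaw_apply {E : Set (ℕ → G)} (hE : MeasurableSet E) :
    seqLaw m E = ∫⁻ x, seqLaw m {s | consSeq (x, s) ∈ E} ∂m := by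
  rw [← (measurePreserving_consSeq m).measure_preimage hE.nullMeasurableSet,
    Measure.prod_apply (measurable_consSeq hE)]
  rfl

variable [MeasurableAdd₂ G] [MeasurableSub₂ G]

variable {φ} in
lemma measurable_rot (hφ : Measurable φ) : Measurable fun q : G × G => rot φ q.1 q.2 :=
  (hφ.comp (measurable_snd.sub measurable_fst)).add measurable_fst

variable {φ} in
lemma measurable_footMap (hφ : Measurable φ) (n : ℕ) :
    Measurable fun q : (ℕ → G) × G => footMap φ q.1 n q.2 := by
  induction n with
  | zero => exact measurable_snd
  | succ n ih =>
    exact ih.comp (measurable_fst.prodMk ((measurable_rot hφ).comp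
      (((measurable_pi_apply n).comp measurable_fst).prodMk measurable_snd)))

variable {φ} in
lemma measurable_foot (hφ : Measurable φ) (n : ℕ) : Measurable fun s : ℕ → G => foot φ s n :=
  (measurable_footMap hφ n).comp (measurable_id.prodMk (measurable_pi_apply n))

variable [m.IsAddLeftInvariant]

omit [IsProbabilityMeasure m] [MeasurableSub₂ G] in
variable {φ} in
lemma measure_rot_preimage (hφ : Measurable φ) (x : G) {A : Set G} (hA : MeasurableSet A) :
    m (rot φ x ⁻¹' A) = m ((fun u => φ u + x) ⁻¹' A) := by
  have := (measurePreserving_sub_right m x).measure_preimage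
    (s := (fun u => φ u + x) ⁻¹' A) ((hφ.add_const x) hA).nullMeasurableSet
  rw [← this]
  rfl

omit [MeasurableSub₂ G] in
/-- The harmonic measure of a set is preserved on average, by translation invariance. -/
lemma lintegral_measure_rot_preimage {φ : G → G} (hφ : Measurable φ) {A : Set G}
    (hA : MeasurableSet A) : ∫⁻ x, m (rot φ x ⁻¹' A) ∂m = m A := by
  simp_rw [measure_rot_preimage m hφ _ hA]
  have hE : MeasurableSet ((fun q : G × G => φ q.2 + q.1) ⁻¹' A) :=
    ((hφ.comp measurable_snd).add measurable_fst) hA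
  have h1 := Measure.prod_apply (μ := m) (ν := m) hE
  have h2 := Measure.prod_apply_symm (μ := m) (ν := m) hE
  calc _ = (m.prod m) ((fun q : G × G => φ q.2 + q.1) ⁻¹' A) := h1.symm
    _ = ∫⁻ u, m ((fun x => φ u + x) ⁻¹' A) ∂m := h2
    _ = ∫⁻ _, m A ∂m := by simp_rw [measure_preimage_add]
    _ = m A := by simp

variable {m}

/-- An arc of harmonic measure `m A` is ever hit with probability at most `m A / p`, where `p` is
the harmonic measure of a new particle: when it is hit, its harmonic measure jumps above `p`. -/
lemma seqLaw_hit_le {φ : G → G} (hφ : Measurable φ) {A : Set G} (hA : MeasurableSet A) {p : ℝ≥0∞}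
    (hp : p ≤ m (φ ⁻¹' {0})) :
    seqLaw m {s | ∃ n, foot φ s n ∈ A} * p ≤ m A := by
  have key : ∀ k, ∀ A : Set G, MeasurableSet A →
      seqLaw m {s | ∃ n < k, foot φ s n ∈ A} * p ≤ m A := by
    intro k
    induction k with
    | zero => intro A _; simp
    | succ k ih =>
      intro A hA
      have hE : MeasurableSet {s : ℕ → G | ∃ n < k + 1, foot φ s n ∈ A} := by
        simp only [Set.ofPred_exists, Set.ofPred_and]
        exact MeasurableSet.iUnion fun n => (MeasurableSet.const _).inter (measurable_foot hφ n hA)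
      rw [seqLaw_apply m hE, ← lintegral_measure_rot_preimage m hφ hA]
      refine (lintegral_mul_const_le _ _).trans (lintegral_mono fun x => ?_)
      by_cases hx : x ∈ A
      · calc _ ≤ 1 * p := by gcongr; exact prob_le_one
          _ ≤ m (φ ⁻¹' {0}) := by rwa [one_mul]
          _ ≤ m ((fun u => φ u + x) ⁻¹' A) := by
            refine measure_mono fun u hu => ?_
            have : φ u = 0 := hu
            simpa [this] using hx
          _ = _ := (measure_rot_preimage m hφ x hA).symm
      · refine le_trans ?_ (ih (rot φ x ⁻¹' A) ((measurable_rot hφ).comp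
          (measurable_const.prodMk measurable_id) hA))
        gcongr
        rintro ⟨n, hn, h⟩
        cases n with
        | zero => exact absurd h hx
        | succ n =>
          rw [foot_consSeq_succ] at h
          exact ⟨n, by omega, h⟩
  have hU : {s : ℕ → G | ∃ n, foot φ s n ∈ A} = ⋃ k, {s | ∃ n < k, foot φ s n ∈ A} := by
    ext s
    simp only [Set.mem_ofPred_eq, Set.mem_iUnion]
    exact ⟨fun ⟨n, hn⟩ => ⟨n + 1, n, n.lt_succ_self, hn⟩, fun ⟨_, n, _, hn⟩ => ⟨n, hn⟩⟩
  rw [hU, Monotone.measure_iUnion, ENNReal.iSup_mul]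
  · exact iSup_le fun k => key k A hA
  · rintro a b hab s ⟨n, hn, h⟩
    exact ⟨n, hn.trans_le hab, h⟩

end

/-! ### The variance of the harmonic measure in one step -/

section
variable {G : Type*} [AddCommGroup G] [MeasurableSpace G] [MeasurableAdd₂ G] [MeasurableSub₂ G]
  {m : Measure G} [IsProbabilityMeasure m] [m.IsAddLeftInvariant] {φ : G → G}

omit [IsProbabilityMeasure m] [m.IsAddLeftInvariant] in
lemma measurableSet_rot_preimage (hφ : Measurable φ) (x : G) {A : Set G} (hA : MeasurableSet A) :
    MeasurableSet (rot φ x ⁻¹' A) :=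
  ((measurable_rot hφ).comp (measurable_const.prodMk measurable_id)) hA

omit [m.IsAddLeftInvariant] in
lemma measurable_measureReal_rot (hφ : Measurable φ) {A : Set G} (hA : MeasurableSet A) :
    Measurable fun x => m.real (rot φ x ⁻¹' A) :=
  (measurable_measure_prodMk_left ((measurable_rot hφ) hA)).ennreal_toReal

omit [m.IsAddLeftInvariant] [AddCommGroup G] [MeasurableAdd₂ G] [MeasurableSub₂ G] in
lemma integrable_of_measurable_of_abs_le {f : G → ℝ} (hf : Measurable f) {c : ℝ}
    (h : ∀ x, |f x| ≤ c) : Integrable f m :=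
  Integrable.of_bound hf.aestronglyMeasurable c (Filter.Eventually.of_forall h)

lemma integral_measureReal_rot (hφ : Measurable φ) {A : Set G} (hA : MeasurableSet A) :
    ∫ x, m.real (rot φ x ⁻¹' A) ∂m = m.real A := by
  have h := lintegral_measure_rot_preimage m hφ hA
  rw [Measure.real, ← h]
  exact integral_toReal (measurable_measure_prodMk_left ((measurable_rot hφ) hA)).aemeasurable
    (Filter.Eventually.of_forall fun x => measure_lt_top _ _)

/-- The mean of `M (1 - M)` after one step is its old value minus the variance of the step. -/
lemma integral_mul_one_sub (hφ : Measurable φ) {A : Set G} (hA : MeasurableSet A) :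
    ∫ x, m.real (rot φ x ⁻¹' A) * (1 - m.real (rot φ x ⁻¹' A)) ∂m
      = m.real A * (1 - m.real A) - ∫ x, (m.real (rot φ x ⁻¹' A) - m.real A) ^ 2 ∂m := by
  have hM := measurable_measureReal_rot (m := m) hφ hA
  set M : G → ℝ := fun x => m.real (rot φ x ⁻¹' A) with hMdef
  set a := m.real A
  have h0 : ∀ x, 0 ≤ M x := fun x => measureReal_nonneg
  have h1 : ∀ x, M x ≤ 1 := fun x => measureReal_le_one
  have ha0 : 0 ≤ a := measureReal_nonneg
  have ha1 : a ≤ 1 := measureReal_le_one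
  have hi : Integrable M m := integrable_of_measurable_of_abs_le hM (c := 1) fun x => by
    rw [abs_of_nonneg (h0 x)]; exact h1 x
  have hi2 : Integrable (fun x => (M x - a) ^ 2) m :=
    integrable_of_measurable_of_abs_le ((hM.sub_const a).pow_const 2) (c := 1) fun x => by
      rw [abs_of_nonneg (sq_nonneg _)]; have := h0 x; have := h1 x; nlinarith
  have e : ∀ x, M x * (1 - M x) = a * (1 - a) + (1 - 2 * a) * (M x - a) - (M x - a) ^ 2 := by
    intro x; ring
  change ∫ x, M x * (1 - M x) ∂m = _
  simp_rw [e]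
  have hi3 : Integrable (fun x => (1 - 2 * a) * (M x - a)) m :=
    (hi.sub (integrable_const a)).const_mul _
  have hm : ∫ x, (M x - a) ∂m = 0 := by
    rw [integral_sub hi (integrable_const a), integral_measureReal_rot hφ hA]
    simp [a]
  have hm2 : ∫ x, (1 - 2 * a) * (M x - a) ∂m = 0 := by rw [integral_const_mul, hm, mul_zero]
  rw [integral_sub (f := fun x => a * (1 - a) + (1 - 2 * a) * (M x - a))
    ((integrable_const _).add hi3) hi2, integral_add (integrable_const _) hi3,
    hm2]
  simp [hMdef]

omit [m.IsAddLeftInvariant] in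
/-- Chebyshev's inequality. -/
lemma mul_sq_le_variance (hφ : Measurable φ) {A : Set G} (hA : MeasurableSet A) {S : Set G}
    (hS : MeasurableSet S) {c : ℝ} (hc : 0 ≤ c)
    (h : ∀ x ∈ S, c ≤ |m.real (rot φ x ⁻¹' A) - m.real A|) :
    m.real S * c ^ 2 ≤ ∫ x, (m.real (rot φ x ⁻¹' A) - m.real A) ^ 2 ∂m := by
  have hM := measurable_measureReal_rot (m := m) hφ hA
  have hi2 : Integrable (fun x => (m.real (rot φ x ⁻¹' A) - m.real A) ^ 2) m :=
    integrable_of_measurable_of_abs_le ((hM.sub_const _).pow_const 2) (c := 1) fun x => by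
      rw [abs_of_nonneg (sq_nonneg _)]
      have h0 : 0 ≤ m.real (rot φ x ⁻¹' A) := measureReal_nonneg
      have h1 : m.real (rot φ x ⁻¹' A) ≤ 1 := measureReal_le_one
      have h2 : 0 ≤ m.real A := measureReal_nonneg
      have h3 : m.real A ≤ 1 := measureReal_le_one
      nlinarith
  calc m.real S * c ^ 2 = ∫ x in S, c ^ 2 ∂m := by simp [Measure.real]
    _ ≤ ∫ x in S, (m.real (rot φ x ⁻¹' A) - m.real A) ^ 2 ∂m := by
      refine setIntegral_mono_on (integrable_const _).integrableOn hi2.integrableOn hS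
        fun x hx => ?_
      rw [← sq_abs (m.real (rot φ x ⁻¹' A) - m.real A)]
      exact pow_le_pow_left₀ hc (h x hx) 2
    _ ≤ _ := setIntegral_le_integral hi2 (Filter.Eventually.of_forall fun x => sq_nonneg _)

omit [MeasurableSub₂ G] in
/-- If `φ` loses half of the mass of `B`, a particle that lands in `A` increases the harmonic
measure of `A` by half of the mass of the complement of `A` near the particle. -/
lemma half_measureReal_le (hφ : Measurable φ) {B : Set G} (hB : MeasurableSet B)
    (hK : ∀ E, MeasurableSet E → 0 ∉ E →
      m.real (φ ⁻¹' E) + 1 / 2 * m.real (E ∩ B) ≤ m.real E)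
    {A : Set G} (hA : MeasurableSet A) {x : G} (hx : x ∈ A) :
    1 / 2 * m.real (Aᶜ ∩ {y | y - x ∈ B}) ≤ m.real (rot φ x ⁻¹' A) - m.real A := by
  have hE : MeasurableSet ((fun u => u + x) ⁻¹' Aᶜ) := measurable_add_const x hA.compl
  have h := hK _ hE (by simpa using hx)
  have e1 : m.real (φ ⁻¹' ((fun u => u + x) ⁻¹' Aᶜ)) = 1 - m.real (rot φ x ⁻¹' A) := by
    rw [Measure.real, Measure.real, measure_rot_preimage m hφ x hA, ← Measure.real, ← Measure.real,
      ← probReal_compl_eq_one_sub ((hφ.add_const x) hA)]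
    rfl
  have e2 : m.real ((fun u => u + x) ⁻¹' Aᶜ) = 1 - m.real A := by
    rw [Measure.real, measure_preimage_add_right, ← Measure.real, probReal_compl_eq_one_sub hA]
  have e3 : m.real ((fun u => u + x) ⁻¹' Aᶜ ∩ B) = m.real (Aᶜ ∩ {y | y - x ∈ B}) := by
    rw [Measure.real, Measure.real, ← (measurePreserving_sub_right m x).measure_preimage
      (hE.inter hB).nullMeasurableSet]
    congr 2
    ext y; simp
  rw [e1, e2, e3] at h
  linarith

omit [m.IsAddLeftInvariant] in
lemma measureReal_rot_compl (hφ : Measurable φ) {A : Set G} (hA : MeasurableSet A) (x : G) :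
    m.real (rot φ x ⁻¹' Aᶜ) - m.real Aᶜ = -(m.real (rot φ x ⁻¹' A) - m.real A) := by
  rw [Set.preimage_compl, probReal_compl_eq_one_sub (measurableSet_rot_preimage hφ x hA),
    probReal_compl_eq_one_sub hA]
  ring

variable [TopologicalSpace G] [BorelSpace G] [IsTopologicalAddGroup G]
  [SecondCountableTopology G] [PreconnectedSpace G]

/-- The variance of the harmonic measure of an arbitrary measurable set under one step, where `k` is
a bump function with support in `B`, used to smooth the density of the set. If the
local density of the set never reaches `1/2` (or is never below), every point of the set (of its
complement) sees enough of the other side; if the density equals `1/2` somewhere, the points near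
such a place do. -/
lemma variance_lower_bound (hφ : Measurable φ) {B : Set G} (hB : MeasurableSet B)
    (hK : ∀ E, MeasurableSet E → 0 ∉ E →
      m.real (φ ⁻¹' E) + 1 / 2 * m.real (E ∩ B) ≤ m.real E)
    {k : G → ℝ} (hk : Continuous k) (hk0 : ∀ y, 0 ≤ k y) (hk1 : ∀ y, k y ≤ 1)
    (hkB : ∀ y, k y ≠ 0 → y ∈ B) (hkB2 : ∀ y z, k y ≠ 0 → k z ≠ 0 → y - z ∈ B)
    {η : ℝ} (hη : 0 < η) (hkη : 2 * η ≤ ∫ y, k y ∂m) {A : Set G} (hA : MeasurableSet A) :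
    min (min (m.real A) (1 - m.real A)) η * (η / 2) ^ 2
      ≤ ∫ x, (m.real (rot φ x ⁻¹' A) - m.real A) ^ 2 ∂m := by
  set κ := ∫ y, k y ∂m with hκ
  -- the smoothed local density
  set d : Set G → G → ℝ := fun A x => ∫ y, A.indicator (fun y => k (y - x)) y ∂m with hd
  have hkx : ∀ x, Measurable fun y => k (y - x) := fun x =>
    hk.measurable.comp (measurable_id.sub_const x)
  have hint : ∀ x, Integrable (fun y => k (y - x)) m := fun x =>
    integrable_of_measurable_of_abs_le (hkx x) (c := 1) fun y => by
      rw [abs_of_nonneg (hk0 _)]; exact hk1 _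
  have hdcont : ∀ A, MeasurableSet A → Continuous (d A) := by
    intro A hA
    refine continuous_of_dominated (bound := fun _ => 1)
      (fun x => ((hkx x).indicator hA).aestronglyMeasurable)
      (fun x => Filter.Eventually.of_forall fun y => ?_) (integrable_const _)
      (Filter.Eventually.of_forall fun y => ?_)
    · refine (norm_indicator_le_norm_self _ _).trans ?_
      rw [Real.norm_of_nonneg (hk0 _)]; exact hk1 _
    · by_cases hy : y ∈ A
      · simp only [Set.indicator_of_mem hy]; fun_prop
      · simp only [Set.indicator_of_notMem hy]; fun_prop
  have hdadd : ∀ A, MeasurableSet A → ∀ x, d A x + d Aᶜ x = κ := by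
    intro A hA x
    simp only [hd]
    rw [integral_indicator hA, integral_indicator hA.compl, integral_add_compl hA (hint x), hκ]
    exact integral_sub_right_eq_self k x
  have hdle : ∀ A, MeasurableSet A → ∀ x, d A x ≤ m.real (A ∩ {y | k (y - x) ≠ 0}) := by
    intro A hA x
    have hS : MeasurableSet (A ∩ {y | k (y - x) ≠ 0}) :=
      hA.inter ((hkx x) (measurableSet_singleton 0).compl)
    rw [← integral_indicator_one hS]
    refine integral_mono ((hint x).indicator hA) ((integrable_const 1).indicator hS) fun y => ?_
    by_cases hy : y ∈ A
    · by_cases hy0 : k (y - x) = 0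
      · simp [hy, hy0, Set.indicator]
      · simpa [hy, hy0, Set.indicator] using hk1 _
    · simp [hy, Set.indicator]
  have hBx : ∀ x, MeasurableSet {y | y - x ∈ B} := fun x => measurable_id.sub_const x hB
  have case1 : ∀ A, MeasurableSet A → (∀ x, d A x ≤ κ / 2) →
      m.real A * (η / 2) ^ 2 ≤ ∫ x, (m.real (rot φ x ⁻¹' A) - m.real A) ^ 2 ∂m := by
    intro A hA h
    refine mul_sq_le_variance hφ hA hA (by positivity) fun x hx => ?_
    refine le_trans ?_ (le_abs_self _)
    refine le_trans ?_ (half_measureReal_le hφ hB hK hA hx)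
    have h1 := hdadd A hA x
    have h2 := h x
    have h3 := hdle Aᶜ hA.compl x
    have h4 : m.real (Aᶜ ∩ {y | k (y - x) ≠ 0}) ≤ m.real (Aᶜ ∩ {y | y - x ∈ B}) :=
      measureReal_mono (Set.inter_subset_inter_right _ fun y hy => hkB _ hy)
    linarith
  by_cases h1 : ∀ x, d A x ≤ κ / 2
  · refine le_trans ?_ (case1 A hA h1)
    gcongr
    exact (min_le_left _ _).trans (min_le_left _ _)
  by_cases h2 : ∀ x, d Aᶜ x ≤ κ / 2
  · have := case1 Aᶜ hA.compl h2
    simp_rw [measureReal_rot_compl hφ hA, neg_sq] at this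
    refine le_trans ?_ this
    rw [probReal_compl_eq_one_sub hA]
    gcongr
    exact (min_le_left _ _).trans (min_le_right _ _)
  push Not at h1 h2
  obtain ⟨x1, hx1⟩ := h1
  obtain ⟨x2, hx2⟩ := h2
  have hx2' : d A x2 ≤ κ / 2 := by have := hdadd A hA x2; linarith
  obtain ⟨x0, hx0⟩ := mem_range_of_exists_le_of_exists_ge (hdcont A hA) ⟨x2, hx2'⟩ ⟨x1, hx1.le⟩
  have hx0' : d Aᶜ x0 = κ / 2 := by have := hdadd A hA x0; linarith
  have hS : MeasurableSet (A ∩ {y | k (y - x0) ≠ 0}) :=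
    hA.inter ((hkx x0) (measurableSet_singleton 0).compl)
  refine le_trans ?_ (mul_sq_le_variance hφ hA hS (c := η / 2) (by positivity) fun x hx => ?_)
  · gcongr
    refine (min_le_right _ _).trans ?_
    have := hdle A hA x0
    linarith
  · refine le_trans ?_ (le_abs_self _)
    refine le_trans ?_ (half_measureReal_le hφ hB hK hA hx.1)
    have h3 := hdle Aᶜ hA.compl x0
    have h4 : m.real (Aᶜ ∩ {y | k (y - x0) ≠ 0}) ≤ m.real (Aᶜ ∩ {y | y - x ∈ B}) := by
      refine measureReal_mono (Set.inter_subset_inter_right _ fun y hy => ?_)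
      have := hkB2 _ _ hy hx.2
      rwa [sub_sub_sub_cancel_right] at this
    linarith

end

/-! ### Convergence of the harmonic measures of the trees -/

/-- The properties of the motion `φ` of the circle under one slit map that govern the long-time
behaviour of the trees: `φ` is injective outside of the preimage of the slit, this preimage has
measure at least `η`, and in one step the measure of every set `A` changes with a variance of order
at least `η²` times the smallest of `m A`, `1 - m A` and `η`. -/
structure IsCollapse {G : Type*} [AddCommGroup G] [MeasurableSpace G] (m : Measure G)
    (φ : G → G) (η : ℝ) : Prop where
  measurable : Measurable φ
  eq_or_eq_zero : ∀ y z, φ y = φ z → y = z ∨ φ y = 0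
  pos : 0 < η
  le_measure : η ≤ m.real (φ ⁻¹' {0})
  variance : ∀ A, MeasurableSet A → min (min (m.real A) (1 - m.real A)) η * (η / 2) ^ 2
    ≤ ∫ x, (m.real (rot φ x ⁻¹' A) - m.real A) ^ 2 ∂m

section
variable {G : Type*} [AddCommGroup G] (φ : G → G)

/-- From index `k` on, particles are received both by the part of the cluster with feet in `A`,
and by the rest. -/
def bothHit (A : Set G) (k : ℕ) : Set (ℕ → G) :=
  {s | (∃ n ≥ k, foot φ s n ∈ A) ∧ ∃ n ≥ k, foot φ s n ∉ A}

/-- The particle of index `n` founds a new tree, with foot in `B`. -/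
def newFoot (B : Set G) (n : ℕ) : Set (ℕ → G) :=
  {s | foot φ s n ∈ B ∧ ∀ i < n, foot φ s i ≠ foot φ s n}

/-- The particle of index `n` founds a new tree, with foot in `B`; from index `k > n` on, this tree
and the rest of the cluster both receive particles. -/
def contested (B : Set G) (n k : ℕ) : Set (ℕ → G) :=
  {s | s ∈ newFoot φ B n ∧ n < k ∧ (∃ l ≥ k, foot φ s l = foot φ s n) ∧
    ∃ l ≥ k, foot φ s l ≠ foot φ s n}

/-- Some particle of index at least `i` is received by a tree that receives finitely many. -/
def finiteHit (i : ℕ) : Set (ℕ → G) :=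
  {s | ∃ n ≥ i, {k | foot φ s k = foot φ s n}.Finite}

variable {φ}

lemma consSeq_mem_bothHit {A : Set G} {k : ℕ} {x : G} {s : ℕ → G} :
    consSeq (x, s) ∈ bothHit φ A (k + 1) ↔ s ∈ bothHit φ (rot φ x ⁻¹' A) k := by
  have key : ∀ C : Set G, (∃ n ≥ k + 1, foot φ (consSeq (x, s)) n ∈ C) ↔
      ∃ n ≥ k, rot φ x (foot φ s n) ∈ C := by
    intro C
    constructor
    · rintro ⟨n, hn, h⟩
      obtain ⟨n, rfl⟩ : ∃ l, n = l + 1 := ⟨n - 1, by omega⟩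
      rw [foot_consSeq_succ] at h
      exact ⟨n, by omega, h⟩
    · rintro ⟨n, hn, h⟩
      exact ⟨n + 1, by omega, by rwa [foot_consSeq_succ]⟩
  exact and_congr (key A) (key Aᶜ)

lemma rot_eq_rot (hinj : ∀ y z, φ y = φ z → y = z ∨ φ y = 0) {x y z : G}
    (h : rot φ x y = rot φ x z) : y = z ∨ rot φ x y = x := by
  rcases hinj _ _ (add_right_cancel h) with h1 | h1
  · exact Or.inl (sub_left_inj.1 h1)
  · right; rw [rot, h1, zero_add]

lemma mem_newFoot_of_consSeq {B : Set G} {n : ℕ} {x : G} {s : ℕ → G}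
    (h : consSeq (x, s) ∈ newFoot φ B (n + 1)) :
    s ∈ newFoot φ (rot φ x ⁻¹' (B \ {x})) n := by
  obtain ⟨h1, h2⟩ := h
  rw [foot_consSeq_succ] at h1
  refine ⟨⟨h1, fun h3 => ?_⟩, fun i hi h3 => ?_⟩
  · refine h2 0 (by omega) ?_
    rw [foot_consSeq_zero, foot_consSeq_succ]
    exact (Set.mem_singleton_iff.1 h3).symm
  · refine h2 (i + 1) (by omega) ?_
    rw [foot_consSeq_succ, foot_consSeq_succ, h3]

lemma mem_contested_of_consSeq (hinj : ∀ y z, φ y = φ z → y = z ∨ φ y = 0) {B : Set G}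
    {n k : ℕ} {x : G} {s : ℕ → G} (h : consSeq (x, s) ∈ contested φ B (n + 1) (k + 1)) :
    s ∈ contested φ (rot φ x ⁻¹' (B \ {x})) n k := by
  obtain ⟨h1, h2, ⟨l, hl, h3⟩, l', hl', h4⟩ := h
  have h5 := mem_newFoot_of_consSeq h1
  obtain ⟨l, rfl⟩ : ∃ j, l = j + 1 := ⟨l - 1, by omega⟩
  obtain ⟨l', rfl⟩ : ∃ j, l' = j + 1 := ⟨l' - 1, by omega⟩
  rw [foot_consSeq_succ, foot_consSeq_succ] at h3 h4
  refine ⟨h5, by omega, ⟨l, by omega, ?_⟩, l', by omega, fun h6 => h4 (by rw [h6])⟩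
  rcases rot_eq_rot hinj h3.symm with h6 | h6
  · exact h6.symm
  · exact absurd h6 h5.1.2

lemma of_consSeq_mem_contested_zero {B : Set G} {k : ℕ} {x : G} {s : ℕ → G}
    (h : consSeq (x, s) ∈ contested φ B 0 (k + 1)) :
    x ∈ B ∧ s ∈ bothHit φ (rot φ x ⁻¹' {x}) k := by
  obtain ⟨h1, -, ⟨l, hl, h3⟩, l', hl', h4⟩ := h
  refine ⟨h1.1, consSeq_mem_bothHit.1 ⟨⟨l, hl, ?_⟩, l', hl', ?_⟩⟩
  · exact h3
  · exact h4

/-- If a tree that receives finitely many particles receives one at `i` or later, then this tree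
was founded at `i` or later, or it is contested at `i`. -/
lemma finiteHit_subset (i : ℕ) :
    finiteHit φ i ⊆ (⋃ l, newFoot φ Set.univ (i + l)) ∪ ⋃ n, contested φ Set.univ n i := by
  classical
  rintro s ⟨n, hn, hfin⟩
  have hex : ∃ k, foot φ s k = foot φ s n := ⟨n, rfl⟩
  set a := Nat.find hex with ha
  have ha1 : foot φ s a = foot φ s n := Nat.find_spec hex
  have hnew : s ∈ newFoot φ Set.univ a :=
    ⟨trivial, fun j hj h => Nat.find_min hex hj (h.trans ha1)⟩
  rcases le_or_gt i a with h | h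
  · left
    refine Set.mem_iUnion.2 ⟨a - i, ?_⟩
    rwa [Nat.add_sub_cancel' h]
  · right
    refine Set.mem_iUnion.2 ⟨a, hnew, h, ⟨n, hn, ha1.symm⟩, ?_⟩
    by_contra hcon
    push Not at hcon
    refine (Set.infinite_of_injective_forall_mem (f := fun l : ℕ => i + l)
      (fun _ _ h => Nat.add_left_cancel h) fun l => ?_) hfin
    exact (hcon (i + l) (by omega)).trans ha1

variable [MeasurableSpace G] [MeasurableAdd₂ G] [MeasurableSub₂ G]

lemma measurableSet_foot_eq [MeasurableSingletonClass G] (hφ : Measurable φ) (n k : ℕ) :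
    MeasurableSet {s : ℕ → G | foot φ s n = foot φ s k} :=
  measurableSet_eq_fun (measurable_foot hφ n) (measurable_foot hφ k)

lemma measurableSet_bothHit (hφ : Measurable φ) {A : Set G} (hA : MeasurableSet A) (k : ℕ) :
    MeasurableSet (bothHit φ A k) := by
  have key : ∀ C : Set G, MeasurableSet C →
      MeasurableSet {s : ℕ → G | ∃ n ≥ k, foot φ s n ∈ C} := by
    intro C hC
    simp only [Set.ofPred_exists, Set.ofPred_and]
    exact MeasurableSet.iUnion fun n => (MeasurableSet.const _).inter (measurable_foot hφ n hC)
  exact (key A hA).inter (key Aᶜ hA.compl)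

lemma measurableSet_newFoot [MeasurableSingletonClass G] (hφ : Measurable φ) {B : Set G}
    (hB : MeasurableSet B) (n : ℕ) : MeasurableSet (newFoot φ B n) := by
  refine (measurable_foot hφ n hB).inter ?_
  change MeasurableSet {s | ∀ i < n, foot φ s i ≠ foot φ s n}
  simp only [Set.ofPred_forall]
  exact MeasurableSet.iInter fun i => MeasurableSet.iInter fun _ =>
    (measurableSet_foot_eq hφ i n).compl

lemma measurableSet_contested [MeasurableSingletonClass G] (hφ : Measurable φ) {B : Set G}
    (hB : MeasurableSet B) (n k : ℕ) : MeasurableSet (contested φ B n k) := by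
  refine (measurableSet_newFoot hφ hB n).inter ((MeasurableSet.const _).inter
    (MeasurableSet.inter ?_ ?_))
  · change MeasurableSet {s | ∃ l ≥ k, foot φ s l = foot φ s n}
    simp only [Set.ofPred_exists, Set.ofPred_and]
    exact MeasurableSet.iUnion fun l => (MeasurableSet.const _).inter (measurableSet_foot_eq hφ l n)
  · change MeasurableSet {s | ∃ l ≥ k, foot φ s l ≠ foot φ s n}
    simp only [Set.ofPred_exists, Set.ofPred_and]
    exact MeasurableSet.iUnion fun l => (MeasurableSet.const _).inter
      (measurableSet_foot_eq hφ l n).compl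

variable {m : Measure G} [IsProbabilityMeasure m] [m.IsAddLeftInvariant] {η : ℝ}

omit [AddCommGroup G] [MeasurableAdd₂ G] [MeasurableSub₂ G] [m.IsAddLeftInvariant] in
lemma measurable_seqLaw_consSeq {E : Set (ℕ → G)} (hE : MeasurableSet E) :
    Measurable fun x => seqLaw m {s | consSeq (x, s) ∈ E} :=
  measurable_measure_prodMk_left (measurable_consSeq hE)

namespace IsCollapse

variable (h : IsCollapse m φ η)
include h

/-- Each of a set and its complement is ever hit with probability at most its measure over `η`. -/
lemma measureReal_bothHit_zero_mul_le {A : Set G} (hA : MeasurableSet A) :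
    (seqLaw m).real (bothHit φ A 0) * η ≤ min (min (m.real A) (1 - m.real A)) η := by
  have hp : ENNReal.ofReal η ≤ m (φ ⁻¹' {0}) :=
    ENNReal.ofReal_le_of_le_toReal h.le_measure
  have key : ∀ C, MeasurableSet C → (seqLaw m).real {s | ∃ n, foot φ s n ∈ C} * η ≤ m.real C := by
    intro C hC
    have := ENNReal.toReal_mono (measure_ne_top _ _) (seqLaw_hit_le h.measurable hC hp)
    rwa [ENNReal.toReal_mul, ENNReal.toReal_ofReal h.pos.le] at this
  have h1 : (seqLaw m).real (bothHit φ A 0) ≤ (seqLaw m).real {s | ∃ n, foot φ s n ∈ A} :=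
    measureReal_mono fun s hs => let ⟨n, _, hn⟩ := hs.1; ⟨n, hn⟩
  have h2 : (seqLaw m).real (bothHit φ A 0) ≤ (seqLaw m).real {s | ∃ n, foot φ s n ∈ Aᶜ} :=
    measureReal_mono fun s hs => let ⟨n, _, hn⟩ := hs.2; ⟨n, hn⟩
  have h3 : (seqLaw m).real (bothHit φ A 0) ≤ 1 := measureReal_le_one
  refine le_min (le_min ?_ ?_) ?_
  · exact (mul_le_mul_of_nonneg_right h1 h.pos.le).trans (key A hA)
  · rw [← probReal_compl_eq_one_sub hA]
    exact (mul_le_mul_of_nonneg_right h2 h.pos.le).trans (key Aᶜ hA.compl)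
  · exact mul_le_of_le_one_left h.pos.le h3

/-- The potential `M (1 - M)`, which decreases by the variance in each step, dominates the expected
time during which both a set and its complement are hit later. -/
lemma sum_bothHit_le (K : ℕ) {A : Set G} (hA : MeasurableSet A) :
    ∑ k ∈ Finset.range K, seqLaw m (bothHit φ A k)
      ≤ ENNReal.ofReal (4 / η ^ 3 * (m.real A * (1 - m.real A))) := by
  have hη := h.pos
  induction K generalizing A with
  | zero => simp
  | succ K ih =>
    have hA' : ∀ x, MeasurableSet (rot φ x ⁻¹' A) :=
      fun x => measurableSet_rot_preimage h.measurable x hA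
    have hvar := h.variance A hA
    set V := ∫ x, (m.real (rot φ x ⁻¹' A) - m.real A) ^ 2 ∂m with hV
    have hV0 : 0 ≤ V := integral_nonneg fun x => sq_nonneg _
    have h0 : seqLaw m (bothHit φ A 0) ≤ ENNReal.ofReal (4 / η ^ 3 * V) := by
      rw [← ENNReal.ofReal_toReal (measure_ne_top (seqLaw m) (bothHit φ A 0))]
      refine ENNReal.ofReal_le_ofReal ?_
      have h1 := h.measureReal_bothHit_zero_mul_le hA
      have h2 : (seqLaw m).real (bothHit φ A 0) * η * (η / 2) ^ 2 ≤ V :=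
        (mul_le_mul_of_nonneg_right h1 (by positivity)).trans hvar
      rw [div_mul_eq_mul_div, le_div_iff₀ (by positivity)]
      change (seqLaw m).real (bothHit φ A 0) * η ^ 3 ≤ 4 * V
      linarith
    have hstep : ∑ k ∈ Finset.range K, seqLaw m (bothHit φ A (k + 1))
        ≤ ENNReal.ofReal (4 / η ^ 3 * (m.real A * (1 - m.real A) - V)) := by
      have e : ∀ k, seqLaw m (bothHit φ A (k + 1))
          = ∫⁻ x, seqLaw m {s | consSeq (x, s) ∈ bothHit φ A (k + 1)} ∂m :=
        fun k => seqLaw_apply m (measurableSet_bothHit h.measurable hA _)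
      simp_rw [e]
      rw [← lintegral_finsetSum _ fun k _ =>
        measurable_seqLaw_consSeq (measurableSet_bothHit h.measurable hA _)]
      have hM := measurable_measureReal_rot (m := m) h.measurable hA
      have h01 : ∀ x, 0 ≤ m.real (rot φ x ⁻¹' A) * (1 - m.real (rot φ x ⁻¹' A)) := fun x =>
        mul_nonneg measureReal_nonneg (sub_nonneg.2 measureReal_le_one)
      calc _ ≤ ∫⁻ x, ENNReal.ofReal
            (4 / η ^ 3 * (m.real (rot φ x ⁻¹' A) * (1 - m.real (rot φ x ⁻¹' A)))) ∂m := by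
            refine lintegral_mono fun x => ?_
            simp only [consSeq_mem_bothHit]
            exact ih (hA' x)
        _ = _ := by
            rw [← ofReal_integral_eq_lintegral_ofReal, integral_const_mul,
              integral_mul_one_sub h.measurable hA]
            · refine integrable_of_measurable_of_abs_le
                ((hM.mul (hM.const_sub 1)).const_mul _) (c := 4 / η ^ 3) fun x => ?_
              have ha : m.real (rot φ x ⁻¹' A) ≤ 1 := measureReal_le_one
              have hb : 0 ≤ m.real (rot φ x ⁻¹' A) := measureReal_nonneg
              rw [abs_of_nonneg (mul_nonneg (by positivity) (h01 x))]
              exact mul_le_of_le_one_right (by positivity) (by nlinarith)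
            · exact Filter.Eventually.of_forall fun x => mul_nonneg (by positivity) (h01 x)
    rw [Finset.sum_range_succ']
    refine (add_le_add hstep h0).trans ?_
    rw [← ENNReal.ofReal_add]
    · refine ENNReal.ofReal_le_ofReal (le_of_eq ?_); ring
    · have e := integral_mul_one_sub (m := m) h.measurable hA
      rw [← hV] at e
      rw [← e]
      exact mul_nonneg (by positivity) (integral_nonneg fun x =>
        mul_nonneg measureReal_nonneg (sub_nonneg.2 measureReal_le_one))
    · positivity

lemma tsum_bothHit_le {A : Set G} (hA : MeasurableSet A) :
    ∑' k, seqLaw m (bothHit φ A k) ≤ ENNReal.ofReal (4 / η ^ 3) * m A := by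
  refine ENNReal.tsum_le_of_sum_range_le fun K => (h.sum_bothHit_le K hA).trans ?_
  have hη := h.pos
  rw [← ENNReal.ofReal_toReal (measure_ne_top m A), ← ENNReal.ofReal_mul (by positivity)]
  refine ENNReal.ofReal_le_ofReal (mul_le_mul_of_nonneg_left ?_ (by positivity))
  have : 0 ≤ m.real A := measureReal_nonneg
  change m.real A * (1 - m.real A) ≤ m.real A
  nlinarith

omit [MeasurableAdd₂ G] [MeasurableSub₂ G] [IsProbabilityMeasure m] [m.IsAddLeftInvariant] in
lemma le_measure_ennreal : ENNReal.ofReal η ≤ m (φ ⁻¹' {0}) :=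
  ENNReal.ofReal_le_of_le_toReal h.le_measure

omit [MeasurableSub₂ G] [IsProbabilityMeasure m] in
lemma measure_rot_preimage_singleton [MeasurableSingletonClass G] (x : G) :
    m (rot φ x ⁻¹' {x}) = m (φ ⁻¹' {0}) := by
  rw [measure_rot_preimage m h.measurable x (measurableSet_singleton x)]
  congr 1
  ext u
  simp

/-- The harmonic measure of the free part `B` of the bottom circle decreases on average by the
factor `1 - p`. -/
lemma lintegral_measure_rot_diff_le [MeasurableSingletonClass G] {B : Set G}
    (hB : MeasurableSet B) :
    ∫⁻ x, m (rot φ x ⁻¹' (B \ {x})) ∂m ≤ (1 - m (φ ⁻¹' {0})) * m B := by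
  set p := m (φ ⁻¹' {0}) with hp
  have hE : MeasurableSet {q : G × G | rot φ q.1 q.2 ∈ B \ {q.1}} :=
    ((measurable_rot h.measurable) hB).inter
      (measurableSet_eq_fun (measurable_rot h.measurable) measurable_fst).compl
  have hmeas : Measurable fun x => m (rot φ x ⁻¹' (B \ {x})) := measurable_measure_prodMk_left hE
  have hsum : ∀ x, m (rot φ x ⁻¹' (B \ {x})) + B.indicator (fun _ => p) x
      = m (rot φ x ⁻¹' B) := by
    intro x
    by_cases hx : x ∈ B
    · rw [Set.indicator_of_mem hx, hp, ← h.measure_rot_preimage_singleton x, ← measure_union]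
      · rw [← Set.preimage_union, Set.sdiff_union_of_subset (Set.singleton_subset_iff.2 hx)]
      · exact Disjoint.preimage _ Set.disjoint_sdiff_left
      · exact measurableSet_rot_preimage h.measurable x (measurableSet_singleton x)
    · rw [Set.indicator_of_notMem hx, add_zero, Set.sdiff_singleton_eq_self hx]
  have htot : ∫⁻ x, m (rot φ x ⁻¹' (B \ {x})) ∂m + p * m B = m B := by
    rw [← lintegral_indicator_const hB, ← lintegral_add_left hmeas]
    simp_rw [hsum]
    exact lintegral_measure_rot_preimage m h.measurable hB
  rw [ENNReal.sub_mul fun _ _ => measure_ne_top m B, one_mul]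
  exact ENNReal.le_sub_of_add_le_right
    (ENNReal.mul_ne_top (measure_ne_top _ _) (measure_ne_top _ _)) htot.le

omit [IsProbabilityMeasure m] [m.IsAddLeftInvariant] in
lemma measurableSet_rot_diff [MeasurableSingletonClass G] {B : Set G} (hB : MeasurableSet B)
    (x : G) : MeasurableSet (rot φ x ⁻¹' (B \ {x})) :=
  measurableSet_rot_preimage h.measurable x (hB.diff (measurableSet_singleton x))

/-- New trees are founded with exponentially decaying probability, as the free part of the bottom
circle shrinks. -/
lemma seqLaw_newFoot_le [MeasurableSingletonClass G] (n : ℕ) {B : Set G} (hB : MeasurableSet B) :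
    seqLaw m (newFoot φ B n) ≤ (1 - m (φ ⁻¹' {0})) ^ n * m B := by
  induction n generalizing B with
  | zero =>
    rw [pow_zero, one_mul, seqLaw_apply m (measurableSet_newFoot h.measurable hB 0),
      ← lintegral_indicator_one hB]
    refine lintegral_mono fun x => ?_
    by_cases hx : x ∈ B
    · simpa [hx] using prob_le_one
    · have : {s | consSeq (x, s) ∈ newFoot φ B 0} = ∅ := by
        ext s
        exact iff_of_false (fun hs => hx hs.1) id
      rw [this]; simp
  | succ n ih =>
    rw [seqLaw_apply m (measurableSet_newFoot h.measurable hB _), pow_succ, mul_assoc]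
    calc _ ≤ ∫⁻ x, (1 - m (φ ⁻¹' {0})) ^ n * m (rot φ x ⁻¹' (B \ {x})) ∂m := by
          refine lintegral_mono fun x => ?_
          exact (measure_mono fun s hs => mem_newFoot_of_consSeq hs).trans
            (ih (h.measurableSet_rot_diff hB x))
      _ = (1 - m (φ ⁻¹' {0})) ^ n * ∫⁻ x, m (rot φ x ⁻¹' (B \ {x})) ∂m :=
          lintegral_const_mul' _ _ (by finiteness)
      _ ≤ _ := by gcongr; exact h.lintegral_measure_rot_diff_le hB

omit [MeasurableAdd₂ G] [MeasurableSub₂ G] [m.IsAddLeftInvariant] h in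
lemma seqLaw_contested_zero (B : Set G) (n : ℕ) : seqLaw m (contested φ B n 0) = 0 := by
  have : contested φ B n 0 = ∅ := by
    ext s; exact iff_of_false (fun hs => absurd hs.2.1 (by omega)) id
  rw [this, measure_empty]

/-- The expected number of steps at which the tree founded by the particle of index `n` is still
contested; when this tree is founded, its harmonic measure is `m (φ ⁻¹' {0})`. -/
lemma tsum_contested_le [MeasurableSingletonClass G] (n : ℕ) {B : Set G} (hB : MeasurableSet B) :
    ∑' k, seqLaw m (contested φ B n k)
      ≤ ENNReal.ofReal (4 / η ^ 3) * m (φ ⁻¹' {0}) * (1 - m (φ ⁻¹' {0})) ^ n * m B := by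
  have e : ∀ n, ∀ B : Set G, MeasurableSet B → ∑' k, seqLaw m (contested φ B n k)
      = ∫⁻ x, ∑' k, seqLaw m {s | consSeq (x, s) ∈ contested φ B n (k + 1)} ∂m := by
    intro n B hB
    rw [tsum_eq_zero_add' ENNReal.summable, seqLaw_contested_zero, zero_add,
      lintegral_tsum fun k => (measurable_seqLaw_consSeq
        (measurableSet_contested h.measurable hB n (k + 1))).aemeasurable]
    exact tsum_congr fun k => seqLaw_apply m (measurableSet_contested h.measurable hB n (k + 1))
  induction n generalizing B with
  | zero =>
    rw [e 0 B hB, pow_zero, mul_one, ← lintegral_indicator_const hB]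
    refine lintegral_mono fun x => ?_
    by_cases hx : x ∈ B
    · rw [Set.indicator_of_mem hx, ← h.measure_rot_preimage_singleton x]
      refine (ENNReal.tsum_le_tsum fun k => ?_).trans (h.tsum_bothHit_le
          (measurableSet_rot_preimage h.measurable x (measurableSet_singleton x)))
      exact measure_mono fun s hs => (of_consSeq_mem_contested_zero hs).2
    · have : ∀ k, {s | consSeq (x, s) ∈ contested φ B 0 (k + 1)} = ∅ := fun k => by
        ext s
        exact iff_of_false (fun hs => hx (of_consSeq_mem_contested_zero hs).1) id
      simp [this, hx]
  | succ n ih =>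
    rw [e (n + 1) B hB, pow_succ (1 - m (φ ⁻¹' {0})), ← mul_assoc, mul_assoc _ _ (m B)]
    calc _ ≤ ∫⁻ x, ENNReal.ofReal (4 / η ^ 3) * m (φ ⁻¹' {0}) * (1 - m (φ ⁻¹' {0})) ^ n
          * m (rot φ x ⁻¹' (B \ {x})) ∂m := by
          refine lintegral_mono fun x => ?_
          refine (ENNReal.tsum_le_tsum fun k => ?_).trans (ih (h.measurableSet_rot_diff hB x))
          exact measure_mono fun s hs => mem_contested_of_consSeq h.eq_or_eq_zero hs
      _ = _ * ∫⁻ x, m (rot φ x ⁻¹' (B \ {x})) ∂m :=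
          lintegral_const_mul' _ _ (by finiteness)
      _ ≤ _ := by gcongr; exact h.lintegral_measure_rot_diff_le hB

omit [MeasurableAdd₂ G] [MeasurableSub₂ G] [m.IsAddLeftInvariant] h in
lemma tsum_one_sub_pow : ∑' n : ℕ, (1 - m (φ ⁻¹' {0})) ^ n = (m (φ ⁻¹' {0}))⁻¹ := by
  rw [ENNReal.tsum_geometric, ENNReal.sub_sub_cancel ENNReal.one_ne_top prob_le_one]

omit [MeasurableAdd₂ G] [MeasurableSub₂ G] [m.IsAddLeftInvariant] [IsProbabilityMeasure m] in
lemma measure_preimage_zero_ne_zero : m (φ ⁻¹' {0}) ≠ 0 := by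
  intro h0
  have h1 := h.le_measure
  have h2 := h.pos
  rw [Measure.real, h0] at h1
  simp at h1; linarith

lemma tsum_tsum_contested_le [MeasurableSingletonClass G] :
    ∑' n, ∑' k, seqLaw m (contested φ Set.univ n k) ≤ ENNReal.ofReal (4 / η ^ 3) := by
  calc _ ≤ ∑' n, ENNReal.ofReal (4 / η ^ 3) * m (φ ⁻¹' {0}) * (1 - m (φ ⁻¹' {0})) ^ n := by
        refine ENNReal.tsum_le_tsum fun n => ?_
        simpa using h.tsum_contested_le n MeasurableSet.univ
    _ = _ := by
        rw [ENNReal.tsum_mul_left, tsum_one_sub_pow, mul_assoc,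
          ENNReal.mul_inv_cancel h.measure_preimage_zero_ne_zero (measure_ne_top _ _), mul_one]

/-- A bound for the expected number of indices up to the last particle that is received by a tree
receiving finitely many. -/
lemma tsum_finiteHit_le [MeasurableSingletonClass G] :
    ∑' i, seqLaw m (finiteHit φ i) ≤ ENNReal.ofReal (5 / η ^ 3) := by
  have hη := h.pos
  set p := m (φ ⁻¹' {0}) with hp
  have h1 : ∀ i, seqLaw m (finiteHit φ i)
      ≤ ∑' l, (1 - p) ^ i * (1 - p) ^ l + ∑' n, seqLaw m (contested φ Set.univ n i) := by
    intro i
    refine (measure_mono (finiteHit_subset i)).trans ((measure_union_le _ _).trans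
      (add_le_add ((measure_iUnion_le _).trans (ENNReal.tsum_le_tsum fun l => ?_))
        (measure_iUnion_le _)))
    rw [← pow_add]
    simpa using h.seqLaw_newFoot_le (i + l) MeasurableSet.univ
  refine (ENNReal.tsum_le_tsum h1).trans ?_
  rw [ENNReal.tsum_add, ENNReal.tsum_comm (f := fun i n => seqLaw m (contested φ Set.univ n i))]
  simp_rw [ENNReal.tsum_mul_left, ENNReal.tsum_mul_right]
  rw [tsum_one_sub_pow]
  have hη1 : η ≤ 1 := h.le_measure.trans measureReal_le_one
  have h2 : p⁻¹ * p⁻¹ ≤ ENNReal.ofReal (1 / η ^ 3) := by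
    have : p⁻¹ ≤ ENNReal.ofReal (1 / η) := by
      rw [one_div, ENNReal.ofReal_inv_of_pos hη]
      exact ENNReal.inv_le_inv.2 h.le_measure_ennreal
    refine (mul_le_mul' this this).trans ?_
    rw [← ENNReal.ofReal_mul (by positivity)]
    refine ENNReal.ofReal_le_ofReal ?_
    rw [div_mul_div_comm, one_mul]
    refine one_div_le_one_div_of_le (by positivity) ?_
    have : η ^ 3 = η * η * η := by ring
    rw [this]
    exact mul_le_of_le_one_right (by positivity) hη1
  refine (add_le_add h2 h.tsum_tsum_contested_le).trans ?_
  rw [← ENNReal.ofReal_add (by positivity) (by positivity)]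
  refine ENNReal.ofReal_le_ofReal (le_of_eq ?_)
  ring

/-- Almost surely there is exactly one foot that is hit infinitely often. -/
lemma ae_unique_infinite [MeasurableSingletonClass G] :
    ∀ᵐ s ∂seqLaw m, (∃ j, {k | foot φ s k = foot φ s j}.Infinite) ∧
      ∀ j j', {k | foot φ s k = foot φ s j}.Infinite → {k | foot φ s k = foot φ s j'}.Infinite →
        foot φ s j = foot φ s j' := by
  classical
  have h1 : ∀ᵐ s ∂seqLaw m, {i | s ∈ finiteHit φ i}.Finite :=
    ae_finite_setOfPred_mem (h.tsum_finiteHit_le.trans_lt ENNReal.ofReal_lt_top).ne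
  have h2 : ∀ᵐ s ∂seqLaw m, ∀ n, {k | s ∈ contested φ Set.univ n k}.Finite := by
    refine ae_all_iff.2 fun n => ae_finite_setOfPred_mem (ne_of_lt ?_)
    refine (h.tsum_contested_le n MeasurableSet.univ).trans_lt ?_
    finiteness
  filter_upwards [h1, h2] with s h1 h2
  constructor
  · obtain ⟨i, hi⟩ := h1.exists_notMem
    refine ⟨i, fun hfin => hi ⟨i, le_rfl, hfin⟩⟩
  · intro j j' hj hj'
    by_contra hne
    have hex : ∃ k, foot φ s k = foot φ s j := ⟨j, rfl⟩
    set a := Nat.find hex with ha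
    have ha1 : foot φ s a = foot φ s j := Nat.find_spec hex
    refine (Set.infinite_of_injective_forall_mem (f := fun l : ℕ => a + 1 + l)
      (fun _ _ h => Nat.add_left_cancel h) fun l => ?_) (h2 a)
    refine ⟨⟨trivial, fun i hi h => Nat.find_min hex hi (h.trans ha1)⟩, by omega, ?_, ?_⟩
    · obtain ⟨k, hk, hk2⟩ := hj.exists_gt (a + 1 + l)
      exact ⟨k, hk2.le, Eq.trans hk ha1.symm⟩
    · obtain ⟨k, hk, hk2⟩ := hj'.exists_gt (a + 1 + l)
      refine ⟨k, hk2.le, fun h3 => hne ?_⟩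
      rw [← ha1, ← h3]; exact hk

end IsCollapse

end

/-! ### Two consecutive particles in different trees -/

section
variable {G : Type*} [AddCommGroup G] [MeasurableSpace G] [MeasurableAdd₂ G] [MeasurableSub₂ G]
  {m : Measure G} [IsProbabilityMeasure m] {φ : G → G}

omit [AddCommGroup G] [MeasurableAdd₂ G] [MeasurableSub₂ G] in
lemma integral_consSeq {F : (ℕ → G) → ℂ} (hF : Measurable F) {c : ℝ} (hc : ∀ s, ‖F s‖ ≤ c) :
    ∫ s, F s ∂seqLaw m = ∫ s, ∫ x, F (consSeq (x, s)) ∂m ∂seqLaw m := by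
  have e := (measurePreserving_consSeq m).map_eq
  have hi : Integrable (fun q : G × (ℕ → G) => F (consSeq q)) (m.prod (seqLaw m)) :=
    Integrable.of_bound (hF.comp measurable_consSeq).aestronglyMeasurable c
      (Filter.Eventually.of_forall fun q => hc _)
  conv_lhs => rw [← e]
  rw [integral_map measurable_consSeq.aemeasurable hF.aestronglyMeasurable,
    integral_prod_symm _ hi]

variable {f : G → ℂ} (hf : Measurable f) (hadd : ∀ x y, f (x + y) = f x * f y)
  (hnorm : ∀ x, ‖f x‖ = 1)

include hnorm in
omit [AddCommGroup G] [MeasurableSpace G] [MeasurableAdd₂ G] [MeasurableSub₂ G] in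
lemma mul_conj_self (x : G) : f x * (starRingEnd ℂ) (f x) = 1 := by
  rw [Complex.mul_conj, Complex.normSq_eq_norm_sq, hnorm]; simp

include hadd hnorm in
omit [MeasurableSpace G] [MeasurableAdd₂ G] [MeasurableSub₂ G] in
lemma character_sub (x y : G) : f (x - y) = f x * (starRingEnd ℂ) (f y) := by
  have h := hadd (x - y) y
  rw [sub_add_cancel] at h
  rw [h, mul_assoc, mul_conj_self hnorm, mul_one]

variable [MeasurableNeg G] [m.IsAddLeftInvariant] [m.IsNegInvariant]

omit [IsProbabilityMeasure m] [MeasurableSub₂ G] in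
include hadd hnorm in
/-- A character is an eigenfunction of the transition operator of the motion of a point. -/
lemma integral_character_rot (z : G) : ∫ x, f (rot φ x z) ∂m
    = (∫ u, f (φ u) * (starRingEnd ℂ) (f u) ∂m) * f z := by
  have h := integral_sub_left_eq_self (fun u => f (φ u) * (starRingEnd ℂ) (f u) * f z) m z
  rw [← integral_mul_const, ← h]
  refine integral_congr_ae (Filter.Eventually.of_forall fun x => ?_)
  simp only
  rw [rot, hadd, character_sub hadd hnorm z x]
  simp only [map_mul, Complex.conj_conj]
  have := mul_conj_self hnorm z
  linear_combination (-(f (φ (z - x)) * f x)) * this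

include hf hadd hnorm in
lemma integral_foot_succ (hφ : Measurable φ) {g : (ℕ → G) → ℂ} (hg : Measurable g)
    (hg1 : ∀ s, ‖g s‖ ≤ 1) (n : ℕ) :
    ∫ s, f (foot φ s (n + 1)) * g (fun i => s (i + 1)) ∂seqLaw m
      = (∫ u, f (φ u) * (starRingEnd ℂ) (f u) ∂m) * ∫ s, f (foot φ s n) * g s ∂seqLaw m := by
  rw [integral_consSeq (c := 1)]
  · rw [← integral_const_mul]
    refine integral_congr_ae (Filter.Eventually.of_forall fun s => ?_)
    simp only [foot_consSeq_succ]
    change ∫ x, f (rot φ x (foot φ s n)) * g s ∂m = _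
    rw [integral_mul_const, integral_character_rot hadd hnorm, mul_assoc]
  · refine (hf.comp (measurable_foot hφ _)).mul (hg.comp ?_)
    exact measurable_pi_iff.2 fun i => measurable_pi_apply _
  · intro s
    rw [norm_mul, hnorm, one_mul]
    exact hg1 _

include hf hadd hnorm in
/-- The correlation of the foot of a particle with its position decays geometrically. -/
lemma integral_foot_conj (hφ : Measurable φ) (n : ℕ) :
    ∫ s, f (foot φ s n) * (starRingEnd ℂ) (f (s n)) ∂seqLaw m
      = (∫ u, f (φ u) * (starRingEnd ℂ) (f u) ∂m) ^ n := by
  induction n with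
  | zero =>
    have : ∀ s : ℕ → G, f (foot φ s 0) * (starRingEnd ℂ) (f (s 0)) = 1 :=
      fun s => mul_conj_self hnorm _
    simp [this]
  | succ n ih =>
    rw [pow_succ', ← ih]
    refine integral_foot_succ hf hadd hnorm hφ (g := fun s => (starRingEnd ℂ) (f (s n))) ?_ ?_ n
    · exact Complex.continuous_conj.measurable.comp (hf.comp (measurable_pi_apply n))
    · intro s; simp [hnorm]

omit [MeasurableNeg G] in
lemma measurable_rot_apply (hφ : Measurable φ) (n : ℕ) :
    Measurable fun s : ℕ → G => rot φ (s n) (s (n + 1)) := by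
  have h : Measurable fun s : ℕ → G => (s n, s (n + 1)) :=
    (measurable_pi_apply n).prodMk (measurable_pi_apply (n + 1))
  exact (measurable_rot hφ).comp h

include hf hadd hnorm in
lemma integral_foot_succ_conj (hφ : Measurable φ) (n : ℕ) :
    ∫ s, f (foot φ s (n + 1)) * (starRingEnd ℂ) (f (rot φ (s n) (s (n + 1)))) ∂seqLaw m
      = (∫ u, f (φ u) * (starRingEnd ℂ) (f u) ∂m) ^ n := by
  induction n with
  | zero =>
    have : ∀ s : ℕ → G, f (foot φ s (0 + 1)) * (starRingEnd ℂ) (f (rot φ (s 0) (s (0 + 1)))) = 1 :=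
      fun s => mul_conj_self hnorm _
    simp only [this]; simp
  | succ n ih =>
    rw [pow_succ', ← ih]
    refine integral_foot_succ hf hadd hnorm hφ
      (g := fun s => (starRingEnd ℂ) (f (rot φ (s n) (s (n + 1))))) ?_ ?_ (n + 1)
    · exact Complex.continuous_conj.measurable.comp (hf.comp (measurable_rot_apply hφ n))
    · intro s; simp [hnorm]

include hf hadd hnorm in
lemma integral_rot_conj (hφ : Measurable φ) (n : ℕ) :
    ∫ s, f (rot φ (s n) (s (n + 1))) * (starRingEnd ℂ) (f (s n)) ∂seqLaw m
      = ∫ u, f (φ u) ∂m := by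
  have hmeas : ∀ n, Measurable fun s : ℕ → G =>
      f (rot φ (s n) (s (n + 1))) * (starRingEnd ℂ) (f (s n)) := fun n =>
    (hf.comp (measurable_rot_apply hφ n)).mul
      (Complex.continuous_conj.measurable.comp (hf.comp (measurable_pi_apply n)))
  have hb : ∀ n, ∀ s : ℕ → G,
      ‖f (rot φ (s n) (s (n + 1))) * (starRingEnd ℂ) (f (s n))‖ ≤ 1 := fun n s => by simp [hnorm]
  induction n with
  | zero =>
    rw [integral_consSeq (hmeas 0) (hb 0)]
    have : ∀ s : ℕ → G, ∫ x, f (rot φ (consSeq (x, s) 0) (consSeq (x, s) (0 + 1)))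
        * (starRingEnd ℂ) (f (consSeq (x, s) 0)) ∂m = ∫ u, f (φ u) ∂m := by
      intro s
      rw [← integral_sub_left_eq_self (fun u => f (φ u)) m (s 0)]
      refine integral_congr_ae (Filter.Eventually.of_forall fun x => ?_)
      change f (φ (s 0 - x) + x) * (starRingEnd ℂ) (f x) = f (φ (s 0 - x))
      rw [hadd, mul_assoc, mul_conj_self hnorm, mul_one]
    simp [this]
  | succ n ih =>
    rw [integral_consSeq (hmeas (n + 1)) (hb (n + 1)), ← ih]
    refine integral_congr_ae (Filter.Eventually.of_forall fun s => ?_)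
    change ∫ x, f (rot φ (s n) (s (n + 1))) * (starRingEnd ℂ) (f (s n)) ∂m = _
    simp

omit [AddCommGroup G] [MeasurableSpace G] [MeasurableAdd₂ G] [MeasurableSub₂ G]
  [MeasurableNeg G] in
include hnorm in
lemma sq_norm_sub_eq (a b : G) :
    ‖f a - f b‖ ^ 2 = 2 - 2 * (f a * (starRingEnd ℂ) (f b)).re := by
  rw [← Complex.normSq_eq_norm_sq, Complex.normSq_sub, Complex.normSq_eq_norm_sq,
    Complex.normSq_eq_norm_sq, hnorm, hnorm]
  ring

omit [AddCommGroup G] [MeasurableAdd₂ G] [MeasurableSub₂ G] [MeasurableNeg G] in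
include hf hnorm in
lemma integral_sq_norm_sub {Ω : Type*} [MeasurableSpace Ω] {P : Measure Ω}
    [IsProbabilityMeasure P] {a b : Ω → G} (ha : Measurable a) (hb : Measurable b) :
    Integrable (fun s => ‖f (a s) - f (b s)‖ ^ 2) P ∧ ∫ s, ‖f (a s) - f (b s)‖ ^ 2 ∂P
      = 2 - 2 * (∫ s, f (a s) * (starRingEnd ℂ) (f (b s)) ∂P).re := by
  have hi : Integrable (fun s => f (a s) * (starRingEnd ℂ) (f (b s))) P :=
    Integrable.of_bound ((hf.comp ha).mul
      (Complex.continuous_conj.measurable.comp (hf.comp hb))).aestronglyMeasurable 1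
      (Filter.Eventually.of_forall fun s => by simp [hnorm])
  simp_rw [sq_norm_sub_eq hnorm]
  have hre : Integrable (fun s => (f (a s) * (starRingEnd ℂ) (f (b s))).re) P := hi.re
  refine ⟨(integrable_const _).sub (hre.const_mul 2), ?_⟩
  rw [integral_sub (integrable_const _) (hre.const_mul 2), integral_const_mul]
  have : ∫ s, (f (a s) * (starRingEnd ℂ) (f (b s))).re ∂P
      = (∫ s, f (a s) * (starRingEnd ℂ) (f (b s)) ∂P).re := integral_re hi
  rw [this]
  simp

include hf hadd hnorm in
/-- The particles of index `n` and `n + 1` have different feet with a probability that is bounded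
below as long as `n (1 - q)` is small: the foot of the first is then close to its position `s n`,
and the foot of the second to `rot φ (s n) (s (n + 1))`, measured by the character `f`. -/
lemma le_seqLaw_foot_ne [MeasurableSingletonClass G] (hφ : Measurable φ) {q : ℝ}
    (hq : ∫ u, f (φ u) * (starRingEnd ℂ) (f u) ∂m = q) (n : ℕ) :
    (1 - (∫ u, f (φ u) ∂m).re) / 2 - 2 * n * (1 - q)
      ≤ (seqLaw m).real {s | foot φ s n ≠ foot φ s (n + 1)} := by
  have hq1 : -1 ≤ q := by
    have h1 : ‖∫ u, f (φ u) * (starRingEnd ℂ) (f u) ∂m‖ ≤ 1 := by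
      refine (norm_integral_le_of_norm_le_const (C := 1)
        (Filter.Eventually.of_forall fun u => by simp [hnorm])).trans (by simp)
    rw [hq, Complex.norm_real] at h1
    exact (abs_le.1 h1).1
  have hpow : 1 - n * (1 - q) ≤ q ^ n := by
    have := one_add_mul_le_pow (a := q - 1) (by linarith) n
    simp only [add_sub_cancel] at this
    linarith
  have hu : Measurable fun s : ℕ → G => s n := measurable_pi_apply n
  have hv : Measurable fun s : ℕ → G => rot φ (s n) (s (n + 1)) :=
    measurable_rot_apply hφ n
  obtain ⟨i1, e1⟩ := integral_sq_norm_sub hf hnorm (P := seqLaw m) (measurable_foot hφ n) hu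
  obtain ⟨i2, e2⟩ := integral_sq_norm_sub hf hnorm (P := seqLaw m) (measurable_foot hφ (n + 1)) hv
  obtain ⟨i3, e3⟩ := integral_sq_norm_sub hf hnorm (P := seqLaw m) hv hu
  rw [integral_foot_conj hf hadd hnorm hφ, hq, ← Complex.ofReal_pow, Complex.ofReal_re] at e1
  rw [integral_foot_succ_conj hf hadd hnorm hφ, hq, ← Complex.ofReal_pow, Complex.ofReal_re] at e2
  rw [integral_rot_conj hf hadd hnorm hφ] at e3
  set E := {s : ℕ → G | foot φ s n ≠ foot φ s (n + 1)} with hE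
  have hEm : MeasurableSet E := (measurableSet_foot_eq hφ n (n + 1)).compl
  have i4 : Integrable (E.indicator fun _ => (4 : ℝ)) (seqLaw m) :=
    (integrable_const _).indicator hEm
  have hle : ∀ s, ‖f (rot φ (s n) (s (n + 1))) - f (s n)‖ ^ 2
      ≤ 2 * ‖f (foot φ s n) - f (s n)‖ ^ 2
        + 2 * ‖f (foot φ s (n + 1)) - f (rot φ (s n) (s (n + 1)))‖ ^ 2
        + E.indicator (fun _ => (4 : ℝ)) s := by
    intro s
    by_cases hs : s ∈ E
    · rw [Set.indicator_of_mem hs]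
      have h1 : ‖f (rot φ (s n) (s (n + 1))) - f (s n)‖ ≤ 2 := by
        refine (norm_sub_le _ _).trans ?_
        rw [hnorm, hnorm]; norm_num
      have h2 := pow_le_pow_left₀ (norm_nonneg _) h1 2
      nlinarith [sq_nonneg ‖f (foot φ s n) - f (s n)‖,
        sq_nonneg ‖f (foot φ s (n + 1)) - f (rot φ (s n) (s (n + 1)))‖]
    · rw [Set.indicator_of_notMem hs, add_zero]
      have hs' : foot φ s n = foot φ s (n + 1) := not_not.1 hs
      rw [← hs']
      have h1 : ‖f (rot φ (s n) (s (n + 1))) - f (s n)‖ ≤ ‖f (foot φ s n) - f (s n)‖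
          + ‖f (foot φ s n) - f (rot φ (s n) (s (n + 1)))‖ := by
        rw [norm_sub_rev (f (foot φ s n)) (f (rot φ (s n) (s (n + 1))))]
        exact (norm_sub_le_norm_sub_add_norm_sub (f (rot φ (s n) (s (n + 1)))) (f (foot φ s n))
          (f (s n))).trans_eq (add_comm _ _)
      have h2 := pow_le_pow_left₀ (norm_nonneg _) h1 2
      nlinarith [sq_nonneg (‖f (foot φ s n) - f (s n)‖
          - ‖f (foot φ s n) - f (rot φ (s n) (s (n + 1)))‖)]
  have hmono := integral_mono i3 (((i1.const_mul 2).add (i2.const_mul 2)).add i4) hle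
  have e4 : ∫ s, (2 * ‖f (foot φ s n) - f (s n)‖ ^ 2
        + 2 * ‖f (foot φ s (n + 1)) - f (rot φ (s n) (s (n + 1)))‖ ^ 2
        + E.indicator (fun _ => (4 : ℝ)) s) ∂seqLaw m
      = 2 * (2 - 2 * q ^ n) + 2 * (2 - 2 * q ^ n) + (seqLaw m).real E * 4 := by
    rw [integral_add (f := fun s => 2 * ‖f (foot φ s n) - f (s n)‖ ^ 2
        + 2 * ‖f (foot φ s (n + 1)) - f (rot φ (s n) (s (n + 1)))‖ ^ 2)
      ((i1.const_mul 2).add (i2.const_mul 2)) i4,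
      integral_add (i1.const_mul 2) (i2.const_mul 2), integral_const_mul, integral_const_mul,
      e1, e2, integral_indicator_const _ hEm, smul_eq_mul]
  have h5 := hmono.trans_eq e4
  rw [e3] at h5
  linarith

end

/-! ### The motion of the bottom circle under a slit map -/

section
variable {N ℓ : ℝ} (hN : 0 < N) (hℓ : 0 < ℓ)

include hN in
lemma cosC_eq_cos_norm (x : AddCircle (2 * Real.pi * N)) : cosC N x = Real.cos (‖x‖ / N) := by
  induction x using QuotientAddGroup.induction_on with
  | H x =>
    rw [cosC_coe hN, AddCircle.norm_eq, ← Real.cos_abs (|_| / N), abs_div, abs_abs, ← abs_div,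
      Real.cos_abs, sub_div]
    have : ((round ((2 * Real.pi * N)⁻¹ * x) : ℤ) : ℝ) * (2 * Real.pi * N) / N
        = (round ((2 * Real.pi * N)⁻¹ * x) : ℤ) * (2 * Real.pi) := by
      field_simp
    rw [this, Real.cos_sub_int_mul_two_pi]

include hN in
lemma one_sub_le_cosC {r : ℝ} {x : AddCircle (2 * Real.pi * N)} (hx : ‖x‖ ≤ N * r) :
    1 - r ^ 2 / 2 ≤ cosC N x := by
  rw [cosC_eq_cos_norm hN]
  have h1 := Real.one_sub_sq_div_two_le_cos (x := ‖x‖ / N)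
  have h2 : ‖x‖ / N ≤ r := by rw [div_le_iff₀ hN]; linarith
  have h3 : 0 ≤ ‖x‖ / N := by positivity
  nlinarith

include hN in
lemma cosC_add_pi (x : AddCircle (2 * Real.pi * N)) :
    cosC N (x + ((Real.pi * N : ℝ) : AddCircle (2 * Real.pi * N))) = -cosC N x := by
  induction x using QuotientAddGroup.induction_on with
  | H x =>
    rw [← AddCircle.coe_add, cosC_coe hN, cosC_coe hN, ← Real.cos_add_pi]
    congr 1
    field_simp

include hN hℓ

/-- In the coordinate `cos (x / N)`, the motion of the bottom circle is affine with slope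
`1 / (1 - δ²)`, capped at `1`. -/
lemma cosC_collapse (y : AddCircle (2 * Real.pi * N)) : cosC N (collapse N ℓ y)
    = min 1 ((1 + cosC N y) / (1 - slitParam N ℓ ^ 2) - 1) := by
  obtain ⟨h0, h1, -, -⟩ := slitMap_spec hN hℓ (p := (y, (0 : ℝ))) le_rfl
  simp only [zero_div, Real.cosh_zero, mul_one] at h1
  rw [add_comm 1 (cosC N y), ← h1, add_sub_cancel_right]
  rcases slitMap_base hN hℓ (p := (y, (0 : ℝ))) rfl with h | ⟨h, -, -⟩
  · rw [h, zero_div, Real.cosh_zero, mul_one, min_eq_right]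
    · rfl
    · have := cosC_sq_add_sinC_sq N (slitMap N ℓ (y, 0)).1
      nlinarith [sq_nonneg (sinC N (slitMap N ℓ (y, 0)).1)]
  · rw [collapse, h, cosC_zero, one_mul, min_eq_left (Real.one_le_cosh _)]

lemma sinC_collapse_nonneg {y : AddCircle (2 * Real.pi * N)} (h : 0 ≤ sinC N y) :
    0 ≤ sinC N (collapse N ℓ y) :=
  (slitMap_spec hN hℓ (p := (y, (0 : ℝ))) le_rfl).2.2.2.1 h

lemma sinC_collapse_nonpos {y : AddCircle (2 * Real.pi * N)} (h : sinC N y ≤ 0) :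
    sinC N (collapse N ℓ y) ≤ 0 :=
  (slitMap_spec hN hℓ (p := (y, (0 : ℝ))) le_rfl).2.2.2.2 h

omit hℓ in
lemma eq_zero_of_cosC_eq_one {y : AddCircle (2 * Real.pi * N)} (h : cosC N y = 1) : y = 0 := by
  refine circle_ext hN (by rw [h, cosC_zero]) ?_
  have := cosC_sq_add_sinC_sq N y
  rw [sinC_zero]
  have : sinC N y ^ 2 = 0 := by rw [h] at this; linarith
  exact pow_eq_zero_iff (two_ne_zero) |>.1 this

lemma collapse_neg (y : AddCircle (2 * Real.pi * N)) :
    collapse N ℓ (-y) = -collapse N ℓ y := by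
  have hcos : cosC N (collapse N ℓ (-y)) = cosC N (collapse N ℓ y) := by
    rw [cosC_collapse hN hℓ, cosC_collapse hN hℓ, cosC_neg]
  refine circle_ext hN (by rw [hcos, cosC_neg]) ?_
  rw [sinC_neg]
  have h1 := cosC_sq_add_sinC_sq N (collapse N ℓ (-y))
  have h2 := cosC_sq_add_sinC_sq N (collapse N ℓ y)
  have h3 : sinC N (collapse N ℓ (-y)) ^ 2 = sinC N (collapse N ℓ y) ^ 2 := by
    rw [hcos] at h1; linarith
  rcases sq_eq_sq_iff_eq_or_eq_neg.1 h3 with h | h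
  · have hs := sinC_neg N y
    rcases le_total 0 (sinC N y) with h0 | h0
    · have := sinC_collapse_nonneg hN hℓ h0
      have := sinC_collapse_nonpos hN hℓ (y := -y) (by linarith)
      linarith
    · have := sinC_collapse_nonpos hN hℓ h0
      have := sinC_collapse_nonneg hN hℓ (y := -y) (by linarith)
      linarith
  · exact h

lemma cosC_collapse_of_ne {y : AddCircle (2 * Real.pi * N)} (h : collapse N ℓ y ≠ 0) :
    1 + cosC N y = (1 - slitParam N ℓ ^ 2) * (1 + cosC N (collapse N ℓ y)) := by
  have hc : 0 < 1 - slitParam N ℓ ^ 2 := by have := slitParam_sq_lt_one hN hℓ; linarith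
  have h1 := cosC_collapse hN hℓ y
  rcases min_choice 1 ((1 + cosC N y) / (1 - slitParam N ℓ ^ 2) - 1) with h2 | h2
  · rw [h2] at h1; exact absurd (eq_zero_of_cosC_eq_one hN h1) h
  · rw [h2] at h1; rw [h1]; field_simp; ring

lemma collapse_eq_zero_iff {y : AddCircle (2 * Real.pi * N)} :
    collapse N ℓ y = 0 ↔ 1 - 2 * slitParam N ℓ ^ 2 ≤ cosC N y := by
  have hc : 0 < 1 - slitParam N ℓ ^ 2 := by have := slitParam_sq_lt_one hN hℓ; linarith
  have h1 := cosC_collapse hN hℓ y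
  constructor
  · intro h
    rw [h, cosC_zero] at h1
    have := min_eq_left_iff.1 h1.symm
    rw [le_sub_iff_add_le, le_div_iff₀ hc] at this
    linarith
  · intro h
    refine eq_zero_of_cosC_eq_one hN ?_
    rw [h1, min_eq_left]
    rw [le_sub_iff_add_le, le_div_iff₀ hc]
    linarith

lemma collapse_eq_collapse {y z : AddCircle (2 * Real.pi * N)}
    (h : collapse N ℓ y = collapse N ℓ z) : y = z ∨ collapse N ℓ y = 0 := by
  by_contra! hne
  have h1 := cosC_collapse_of_ne hN hℓ hne.2
  have h2 := cosC_collapse_of_ne hN hℓ (h ▸ hne.2)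
  rw [← h] at h2
  have hcos : cosC N y = cosC N z := by linarith
  have hy := cosC_sq_add_sinC_sq N y
  have hz := cosC_sq_add_sinC_sq N z
  have hsq : sinC N y ^ 2 = sinC N z ^ 2 := by rw [hcos] at hy; linarith
  rcases sq_eq_sq_iff_eq_or_eq_neg.1 hsq with h3 | h3
  · exact hne.1 (circle_ext hN hcos h3)
  · have h4 : sinC N (collapse N ℓ y) = 0 := by
      rcases le_total 0 (sinC N y) with h0 | h0
      · have h5 := sinC_collapse_nonneg hN hℓ h0
        have h6 := sinC_collapse_nonpos hN hℓ (y := z) (by linarith)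
        rw [← h] at h6; linarith
      · have h5 := sinC_collapse_nonpos hN hℓ h0
        have h6 := sinC_collapse_nonneg hN hℓ (y := z) (by linarith)
        rw [← h] at h6; linarith
    have h5 := cosC_sq_add_sinC_sq N (collapse N ℓ y)
    rw [h4] at h5
    have h6 : cosC N (collapse N ℓ y) = -1 := by
      rcases sq_eq_sq_iff_eq_or_eq_neg.1 (show cosC N (collapse N ℓ y) ^ 2 = 1 ^ 2 by linarith)
        with h7 | h7
      · exact absurd (eq_zero_of_cosC_eq_one hN h7) hne.2
      · exact h7
    have h7 : cosC N y = -1 := by rw [h6] at h1; linarith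
    have h8 : sinC N y = 0 := by rw [h7] at hy; nlinarith
    exact hne.1 (circle_ext hN hcos (by linarith))

/-- The inverse of the motion of the circle, in the coordinate on `(0, 2πN)`. -/
lemma exists_inverse_collapse {y : ℝ} (hy : y ∈ Set.Ioo 0 (2 * Real.pi * N))
    (h : collapse N ℓ (y : AddCircle (2 * Real.pi * N)) ≠ 0) :
    ∃ w ∈ Set.Ioo 0 (2 * Real.pi * N), collapse N ℓ (y : AddCircle (2 * Real.pi * N)) = (w : ℝ) ∧
      y = 2 * N * Real.arccos (√(1 - slitParam N ℓ ^ 2) * Real.cos (w / (2 * N))) := by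
  have hT : 0 < 2 * Real.pi * N := by positivity
  have : Fact (0 < 2 * Real.pi * N) := ⟨hT⟩
  have hc : 0 < 1 - slitParam N ℓ ^ 2 := by have := slitParam_sq_lt_one hN hℓ; linarith
  obtain ⟨w, hw, hw2⟩ : collapse N ℓ (y : AddCircle (2 * Real.pi * N))
      ∈ ((↑) : ℝ → AddCircle (2 * Real.pi * N)) '' Set.Ico 0 (0 + 2 * Real.pi * N) := by
    rw [AddCircle.coe_image_Ico_eq]; trivial
  rw [zero_add] at hw
  have hw0 : w ≠ 0 := by
    rintro rfl
    exact h (by rw [← hw2]; rfl)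
  have hw1 : 0 < w := lt_of_le_of_ne hw.1 (Ne.symm hw0)
  refine ⟨w, ⟨hw1, hw.2⟩, hw2.symm, ?_⟩
  have e1 := cosC_collapse_of_ne hN hℓ h
  have half : ∀ v : ℝ, v / N = 2 * (v / (2 * N)) := fun v => by field_simp
  rw [← hw2, cosC_coe hN, cosC_coe hN, half, half, Real.cos_two_mul, Real.cos_two_mul] at e1
  have hrange : ∀ v ∈ Set.Ioo 0 (2 * Real.pi * N), 0 < v / (2 * N) ∧ v / (2 * N) < Real.pi := by
    intro v hv
    refine ⟨div_pos hv.1 (by positivity), ?_⟩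
    rw [div_lt_iff₀ (by positivity)]
    linarith [hv.2]
  obtain ⟨y1, y2⟩ := hrange y hy
  obtain ⟨w1, w2⟩ := hrange w ⟨hw1, hw.2⟩
  have sy := Real.sin_pos_of_pos_of_lt_pi y1 y2
  have sw := Real.sin_pos_of_pos_of_lt_pi w1 w2
  have e2 : Real.cos (y / (2 * N)) ^ 2
      = (√(1 - slitParam N ℓ ^ 2) * Real.cos (w / (2 * N))) ^ 2 := by
    rw [mul_pow, Real.sq_sqrt hc.le]; linarith
  have s1 : 0 ≤ Real.cos (y / (2 * N)) → 0 ≤ Real.cos (w / (2 * N)) := by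
    intro h0
    have := sinC_collapse_nonneg hN hℓ (y := (y : ℝ)) (by
      rw [sinC_coe hN, half, Real.sin_two_mul]; positivity)
    rw [← hw2, sinC_coe hN, half, Real.sin_two_mul] at this
    exact nonneg_of_mul_nonneg_right this (by positivity)
  have s2 : Real.cos (y / (2 * N)) ≤ 0 → Real.cos (w / (2 * N)) ≤ 0 := by
    intro h0
    have := sinC_collapse_nonpos hN hℓ (y := (y : ℝ)) (by
      rw [sinC_coe hN, half, Real.sin_two_mul]
      exact mul_nonpos_of_nonneg_of_nonpos (by positivity) h0)
    rw [← hw2, sinC_coe hN, half, Real.sin_two_mul] at this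
    by_contra! h1
    have : 0 < 2 * Real.sin (w / (2 * N)) * Real.cos (w / (2 * N)) := by positivity
    linarith
  have e3 : Real.cos (y / (2 * N)) = √(1 - slitParam N ℓ ^ 2) * Real.cos (w / (2 * N)) := by
    have hs : 0 < √(1 - slitParam N ℓ ^ 2) := Real.sqrt_pos.2 hc
    rcases sq_eq_sq_iff_eq_or_eq_neg.1 e2 with h3 | h3
    · exact h3
    · rcases le_total 0 (Real.cos (y / (2 * N))) with h0 | h0
      · have := mul_nonneg hs.le (s1 h0); linarith
      · have := mul_nonneg_of_nonpos_of_nonpos (neg_nonpos.2 hs.le) (s2 h0); linarith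
  rw [← e3, Real.arccos_cos y1.le y2.le]
  field_simp

end

/-! ### The one-step estimates for the slit map -/

section
variable {T : ℝ} [hT : Fact (0 < T)]

/-- The normalized measure of a set in terms of its lift to `(0, T)`. -/
lemma volume_lift {E : Set (AddCircle T)} (hE : MeasurableSet E) :
    volume {w : ℝ | w ∈ Set.Ioo 0 T ∧ (w : AddCircle T) ∈ E}
      = ENNReal.ofReal T * AddCircle.haarAddCircle E := by
  have h1 := (AddCircle.measurePreserving_mk T 0).measure_preimage hE.nullMeasurableSet
  rw [AddCircle.volume_eq_smul_haarAddCircle, Measure.smul_apply, smul_eq_mul, zero_add] at h1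
  rw [← h1, ← restrict_Ioo_eq_restrict_Ioc, Measure.restrict_apply
    (AddCircle.measurable_mk' hE), Set.inter_comm]
  rfl

lemma haarAddCircle_real_closedBall (x : AddCircle T) {r : ℝ} (hr : 0 ≤ r) (hrT : 2 * r ≤ T) :
    AddCircle.haarAddCircle.real (Metric.closedBall x r) = 2 * r / T := by
  have h1 := AddCircle.volume_closedBall T (x := x) r
  rw [AddCircle.volume_eq_smul_haarAddCircle, Measure.smul_apply, smul_eq_mul,
    min_eq_right hrT] at h1
  have h2 := congrArg ENNReal.toReal h1
  rw [ENNReal.toReal_mul, ENNReal.toReal_ofReal hT.out.le, ENNReal.toReal_ofReal (by linarith)]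
    at h2
  rw [eq_div_iff hT.out.ne', mul_comm]
  exact h2

end

section
variable {N ℓ : ℝ} (hN : 0 < N) (hℓ : 0 < ℓ)

/-- A bound for the derivative of the inverse motion of the circle: it is at most `1`, and at
most `r` where the sine is at most `r δ`. -/
lemma sqrt_mul_div_le {δ s C r : ℝ} (hδ : 0 < δ) (hδ1 : δ < 1) (hs : 0 ≤ s) (hC : s ^ 2 + C ^ 2 = 1)
    (hr : 0 ≤ r) (hsr : r = 1 ∨ s ≤ r * δ) :
    √(1 - δ ^ 2) * s / √(1 - (√(1 - δ ^ 2) * C) ^ 2) ≤ r := by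
  have hc : 0 < 1 - δ ^ 2 := by nlinarith
  have hs1 : s ^ 2 ≤ 1 := by nlinarith [sq_nonneg C]
  have hpos : 0 < 1 - (√(1 - δ ^ 2) * C) ^ 2 := by
    rw [mul_pow, Real.sq_sqrt hc.le]; nlinarith [sq_nonneg s, sq_nonneg C]
  rw [div_le_iff₀ (Real.sqrt_pos.2 hpos)]
  refine abs_le_of_sq_le_sq' ?_ (by positivity) |>.2
  rw [mul_pow, mul_pow, Real.sq_sqrt hc.le, Real.sq_sqrt hpos.le, mul_pow, Real.sq_sqrt hc.le]
  rcases hsr with rfl | h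
  · nlinarith
  · have h2 : s ^ 2 ≤ (r * δ) ^ 2 := pow_le_pow_left₀ hs h 2
    have h3 : 1 - (1 - δ ^ 2) * C ^ 2 = δ ^ 2 + (1 - δ ^ 2) * s ^ 2 := by
      linear_combination (-(1 - δ ^ 2)) * hC
    rw [h3]
    have h4 : 0 ≤ r ^ 2 * ((1 - δ ^ 2) * s ^ 2) := by positivity
    nlinarith [mul_nonneg (sq_nonneg δ) (sq_nonneg s)]

include hN hℓ

/-- The motion of the circle is a contraction of the measure outside of the preimage of `0`, by a
factor `1 / 2` on the ball of radius `N δ`. -/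
lemma measure_collapse_preimage_add_le [Fact (0 < 2 * Real.pi * N)]
    {E : Set (AddCircle (2 * Real.pi * N))} (hE : MeasurableSet E) (h0 : 0 ∉ E) :
    (AddCircle.haarAddCircle).real (collapse N ℓ ⁻¹' E) + 1 / 2 * (AddCircle.haarAddCircle).real
      (E ∩ Metric.closedBall 0 (N * slitParam N ℓ)) ≤ (AddCircle.haarAddCircle).real E := by
  have hT : 0 < 2 * Real.pi * N := Fact.out
  have hδ := slitParam_pos hN hℓ
  have hδ1 := slitParam_lt_one N ℓ
  set δ := slitParam N ℓ with hδdef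
  have hc : 0 < 1 - δ ^ 2 := by nlinarith
  set B : Set (AddCircle (2 * Real.pi * N)) := Metric.closedBall 0 (N * δ) with hB
  have hBm : MeasurableSet B := Metric.isClosed_closedBall.measurableSet
  set lift : Set (AddCircle (2 * Real.pi * N)) → Set ℝ := fun E =>
    {w : ℝ | w ∈ Set.Ioo 0 (2 * Real.pi * N) ∧ (w : AddCircle (2 * Real.pi * N)) ∈ E} with hlift
  have hliftm : ∀ E, MeasurableSet E → MeasurableSet (lift E) := fun E hE =>
    measurableSet_Ioo.inter (AddCircle.measurable_mk' hE)
  set γ : ℝ → ℝ := fun w => 2 * N * Real.arccos (√(1 - δ ^ 2) * Real.cos (w / (2 * N))) with hγ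
  set γ' : ℝ → ℝ := fun w => √(1 - δ ^ 2) * Real.sin (w / (2 * N))
    / √(1 - (√(1 - δ ^ 2) * Real.cos (w / (2 * N))) ^ 2) with hγ'
  have hrange : ∀ v ∈ Set.Ioo 0 (2 * Real.pi * N), 0 < v / (2 * N) ∧ v / (2 * N) < Real.pi := by
    intro v hv
    refine ⟨div_pos hv.1 (by positivity), ?_⟩
    rw [div_lt_iff₀ (by positivity)]
    linarith [hv.2]
  have hlt : ∀ w, (√(1 - δ ^ 2) * Real.cos (w / (2 * N))) ^ 2 < 1 := by
    intro w
    rw [mul_pow, Real.sq_sqrt hc.le]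
    nlinarith [Real.sin_sq_add_cos_sq (w / (2 * N)), sq_nonneg (Real.sin (w / (2 * N))),
      sq_nonneg (Real.cos (w / (2 * N)))]
  have hderiv : ∀ w, HasDerivAt γ (γ' w) w := by
    intro w
    obtain ⟨h1, h2⟩ := sq_lt_one_iff_abs_lt_one _ |>.1 (hlt w) |> abs_lt.1
    have h3 := (Real.hasDerivAt_arccos h1.ne' h2.ne)
    have h4 : HasDerivAt (fun w => √(1 - δ ^ 2) * Real.cos (w / (2 * N)))
        (√(1 - δ ^ 2) * (-Real.sin (w / (2 * N)) * (1 / (2 * N)))) w :=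
      ((Real.hasDerivAt_cos _).comp w ((hasDerivAt_id w).div_const _)).const_mul _
    have h5 := (h3.comp w h4).const_mul (2 * N)
    refine h5.congr_deriv ?_
    simp only [hγ']
    field_simp
  have hinj : Set.InjOn γ (lift E) := by
    rintro v ⟨hv, -⟩ w ⟨hw, -⟩ h
    have h1 : Real.arccos (√(1 - δ ^ 2) * Real.cos (v / (2 * N)))
        = Real.arccos (√(1 - δ ^ 2) * Real.cos (w / (2 * N))) :=
      mul_left_cancel₀ (by positivity) h
    obtain ⟨v1, v2⟩ := sq_lt_one_iff_abs_lt_one _ |>.1 (hlt v) |> abs_lt.1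
    obtain ⟨w1, w2⟩ := sq_lt_one_iff_abs_lt_one _ |>.1 (hlt w) |> abs_lt.1
    have h2 := Real.arccos_injOn ⟨v1.le, v2.le⟩ ⟨w1.le, w2.le⟩ h1
    have h3 := mul_left_cancel₀ (Real.sqrt_pos.2 hc).ne' h2
    obtain ⟨v3, v4⟩ := hrange v hv
    obtain ⟨w3, w4⟩ := hrange w hw
    have h4 := Real.injOn_cos ⟨v3.le, v4.le⟩ ⟨w3.le, w4.le⟩ h3
    field_simp at h4
    exact h4
  have hsub : lift (collapse N ℓ ⁻¹' E) ⊆ γ '' lift E := by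
    rintro y ⟨hy, hyE⟩
    have hyE : collapse N ℓ (y : AddCircle (2 * Real.pi * N)) ∈ E := hyE
    obtain ⟨w, hw, h1, h2⟩ := exists_inverse_collapse hN hℓ hy (fun h => h0 (h ▸ hyE))
    exact ⟨w, ⟨hw, h1 ▸ hyE⟩, h2.symm⟩
  have hle : ∀ w ∈ lift E, ENNReal.ofReal |γ' w| + (lift B).indicator (fun _ => 2⁻¹) w ≤ 1 := by
    rintro w ⟨hw, -⟩
    obtain ⟨w1, w2⟩ := hrange w hw
    have hs := Real.sin_pos_of_pos_of_lt_pi w1 w2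
    rw [abs_of_nonneg (by positivity)]
    by_cases hwB : w ∈ lift B
    · have h1 : Real.sin (w / (2 * N)) ≤ 1 / 2 * δ := by
        have h2 := one_sub_le_cosC hN (mem_closedBall_zero_iff.1 hwB.2)
        rw [cosC_coe hN, show w / N = 2 * (w / (2 * N)) by field_simp, Real.cos_two_mul] at h2
        refine abs_le_of_sq_le_sq' ?_ (by positivity) |>.2
        have := Real.sin_sq_add_cos_sq (w / (2 * N))
        nlinarith
      have h3 := sqrt_mul_div_le hδ hδ1 hs.le (Real.sin_sq_add_cos_sq _) (r := 1 / 2) (by norm_num)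
        (Or.inr h1)
      rw [Set.indicator_of_mem hwB]
      calc _ ≤ ENNReal.ofReal (1 / 2) + 2⁻¹ := by gcongr
        _ = 1 := by
          rw [one_div, ENNReal.ofReal_inv_of_pos (by norm_num), ENNReal.ofReal_ofNat,
            ENNReal.inv_two_add_inv_two]
    · rw [Set.indicator_of_notMem hwB, add_zero]
      have h3 := sqrt_mul_div_le hδ hδ1 hs.le (Real.sin_sq_add_cos_sq _) (r := 1) (by norm_num)
        (Or.inl rfl)
      exact ENNReal.ofReal_le_one.2 h3
  have main : volume (lift (collapse N ℓ ⁻¹' E)) + 2⁻¹ * volume (lift (E ∩ B))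
      ≤ volume (lift E) := by
    calc _ ≤ volume (γ '' lift E) + 2⁻¹ * volume (lift (E ∩ B)) := by gcongr
      _ = (∫⁻ w in lift E, ENNReal.ofReal |γ' w|)
          + ∫⁻ w in lift E, (lift B).indicator (fun _ => 2⁻¹) w := by
        congr 1
        · have := lintegral_image_eq_lintegral_abs_deriv_mul (hliftm E hE)
            (fun w _ => (hderiv w).hasDerivWithinAt) hinj (fun _ => 1)
          simpa using this
        · rw [lintegral_indicator (hliftm B hBm), setLIntegral_const,
            Measure.restrict_apply (hliftm B hBm)]
          congr 2
          ext w
          simp only [hlift, Set.mem_inter_iff, Set.mem_ofPred_eq]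
          tauto
      _ = ∫⁻ w in lift E, ENNReal.ofReal |γ' w| + (lift B).indicator (fun _ => 2⁻¹) w := by
        rw [lintegral_add_right _ (measurable_const.indicator (hliftm B hBm))]
      _ ≤ ∫⁻ w in lift E, 1 := setLIntegral_mono' (hliftm E hE) hle
      _ = volume (lift E) := setLIntegral_one _
  have hvol : ∀ E, MeasurableSet E → volume (lift E)
      = ENNReal.ofReal (2 * Real.pi * N) * AddCircle.haarAddCircle E := fun E hE => volume_lift hE
  rw [hvol _ ((continuous_collapse hN hℓ).measurable hE), hvol _ (hE.inter hBm), hvol _ hE,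
    mul_left_comm, ← mul_add,
    ENNReal.mul_le_mul_iff_right (by simpa using hT) ENNReal.ofReal_ne_top] at main
  have h1 := ENNReal.toReal_mono (measure_ne_top _ _) main
  rw [ENNReal.toReal_add (measure_ne_top _ _)
    (ENNReal.mul_ne_top (by norm_num) (measure_ne_top _ _)), ENNReal.toReal_mul] at h1
  simpa [measureReal_def] using h1

/-- The motion of the circle under the slit map is a collapse with `η` of order `δ`. -/
lemma isCollapse_collapse [Fact (0 < 2 * Real.pi * N)] :
    IsCollapse AddCircle.haarAddCircle (collapse N ℓ) (slitParam N ℓ / (16 * Real.pi)) := by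
  have hδ := slitParam_pos hN hℓ
  have hδ1 := slitParam_lt_one N ℓ
  set δ := slitParam N ℓ with hδdef
  have hpi := Real.pi_gt_three
  have hball : ∀ r, 0 ≤ r → r ≤ 1 → (AddCircle.haarAddCircle (T := 2 * Real.pi * N)).real
      (Metric.closedBall 0 (N * r)) = r / Real.pi := by
    intro r hr hr1
    rw [haarAddCircle_real_closedBall _ (by positivity) (by nlinarith)]
    field_simp
  have hR : 0 < N * (δ / 2) := by positivity
  set k : AddCircle (2 * Real.pi * N) → ℝ := fun y => max 0 (1 - ‖y‖ / (N * (δ / 2))) with hk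
  have hkc : Continuous k := by fun_prop
  have hk0 : ∀ y, 0 ≤ k y := fun y => le_max_left _ _
  have hk1 : ∀ y, k y ≤ 1 := fun y => max_le zero_le_one (by
    have : 0 ≤ ‖y‖ / (N * (δ / 2)) := by positivity
    linarith)
  have hsupp : ∀ y, k y ≠ 0 → ‖y‖ ≤ N * (δ / 2) := by
    intro y hy
    by_contra! h
    refine hy (max_eq_left ?_)
    rw [sub_nonpos, le_div_iff₀ hR]
    linarith
  have hki : Integrable k AddCircle.haarAddCircle := Integrable.of_bound
    hkc.aestronglyMeasurable 1 (Filter.Eventually.of_forall fun y => by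
      rw [Real.norm_of_nonneg (hk0 y)]; exact hk1 y)
  have hη : 0 < δ / (16 * Real.pi) := by positivity
  have hkη : 2 * (δ / (16 * Real.pi)) ≤ ∫ y, k y ∂AddCircle.haarAddCircle := by
    have hBm : MeasurableSet (Metric.closedBall (0 : AddCircle (2 * Real.pi * N)) (N * (δ / 4))) :=
      Metric.isClosed_closedBall.measurableSet
    have h1 : ∫ y, (Metric.closedBall (0 : AddCircle (2 * Real.pi * N)) (N * (δ / 4))).indicator
        (fun _ => (1 / 2 : ℝ)) y ∂AddCircle.haarAddCircle = 2 * (δ / (16 * Real.pi)) := by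
      rw [integral_indicator_const _ hBm, hball _ (by positivity) (by linarith), smul_eq_mul]
      field_simp
      norm_num
    rw [← h1]
    refine integral_mono ((integrable_const _).indicator hBm) hki fun y => ?_
    by_cases hy : y ∈ Metric.closedBall (0 : AddCircle (2 * Real.pi * N)) (N * (δ / 4))
    · rw [Set.indicator_of_mem hy]
      refine le_max_of_le_right ?_
      have h2 : ‖y‖ / (N * (δ / 2)) ≤ 1 / 2 := by
        rw [div_le_iff₀ hR]
        have := mem_closedBall_zero_iff.1 hy
        linarith
      linarith
    · rw [Set.indicator_of_notMem hy]
      exact hk0 y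
  refine ⟨(continuous_collapse hN hℓ).measurable, fun y z => collapse_eq_collapse hN hℓ, hη, ?_,
    fun A hA => variance_lower_bound (continuous_collapse hN hℓ).measurable
      (B := Metric.closedBall 0 (N * δ)) Metric.isClosed_closedBall.measurableSet
      (fun E hE h0 => measure_collapse_preimage_add_le hN hℓ hE h0) hkc hk0 hk1 ?_ ?_ hη hkη hA⟩
  · calc δ / (16 * Real.pi) ≤ δ / Real.pi := by
          apply div_le_div_of_nonneg_left hδ.le (by positivity); linarith
      _ = _ := (hball δ hδ.le hδ1.le).symm
      _ ≤ _ := measureReal_mono fun y hy => by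
        refine (collapse_eq_zero_iff hN hℓ).2 ?_
        have := one_sub_le_cosC hN (mem_closedBall_zero_iff.1 hy)
        nlinarith [sq_nonneg δ]
  · intro y hy
    refine mem_closedBall_zero_iff.2 ((hsupp y hy).trans ?_)
    gcongr
    linarith
  · intro y z hy hz
    refine mem_closedBall_zero_iff.2 ((norm_sub_le y z).trans ?_)
    have := hsupp y hy
    have := hsupp z hz
    linarith

end

/-! ### The displacement of the bottom circle -/

lemma continuous_coe_toCircle {T : ℝ} :
    Continuous fun u : AddCircle T => ((AddCircle.toCircle u : Circle) : ℂ) :=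
  Continuous.comp (g := ((↑) : Circle → ℂ)) (by fun_prop) AddCircle.continuous_toCircle

section
variable {N ℓ : ℝ} (hN : 0 < N) (hℓ : 0 < ℓ)

include hN hℓ

lemma sinC_collapse_mul_nonneg (u : AddCircle (2 * Real.pi * N)) :
    0 ≤ sinC N (collapse N ℓ u) * sinC N u := by
  rcases le_total 0 (sinC N u) with h | h
  · exact mul_nonneg (sinC_collapse_nonneg hN hℓ h) h
  · exact mul_nonneg_of_nonpos_of_nonpos (sinC_collapse_nonpos hN hℓ h) h

/-- The squared displacement under one slit map is of order `δ²` near the slit, and decays like the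
inverse square of the distance from it. -/
lemma one_sub_le_displacement (u : AddCircle (2 * Real.pi * N)) :
    1 - (cosC N (collapse N ℓ u) * cosC N u + sinC N (collapse N ℓ u) * sinC N u)
      ≤ 6 * slitParam N ℓ ^ 4 * (1 - cosC N u + slitParam N ℓ ^ 2)⁻¹ := by
  have hδ := slitParam_pos hN hℓ
  have hβb := sinC_collapse_mul_nonneg hN hℓ u
  have hab := cosC_sq_add_sinC_sq N u
  have hαβ := cosC_sq_add_sinC_sq N (collapse N ℓ u)
  have hz := collapse_eq_zero_iff hN hℓ (y := u)
  have hnz := cosC_collapse_of_ne hN hℓ (y := u)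
  have ha1 : cosC N u ≤ 1 := by nlinarith [sq_nonneg (sinC N u)]
  have hα1 : cosC N (collapse N ℓ u) ≤ 1 := by nlinarith [sq_nonneg (sinC N (collapse N ℓ u))]
  have hα2 : -1 ≤ cosC N (collapse N ℓ u) := by nlinarith [sq_nonneg (sinC N (collapse N ℓ u))]
  have ha2 : -1 ≤ cosC N u := by nlinarith [sq_nonneg (sinC N u)]
  have hpos : 0 < 1 - cosC N u + slitParam N ℓ ^ 2 := by nlinarith
  rw [← div_eq_mul_inv, le_div_iff₀ hpos]
  by_cases h0 : collapse N ℓ u = 0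
  · have h1 := hz.1 h0
    rw [h0, cosC_zero, sinC_zero]
    nlinarith
  · have h1 := hnz h0
    have h2 : cosC N u < 1 - 2 * slitParam N ℓ ^ 2 := by
      by_contra! h; exact h0 (hz.2 h)
    set δ := slitParam N ℓ
    set a := cosC N u
    set b := sinC N u
    set α := cosC N (collapse N ℓ u)
    set β := sinC N (collapse N ℓ u)
    -- `1 - αa - βb` is `(α - a)² / (1 - αa + βb)`
    have h3 : (1 - (α * a + β * b)) * (1 - α * a + β * b) = δ ^ 4 * (1 + α) ^ 2 := by
      have : α - a = δ ^ 2 * (1 + α) := by linarith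
      calc _ = (1 - α * a) ^ 2 - β ^ 2 * b ^ 2 := by ring
        _ = (1 - α * a) ^ 2 - (1 - α ^ 2) * (1 - a ^ 2) := by
          rw [show β ^ 2 = 1 - α ^ 2 by linarith, show b ^ 2 = 1 - a ^ 2 by linarith]
        _ = (α - a) ^ 2 := by ring
        _ = _ := by rw [this]; ring
    have h4 : (1 + α) * (1 - a) ≤ 2 * (1 - α * a) := by
      nlinarith [mul_nonneg (sub_nonneg.2 hα1) (by linarith : 0 ≤ 1 + a)]
    have h5 : 0 ≤ 1 - (α * a + β * b) := by nlinarith [sq_nonneg (α - a), sq_nonneg (β - b)]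
    have h6 : 1 - a + δ ^ 2 ≤ 3 / 2 * (1 - a) := by linarith
    rcases hα2.eq_or_lt with h7 | h7
    · have h8 : a = -1 := by rw [← h7] at h1; linarith
      rw [← h7, h8]
      have : β * b = 0 := by
        have : b ^ 2 = 0 := by rw [h8] at hab; linarith
        rw [pow_eq_zero_iff two_ne_zero |>.1 this, mul_zero]
      rw [this]
      have : 0 ≤ 6 * δ ^ 4 := by positivity
      linarith
    · have hα : 0 < 1 + α := by linarith
      -- cancel the factor `1 + α`
      have h8 : (1 - (α * a + β * b)) * (1 - a) * (1 + α) ≤ 2 * δ ^ 4 * (1 + α) * (1 + α) := by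
        calc _ = (1 - (α * a + β * b)) * ((1 + α) * (1 - a)) := by ring
          _ ≤ (1 - (α * a + β * b)) * (2 * (1 - α * a)) := by gcongr
          _ ≤ (1 - (α * a + β * b)) * (2 * (1 - α * a + β * b)) := by gcongr; linarith
          _ = 2 * ((1 - (α * a + β * b)) * (1 - α * a + β * b)) := by ring
          _ = _ := by rw [h3]; ring
      have h9 := le_of_mul_le_mul_right h8 hα
      have h10 : 2 * δ ^ 4 * (1 + α) ≤ 4 * δ ^ 4 := by
        have : 0 ≤ δ ^ 4 := by positivity
        nlinarith
      calc _ ≤ (1 - (α * a + β * b)) * (3 / 2 * (1 - a)) := by gcongr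
        _ ≤ 6 * δ ^ 4 := by linarith

omit hℓ in
lemma integral_inv_one_sub_cosC_le [Fact (0 < 2 * Real.pi * N)] {δ : ℝ} (hδ : 0 < δ) :
    ∫ u, (1 - cosC N u + δ ^ 2)⁻¹ ∂AddCircle.haarAddCircle ≤ 2 / δ := by
  have hpi := Real.pi_pos
  have h1 := AddCircle.integral_preimage (2 * Real.pi * N) (-(Real.pi * N))
    (fun u => (1 - cosC N u + δ ^ 2)⁻¹)
  rw [AddCircle.integral_haarAddCircle, ← h1, smul_eq_mul]
  have h2 : ∫ x in Set.Ioc (-(Real.pi * N)) (-(Real.pi * N) + 2 * Real.pi * N),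
      (1 - cosC N (x : AddCircle (2 * Real.pi * N)) + δ ^ 2)⁻¹
      ≤ ∫ x, (δ ^ 2)⁻¹ * (1 + ((Real.pi * N * δ)⁻¹ * x) ^ 2)⁻¹ := by
    have hi : Integrable fun x : ℝ => (δ ^ 2)⁻¹ * (1 + ((Real.pi * N * δ)⁻¹ * x) ^ 2)⁻¹ :=
      (integrable_inv_one_add_sq.comp_mul_left' (by positivity)).const_mul _
    refine (integral_mono_of_nonneg ?_ hi.integrableOn
      (ae_restrict_of_forall_mem measurableSet_Ioc fun x hx => ?_)).trans
      (setIntegral_le_integral hi (Filter.Eventually.of_forall fun x => by positivity))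
    · refine Filter.Eventually.of_forall fun x => inv_nonneg.2 ?_
      have := cosC_sq_add_sinC_sq N (x : AddCircle (2 * Real.pi * N))
      nlinarith [sq_nonneg (sinC N (x : AddCircle (2 * Real.pi * N)))]
    · have hx' : |x / N| ≤ Real.pi := by
        rw [abs_div, abs_of_pos hN, div_le_iff₀ hN, abs_le]
        constructor <;> linarith [hx.1, hx.2]
      have h3 := Real.cos_le_one_sub_mul_cos_sq hx'
      have h4 : 1 / Real.pi ^ 2 * (x / N) ^ 2 ≤ 2 / Real.pi ^ 2 * (x / N) ^ 2 := by
        gcongr; norm_num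
      simp only [cosC_coe hN]
      rw [← mul_inv]
      refine inv_anti₀ (by positivity) ?_
      calc δ ^ 2 * (1 + ((Real.pi * N * δ)⁻¹ * x) ^ 2)
          = δ ^ 2 + 1 / Real.pi ^ 2 * (x / N) ^ 2 := by field_simp
        _ ≤ _ := by linarith
  rw [integral_const_mul, Measure.integral_comp_mul_left (fun x => (1 + x ^ 2)⁻¹),
    integral_univ_inv_one_add_sq, inv_inv, abs_of_pos (by positivity), smul_eq_mul] at h2
  calc _ ≤ (2 * Real.pi * N)⁻¹ * ((δ ^ 2)⁻¹ * (Real.pi * N * δ * Real.pi)) := by gcongr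
    _ = Real.pi / 2 / δ := by field_simp
    _ ≤ 2 / δ := by
      have := Real.pi_le_four
      gcongr
      linarith

/-- The correlation of `φ u` with `u` misses `1` by a multiple of `δ³` only. -/
lemma exists_correlation [Fact (0 < 2 * Real.pi * N)] :
    ∃ q : ℝ, ∫ u, ((AddCircle.toCircle (collapse N ℓ u) : Circle) : ℂ)
        * (starRingEnd ℂ) ((AddCircle.toCircle u : Circle) : ℂ) ∂AddCircle.haarAddCircle = q ∧
      1 - q ≤ 12 * slitParam N ℓ ^ 3 := by
  have hδ := slitParam_pos hN hℓ
  set m := AddCircle.haarAddCircle (T := 2 * Real.pi * N)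
  set g : AddCircle (2 * Real.pi * N) → ℂ := fun u =>
    ((AddCircle.toCircle (collapse N ℓ u) : Circle) : ℂ)
        * (starRingEnd ℂ) ((AddCircle.toCircle u : Circle) : ℂ) with hg
  have hgc : Continuous g := by
    exact (continuous_coe_toCircle.comp (continuous_collapse hN hℓ)).mul
      (Complex.continuous_conj.comp continuous_coe_toCircle)
  have hgi : Integrable g m := Integrable.of_bound hgc.aestronglyMeasurable 1
    (Filter.Eventually.of_forall fun u => by
      simp only [hg, norm_mul, RCLike.norm_conj, Circle.norm_coe, mul_one, le_refl])
  have hre : ∀ u, (g u).re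
      = cosC N (collapse N ℓ u) * cosC N u + sinC N (collapse N ℓ u) * sinC N u := by
    intro u
    simp only [hg, coe_toCircle, Complex.mul_re, Complex.conj_re, Complex.conj_im]
    ring
  have him : ∀ u, (g u).im
      = sinC N (collapse N ℓ u) * cosC N u - cosC N (collapse N ℓ u) * sinC N u := by
    intro u
    simp only [hg, coe_toCircle, Complex.mul_im, Complex.conj_re, Complex.conj_im]
    ring
  refine ⟨∫ u, (g u).re ∂m, ?_, ?_⟩
  · -- the imaginary part is odd
    have h1 : ∫ u, (g u).im ∂m = 0 := by
      have h2 := integral_neg_eq_self (fun u => (g u).im) m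
      have h3 : ∀ u, (g (-u)).im = -(g u).im := by
        intro u
        rw [him, him, collapse_neg hN hℓ, sinC_neg, cosC_neg, sinC_neg, cosC_neg]
        ring
      simp only [h3, integral_neg] at h2
      linarith
    refine Complex.ext ?_ ?_
    · rw [Complex.ofReal_re]
      exact (integral_re hgi).symm
    · rw [Complex.ofReal_im, ← h1]
      exact (integral_im hgi).symm
  · have hden : ∀ u, 0 < 1 - cosC N u + slitParam N ℓ ^ 2 := by
      intro u
      have := cosC_sq_add_sinC_sq N u
      have : 0 < slitParam N ℓ ^ 2 := by positivity
      nlinarith [sq_nonneg (sinC N u)]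
    have hi : Integrable (fun u => (1 - cosC N u + slitParam N ℓ ^ 2)⁻¹) m := by
      have hc : Continuous fun u => (1 - cosC N u + slitParam N ℓ ^ 2)⁻¹ :=
        ((continuous_const.sub (continuous_cosC N)).add continuous_const).inv₀
          fun u => (hden u).ne'
      exact hc.integrable_of_hasCompactSupport (HasCompactSupport.of_compactSpace _)
    have h1 : 1 - ∫ u, (g u).re ∂m = ∫ u, (1 - (g u).re) ∂m := by
      have := integral_sub (integrable_const (1 : ℝ)) hgi.re
      simpa using this.symm
    calc _ = ∫ u, (1 - (g u).re) ∂m := h1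
      _ ≤ ∫ u, 6 * slitParam N ℓ ^ 4 * (1 - cosC N u + slitParam N ℓ ^ 2)⁻¹ ∂m := by
        refine integral_mono ((integrable_const _).sub hgi.re) (hi.const_mul _) fun u => ?_
        simp only [hre]
        exact one_sub_le_displacement hN hℓ u
      _ ≤ 6 * slitParam N ℓ ^ 4 * (2 / slitParam N ℓ) := by
        rw [integral_const_mul]
        gcongr
        exact integral_inv_one_sub_cosC_le hN hδ
      _ = _ := by field_simp; norm_num

/-- The motion of the circle sends a macroscopic arc around `πN` to the half circle where the cosine
is nonpositive. -/
lemma le_one_sub_integral_collapse [Fact (0 < 2 * Real.pi * N)] :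
    (1 - slitParam N ℓ ^ 2) / Real.pi
      ≤ 1 - (∫ u, ((AddCircle.toCircle (collapse N ℓ u) : Circle) : ℂ)
          ∂AddCircle.haarAddCircle).re := by
  have hδ := slitParam_pos hN hℓ
  have hδ1 := slitParam_lt_one N ℓ
  have hpi := Real.pi_gt_three
  set δ := slitParam N ℓ with hδdef
  have hκ : 0 < 1 - δ ^ 2 := by nlinarith
  have hκ1 : 1 - δ ^ 2 ≤ 1 := by nlinarith
  set m := AddCircle.haarAddCircle (T := 2 * Real.pi * N)
  have hc : Continuous fun u => ((AddCircle.toCircle (collapse N ℓ u) : Circle) : ℂ) :=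
    continuous_coe_toCircle.comp (continuous_collapse hN hℓ)
  have hi : Integrable (fun u => ((AddCircle.toCircle (collapse N ℓ u) : Circle) : ℂ)) m :=
    Integrable.of_bound hc.aestronglyMeasurable 1
      (Filter.Eventually.of_forall fun u => (Circle.norm_coe _).le)
  have h1 : (∫ u, ((AddCircle.toCircle (collapse N ℓ u) : Circle) : ℂ) ∂m).re
      = ∫ u, cosC N (collapse N ℓ u) ∂m := (integral_re hi).symm
  set B := Metric.closedBall ((Real.pi * N : ℝ) : AddCircle (2 * Real.pi * N)) (N * (1 - δ ^ 2))
  have hB : MeasurableSet B := Metric.isClosed_closedBall.measurableSet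
  have h2 : m.real B = (1 - δ ^ 2) / Real.pi := by
    rw [haarAddCircle_real_closedBall _ (by positivity) (by nlinarith)]
    field_simp
  have h3 : 1 - ∫ u, cosC N (collapse N ℓ u) ∂m = ∫ u, (1 - cosC N (collapse N ℓ u)) ∂m := by
    have := integral_sub (integrable_const (1 : ℝ)) hi.re
    simp only [integral_const, probReal_univ, one_smul] at this
    exact this.symm
  rw [h1, h3, ← h2, ← integral_indicator_one hB]
  refine integral_mono ((integrable_const 1).indicator hB) ((integrable_const _).sub hi.re)
    fun u => ?_
  have hle : cosC N (collapse N ℓ u) ≤ 1 := by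
    have := cosC_sq_add_sinC_sq N (collapse N ℓ u)
    nlinarith [sq_nonneg (sinC N (collapse N ℓ u))]
  by_cases hu : u ∈ B
  · rw [Set.indicator_of_mem hu]
    have h4 := one_sub_le_cosC hN (mem_closedBall_iff_norm.1 hu)
    have h5 := cosC_add_pi hN (u - ((Real.pi * N : ℝ) : AddCircle (2 * Real.pi * N)))
    rw [sub_add_cancel] at h5
    have h6 : cosC N (collapse N ℓ u) ≤ 0 := by
      rw [cosC_collapse hN hℓ]
      refine (min_le_right _ _).trans ?_
      rw [sub_nonpos, div_le_one hκ]
      nlinarith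
    simpa using h6
  · rw [Set.indicator_of_notMem hu]
    exact sub_nonneg.2 hle

/-- With probability bounded below, the particles of index `n` and `n + 1` are received by different
trees, as long as `n` is at most a small multiple of `δ⁻³`. -/
lemma le_seqLaw_foot_collapse_ne [Fact (0 < 2 * Real.pi * N)] (n : ℕ) :
    (1 - slitParam N ℓ ^ 2) / (2 * Real.pi) - 24 * n * slitParam N ℓ ^ 3
      ≤ (seqLaw (AddCircle.haarAddCircle (T := 2 * Real.pi * N))).real
        {s | foot (collapse N ℓ) s n ≠ foot (collapse N ℓ) s (n + 1)} := by
  obtain ⟨q, hq, hq1⟩ := exists_correlation hN hℓ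
  have h1 := le_seqLaw_foot_ne (m := AddCircle.haarAddCircle (T := 2 * Real.pi * N))
    (f := fun u => ((AddCircle.toCircle u : Circle) : ℂ))
    continuous_coe_toCircle.measurable
    (fun x y => by rw [AddCircle.toCircle_add, Circle.coe_mul]) (fun x => Circle.norm_coe _)
    (continuous_collapse hN hℓ).measurable hq n
  have h2 := le_one_sub_integral_collapse hN hℓ
  have h3 : (1 - slitParam N ℓ ^ 2) / (2 * Real.pi) = (1 - slitParam N ℓ ^ 2) / Real.pi / 2 := by
    field_simp
  have h4 : 2 * n * (1 - q) ≤ 2 * n * (12 * slitParam N ℓ ^ 3) := by gcongr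
  linarith

omit hN hℓ in
lemma slitParam_eq : slitParam N ℓ = (Real.exp (ℓ / N) - 1) / (1 + Real.exp (ℓ / N)) := by
  rw [slitParam]; field_simp; ring

lemma slitParam_le : slitParam N ℓ ≤ ℓ / N := by
  rw [slitParam_eq, div_le_iff₀ (by positivity)]
  have h1 := Real.one_sub_le_exp_neg (ℓ / N)
  have h2 : Real.exp (-(ℓ / N)) * Real.exp (ℓ / N) = 1 := by rw [← Real.exp_add]; simp
  have h3 := mul_le_mul_of_nonneg_right h1 (Real.exp_pos (ℓ / N)).le
  have h4 : 0 < ℓ / N := by positivity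
  linarith

lemma le_slitParam {K : ℝ} (hK : ℓ ≤ K * N) : ℓ / N / (1 + Real.exp K) ≤ slitParam N ℓ := by
  rw [slitParam_eq]
  have h1 := Real.add_one_le_exp (ℓ / N)
  have h2 : ℓ / N ≤ K := by rwa [div_le_iff₀ hN]
  have : 0 < ℓ / N := by positivity
  apply div_le_div₀ (by linarith) (by linarith) (by positivity)
  gcongr

lemma le_one_sub_slitParam_sq {K : ℝ} (hK : ℓ ≤ K * N) :
    4 / (1 + Real.exp K) ^ 2 ≤ 1 - slitParam N ℓ ^ 2 := by
  have h2 : ℓ / N ≤ K := by rwa [div_le_iff₀ hN]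
  have h1 : 1 ≤ Real.exp (ℓ / N) := Real.one_le_exp (by positivity)
  have : 1 - slitParam N ℓ ^ 2 = 4 * Real.exp (ℓ / N) / (1 + Real.exp (ℓ / N)) ^ 2 := by
    rw [slitParam_eq]; field_simp; ring
  rw [this]
  apply div_le_div₀ (by positivity) (by linarith) (by positivity)
  gcongr

end

/-! ### Generic positions -/

lemma foot_succ {G : Type*} [AddCommGroup G] (φ : G → G) (s : ℕ → G) (n : ℕ) :
    foot φ s (n + 1) = rot φ (s 0) (foot φ (fun i => s (i + 1)) n) :=
  footMap_succ_shift φ s n _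

section
variable {N ℓ : ℝ} (hN : 0 < N) (hℓ : 0 < ℓ)

include hN hℓ

lemma cosC_eq_of_slitMap_eq_zero {y : AddCircle (2 * Real.pi * N)}
    (h : slitMap N ℓ (y, 0) = 0) : cosC N y = 1 - 2 * slitParam N ℓ ^ 2 := by
  have h1 := (slitMap_spec hN hℓ (p := (y, (0 : ℝ))) le_rfl).2.1
  have hc : 0 < 1 - slitParam N ℓ ^ 2 := by have := slitParam_sq_lt_one hN hℓ; linarith
  simp only [h, Prod.fst_zero, Prod.snd_zero, cosC_zero, zero_div, Real.cosh_zero, mul_one] at h1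
  rw [eq_div_iff hc.ne'] at h1
  linarith

/-- A sequence of positions is generic as soon as no particle, transported backwards along the later
arrivals, ever lies on one of the two points that are mapped to the foot of a slit. -/
lemma generic_of_forall_ne (x : ℕ → ℝ)
    (h : ∀ i l, cosC N (foot (collapse N ℓ) (fun j => positions N x (i + 1 + j)) l
      - positions N x i) ≠ 1 - 2 * slitParam N ℓ ^ 2) : Generic N ℓ x := by
  intro n k hk hfoot hbase
  set s := positions N x with hs
  set φ := collapse N ℓ with hφ
  set u : ℕ → ℕ → AddCircle (2 * Real.pi * N) := fun n i => foot φ (fun j => s (i + j)) (n - i)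
    with hu
  have hdiag : ∀ n, u n n = s n := by
    intro n; simp only [hu, Nat.sub_self]; rfl
  have hzero : ∀ n, u n 0 = foot φ s n := by
    intro n; simp only [hu, Nat.sub_zero, Nat.zero_add]
  have hstep : ∀ n i, i < n → u n i = rot φ (s i) (u n (i + 1)) := by
    intro n i hi
    simp only [hu]
    rw [show n - i = (n - (i + 1)) + 1 by omega, foot_succ]
    have : (fun j => s (i + (j + 1))) = fun j => s (i + 1 + j) := by
      funext j; rw [add_assoc, add_comm 1]
    rw [this]; rfl
  -- the position of the particle stays on the bottom circle all the way
  have hchain : ∀ i ≤ n, (chl N ℓ x i (u n i, 0)).2 = 0 := by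
    intro i hi
    induction hi using Nat.decreasingInduction with
    | self => rw [hdiag]; exact hbase
    | of_succ i hi ih =>
      rcases slitMapAt_base hN hℓ (x (i + 1)) (u n (i + 1)) with h1 | ⟨-, -, h2, -⟩
      · rw [hstep n i hi]
        change (chl N ℓ x i (rot (collapse N ℓ) (x (i + 1)) (u n (i + 1)), 0)).2 = 0
        rw [← h1]; exact ih
      · exact absurd ih (chl_snd_pos hN hℓ x i h2).ne'
  have hne : ∀ i < n, u n i ≠ s i := by
    intro i hi heq
    rcases slitMapAt_base hN hℓ (x (i + 1)) (u n (i + 1)) with h1 | ⟨-, -, h2, -⟩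
    · refine h i (n - (i + 1)) (cosC_eq_of_slitMap_eq_zero hN hℓ ?_)
      have h2 := congrArg Prod.snd h1
      rw [slitMapAt_snd] at h2
      have h3 := heq
      rw [hstep n i hi, rot, add_eq_right] at h3
      exact Prod.ext h3 h2
    · exact absurd (hchain (i + 1) hi) (chl_snd_pos hN hℓ x i h2).ne'
  have heq : ∀ i ≤ k, u k i = u n i := by
    intro i hi
    induction i with
    | zero => rw [hzero, hzero]; exact hfoot
    | succ i ih =>
      have h1 := ih (by omega)
      rw [hstep k i (by omega), hstep n i (by omega)] at h1
      rcases rot_eq_rot (fun y z => collapse_eq_collapse hN hℓ) h1.symm with h2 | h2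
      · exact h2.symm
      · rw [← hstep n i (by omega)] at h2
        exact absurd h2 (hne i (by omega))
  exact hne k hk ((heq k le_rfl).symm.trans (hdiag k))

variable [Fact (0 < 2 * Real.pi * N)]

omit hℓ in
lemma haarAddCircle_cosC_eq (a : ℝ) :
    AddCircle.haarAddCircle {y : AddCircle (2 * Real.pi * N) | cosC N y = a} = 0 := by
  have hs : ∀ x : AddCircle (2 * Real.pi * N), AddCircle.haarAddCircle {x} = 0 := by
    intro x
    have h1 := haarAddCircle_real_closedBall x (r := 0) le_rfl
      (by simpa using (Fact.out : 0 < 2 * Real.pi * N).le)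
    rw [Metric.closedBall_zero, mul_zero, zero_div] at h1
    exact (measureReal_eq_zero_iff).1 h1
  have hsub : ∀ b : ℝ, AddCircle.haarAddCircle
      {y : AddCircle (2 * Real.pi * N) | cosC N y = a ∧ sinC N y = b} = 0 := by
    intro b
    rcases Set.Subsingleton.eq_empty_or_singleton
      (s := {y : AddCircle (2 * Real.pi * N) | cosC N y = a ∧ sinC N y = b})
      (fun y hy z hz => circle_ext hN (hy.1.trans hz.1.symm) (hy.2.trans hz.2.symm)) with h | ⟨x, h⟩
    · rw [h, measure_empty]
    · rw [h, hs]
  refine measure_mono_null (t := {y | cosC N y = a ∧ sinC N y = √(1 - a ^ 2)}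
    ∪ {y | cosC N y = a ∧ sinC N y = -√(1 - a ^ 2)}) ?_
    (measure_union_null (hsub _) (hsub _))
  intro y hy
  have hy : cosC N y = a := hy
  have h1 := cosC_sq_add_sinC_sq N y
  rw [hy] at h1
  rcases sq_eq_sq_iff_eq_or_eq_neg.1 (show sinC N y ^ 2 = √(1 - a ^ 2) ^ 2 by
    rw [Real.sq_sqrt (by nlinarith [sq_nonneg (sinC N y)])]; linarith) with h | h
  · exact Or.inl ⟨hy, h⟩
  · exact Or.inr ⟨hy, h⟩

/-- Almost every sequence of positions is generic: given the later positions, each position has to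
avoid two points. -/
lemma ae_forall_cosC_ne :
    ∀ᵐ s ∂seqLaw (AddCircle.haarAddCircle (T := 2 * Real.pi * N)), ∀ i l,
      cosC N (foot (collapse N ℓ) (fun j => s (i + 1 + j)) l - s i)
        ≠ 1 - 2 * slitParam N ℓ ^ 2 := by
  set m := AddCircle.haarAddCircle (T := 2 * Real.pi * N)
  have hφ := (continuous_collapse hN hℓ).measurable
  rw [ae_all_iff]; intro i
  rw [ae_all_iff]; intro l
  have hmeas : ∀ i, MeasurableSet {s : ℕ → AddCircle (2 * Real.pi * N) |
      cosC N (foot (collapse N ℓ) (fun j => s (i + 1 + j)) l - s i)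
        = 1 - 2 * slitParam N ℓ ^ 2} := by
    intro i
    refine (measurableSet_singleton _).preimage ((continuous_cosC N).measurable.comp
      (Measurable.sub ?_ (measurable_pi_apply i)))
    exact (measurable_foot hφ l).comp (measurable_pi_iff.2 fun j => measurable_pi_apply _)
  rw [ae_iff]
  simp only [not_not]
  induction i with
  | zero =>
    have h1 := hmeas 0
    rw [← (measurePreserving_consSeq m).measure_preimage h1.nullMeasurableSet,
      Measure.prod_apply_symm (measurable_consSeq h1), lintegral_eq_zero_of_ae_eq_zero]
    refine Filter.Eventually.of_forall fun s => ?_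
    have h2 := (Measure.measurePreserving_sub_left m (foot (collapse N ℓ) s l)).measure_preimage
      (s := {y | cosC N y = 1 - 2 * slitParam N ℓ ^ 2})
      ((measurableSet_singleton _).preimage (continuous_cosC N).measurable).nullMeasurableSet
    rw [haarAddCircle_cosC_eq hN] at h2
    refine Eq.trans (congrArg m ?_) h2
    ext x
    simp only [Set.mem_preimage, Set.mem_ofPred_eq]
    have : (fun j => consSeq (x, s) (0 + 1 + j)) = s := by
      funext j
      rw [show 0 + 1 + j = j + 1 by omega]; rfl
    rw [this]; rfl
  | succ i ih =>
    rw [seqLaw_apply m (hmeas (i + 1)), lintegral_eq_zero_of_ae_eq_zero]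
    refine Filter.Eventually.of_forall fun x => ?_
    refine Eq.trans (congrArg _ ?_) ih
    ext s
    simp only [Set.mem_ofPred_eq]
    have : (fun j => consSeq (x, s) (i + 1 + 1 + j)) = fun j => s (i + 1 + j) := by
      funext j
      rw [show i + 1 + 1 + j = (i + 1 + j) + 1 by omega]; rfl
    rw [this]; rfl

end

/-! ### The last hit of a finite tree -/

section
variable {α β : Type*} [MeasurableSpace α] [MeasurableSpace β] (κ : Measure α)
  [IsProbabilityMeasure κ] (m : Measure β) [IsProbabilityMeasure m]

lemma measurable_fst_eval (j : ℕ) : Measurable fun w : ℕ → α × β => (w j).1 :=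
  measurable_fst.comp (measurable_pi_apply j)

lemma measurable_snd_seq : Measurable fun (w : ℕ → α × β) i => (w i).2 :=
  measurable_pi_iff.2 fun i => measurable_snd.comp (measurable_pi_apply i)

/-- In a sequence of independent pairs with independent components, each first component is
independent of the sequence of second components. -/
lemma seqLaw_prod_apply (j : ℕ) {D : Set α} (hD : MeasurableSet D) {A : Set (ℕ → β)}
    (hA : MeasurableSet A) :
    seqLaw (κ.prod m) {w | (w j).1 ∈ D ∧ (fun i => (w i).2) ∈ A} = κ D * seqLaw m A := by
  classical
  have hDm : MeasurableSet {w : ℕ → α × β | (w j).1 ∈ D} :=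
    measurable_fst_eval j hD
  have hbox : ∀ (s : Finset ℕ) (t : ℕ → Set β), (∀ i, MeasurableSet (t i)) →
      seqLaw (κ.prod m) {w | (w j).1 ∈ D ∧ (fun i => (w i).2) ∈ Set.pi (s : Set ℕ) t}
        = κ D * ∏ i ∈ s, m (t i) := by
    intro s t ht
    set Q : ℕ → Set (α × β) := fun i =>
      (if i = j then D else Set.univ) ×ˢ (if i ∈ s then t i else Set.univ) with hQ
    have h1 : {w : ℕ → α × β | (w j).1 ∈ D ∧ (fun i => (w i).2) ∈ Set.pi (s : Set ℕ) t}
        = Set.pi (insert j s : Finset ℕ) Q := by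
      ext w
      simp only [hQ, Set.mem_pi, Set.mem_ofPred_eq, Finset.mem_coe, Finset.mem_insert,
        Set.mem_prod]
      constructor
      · rintro ⟨h1, h2⟩ i -
        refine ⟨?_, ?_⟩
        · split_ifs with h
          exacts [h ▸ h1, trivial]
        · split_ifs with h
          exacts [h2 i h, trivial]
      · intro h
        refine ⟨by simpa using (h j (Or.inl rfl)).1, fun i hi => ?_⟩
        simpa [hi] using (h i (Or.inr hi)).2
    have hQm : ∀ i, MeasurableSet (Q i) := by
      intro i
      refine MeasurableSet.prod ?_ ?_
      · split_ifs
        exacts [hD, MeasurableSet.univ]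
      · split_ifs
        exacts [ht i, MeasurableSet.univ]
    rw [h1, Measure.infinitePi_pi _ fun i _ => hQm i]
    simp only [hQ, Measure.prod_prod]
    rw [Finset.prod_mul_distrib]
    congr 1
    · rw [Finset.prod_eq_single j]
      · simp
      · intro i _ hi; simp [hi]
      · intro h; simp at h
    · have h2 : s ⊆ insert j s := Finset.subset_insert j s
      rw [← Finset.prod_subset h2]
      · exact Finset.prod_congr rfl fun i hi => by simp [hi]
      · intro i _ hi; simp [hi]
  by_cases h0 : κ D = 0
  · rw [h0, zero_mul]
    have := hbox ∅ (fun _ => Set.univ) fun _ => MeasurableSet.univ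
    rw [h0, zero_mul] at this
    refine measure_mono_null ?_ this
    rintro w ⟨hw, -⟩
    exact ⟨hw, by simp⟩
  · have h1 : (κ D)⁻¹ • ((seqLaw (κ.prod m)).restrict {w | (w j).1 ∈ D}).map
        (fun w i => (w i).2) = seqLaw m := by
      refine Measure.eq_infinitePi _ fun s t ht => ?_
      have htm : MeasurableSet (Set.pi (s : Set ℕ) t) :=
        MeasurableSet.pi (Set.to_countable _) fun i _ => ht i
      rw [Measure.smul_apply, Measure.map_apply measurable_snd_seq htm,
        Measure.restrict_apply (measurable_snd_seq htm), smul_eq_mul, Set.inter_comm]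
      refine (congrArg _ (hbox s t ht)).trans ?_
      rw [← mul_assoc, ENNReal.inv_mul_cancel h0 (measure_ne_top _ _), one_mul]
    rw [← h1, Measure.smul_apply, Measure.map_apply measurable_snd_seq hA,
      Measure.restrict_apply (measurable_snd_seq hA), smul_eq_mul, ← mul_assoc,
      ENNReal.mul_inv_cancel h0 (measure_ne_top _ _), one_mul, Set.inter_comm]
    rfl

lemma map_snd_seqLaw_prod :
    (seqLaw (κ.prod m)).map (fun w i => (w i).2) = seqLaw m := by
  ext A hA
  have := seqLaw_prod_apply κ m 0 MeasurableSet.univ hA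
  simp only [Set.mem_univ, true_and, measure_univ, one_mul] at this
  rw [Measure.map_apply measurable_snd_seq hA, ← this]
  rfl

lemma map_eval_seqLaw_prod (j : ℕ) :
    (seqLaw (κ.prod m)).map (fun w => (w j).1) = κ := by
  ext D hD
  have := seqLaw_prod_apply κ m j hD MeasurableSet.univ
  simp only [Set.mem_univ, and_true, measure_univ, mul_one] at this
  rw [Measure.map_apply (measurable_fst_eval j) hD, ← this]
  rfl

lemma lintegral_seqLaw_prod {f : α → ℝ≥0∞} (hf : Measurable f) (j : ℕ) {A : Set (ℕ → β)}
    (hA : MeasurableSet A) :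
    ∫⁻ w, f (w j).1 * A.indicator 1 (fun i => (w i).2) ∂seqLaw (κ.prod m)
      = (∫⁻ a, f a ∂κ) * seqLaw m A := by
  have hind : IndepFun (fun w : ℕ → α × β => (w j).1) (fun (w : ℕ → α × β) i => (w i).2)
      (seqLaw (κ.prod m)) := by
    rw [indepFun_iff_measure_inter_preimage_eq_mul]
    intro D A hD hA
    have h1 := map_eval_seqLaw_prod κ m j
    have h2 := map_snd_seqLaw_prod κ m
    rw [← Measure.map_apply (measurable_fst_eval j) hD,
      ← Measure.map_apply measurable_snd_seq hA, h2]
    refine (seqLaw_prod_apply κ m j hD hA).trans ?_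
    congr 2
    exact h1.symm
  have hm : Measurable fun w : ℕ → α × β => (w j).1 := measurable_fst_eval j
  have h3 := lintegral_mul_eq_lintegral_mul_lintegral_of_indepFun (hf.comp hm)
    ((measurable_one.indicator hA).comp measurable_snd_seq)
    (hind.comp hf (measurable_one.indicator hA))
  refine h3.trans ?_
  congr 1
  · conv_rhs => rw [← map_eval_seqLaw_prod κ m j, lintegral_map hf hm]
    rfl
  · rw [← lintegral_indicator_one hA, ← map_snd_seqLaw_prod κ m,
      lintegral_map (measurable_one.indicator hA) measurable_snd_seq]
    rfl

end

section
variable {G : Type*} [AddCommGroup G]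

/-- The last arrival time of a particle in a tree that receives finitely many, as a function of the
sequence of waiting times and positions. -/
noncomputable def lastFiniteTime (φ : G → G) (w : ℕ → ℝ × G) : ℝ≥0∞ :=
  ⨆ n, ⨆ _ : {k | foot φ (fun i => (w i).2) k = foot φ (fun i => (w i).2) n}.Finite,
    ENNReal.ofReal (∑ i ∈ Finset.range (n + 1), (w i).1)

variable {φ : G → G} [MeasurableSpace G] [MeasurableAdd₂ G] [MeasurableSub₂ G]
  [MeasurableSingletonClass G]

lemma measurableSet_finite (hφ : Measurable φ) (n : ℕ) :
    MeasurableSet {s : ℕ → G | {k | foot φ s k = foot φ s n}.Finite} := by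
  have : {s : ℕ → G | {k | foot φ s k = foot φ s n}.Finite}
      = ⋃ b, ⋂ k, ⋂ _ : b < k, {s | foot φ s k = foot φ s n}ᶜ := by
    ext s
    simp only [Set.mem_ofPred_eq, Set.mem_iUnion, Set.mem_iInter, Set.mem_compl_iff]
    constructor
    · intro h
      obtain ⟨b, hb⟩ := h.bddAbove
      exact ⟨b, fun k hk h => (hb h).not_gt hk⟩
    · rintro ⟨b, hb⟩
      exact (Set.finite_Iic b).subset fun k hk => not_lt.1 fun h => hb k h hk
  rw [this]
  exact MeasurableSet.iUnion fun b => MeasurableSet.iInter fun k => MeasurableSet.iInter fun _ =>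
    (measurableSet_foot_eq hφ k n).compl

lemma measurableSet_finiteHit (hφ : Measurable φ) (i : ℕ) : MeasurableSet (finiteHit φ i) := by
  simp only [finiteHit, Set.ofPred_exists, Set.ofPred_and]
  exact MeasurableSet.iUnion fun n => (MeasurableSet.const _).inter (measurableSet_finite hφ n)

lemma measurable_lastFiniteTime (hφ : Measurable φ) : Measurable (lastFiniteTime φ) := by
  classical
  refine Measurable.iSup fun n => ?_
  have h1 : Measurable fun w : ℕ → ℝ × G =>
      ENNReal.ofReal (∑ i ∈ Finset.range (n + 1), (w i).1) :=
    (Finset.measurable_sum _ fun i _ => measurable_fst_eval i).ennreal_ofReal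
  have h2 : MeasurableSet {w : ℕ → ℝ × G |
      {k | foot φ (fun i => (w i).2) k = foot φ (fun i => (w i).2) n}.Finite} :=
    measurable_snd_seq (measurableSet_finite hφ n)
  convert h1.indicator h2 using 2 with w
  by_cases hw : {k | foot φ (fun i => (w i).2) k = foot φ (fun i => (w i).2) n}.Finite
  · rw [iSup_pos hw, Set.indicator_of_mem]; exact hw
  · rw [iSup_neg hw, Set.indicator_of_notMem]
    · rfl
    · exact hw

variable {m : Measure G} [IsProbabilityMeasure m] [m.IsAddLeftInvariant] {η : ℝ}
  {κ : Measure ℝ} [IsProbabilityMeasure κ] (h : IsCollapse m φ η)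

include h

/-- Each waiting time counts as long as a finite tree is still to be hit. -/
lemma IsCollapse.lintegral_lastFiniteTime_le [TopologicalSpace G] [BorelSpace G]
    [IsTopologicalAddGroup G] [SecondCountableTopology G] :
    ∫⁻ w, lastFiniteTime φ w ∂seqLaw (κ.prod m)
      ≤ (∫⁻ a, ENNReal.ofReal a ∂κ) * ENNReal.ofReal (5 / η ^ 3) := by
  have hle : ∀ w : ℕ → ℝ × G, lastFiniteTime φ w ≤ ∑' j, ENNReal.ofReal (w j).1
      * (finiteHit φ j).indicator 1 (fun i => (w i).2) := by
    intro w
    refine iSup₂_le fun n hn => ?_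
    calc _ ≤ ∑ i ∈ Finset.range (n + 1), ENNReal.ofReal (w i).1 :=
          Finset.le_sum_of_subadditive _ ENNReal.ofReal_zero.le
            (fun _ _ => ENNReal.ofReal_add_le) _ _
      _ = ∑ i ∈ Finset.range (n + 1), ENNReal.ofReal (w i).1
            * (finiteHit φ i).indicator 1 (fun i => (w i).2) := by
        refine Finset.sum_congr rfl fun i hi => ?_
        rw [Set.indicator_of_mem, Pi.one_apply, mul_one]
        exact ⟨n, by simp at hi; omega, hn⟩
      _ ≤ _ := ENNReal.sum_le_tsum _
  have hmeas : ∀ j, Measurable fun w : ℕ → ℝ × G => ENNReal.ofReal (w j).1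
      * (finiteHit φ j).indicator 1 (fun i => (w i).2) := fun j =>
    (measurable_fst_eval j).ennreal_ofReal.mul
      ((measurable_one.indicator (measurableSet_finiteHit h.measurable j)).comp measurable_snd_seq)
  calc _ ≤ ∫⁻ w, ∑' j, ENNReal.ofReal (w j).1
      * (finiteHit φ j).indicator 1 (fun i => (w i).2) ∂seqLaw (κ.prod m) := lintegral_mono hle
    _ = ∑' j, (∫⁻ a, ENNReal.ofReal a ∂κ) * seqLaw m (finiteHit φ j) := by
      rw [lintegral_tsum fun j => (hmeas j).aemeasurable]
      exact tsum_congr fun j => lintegral_seqLaw_prod κ m ENNReal.measurable_ofReal j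
        (measurableSet_finiteHit h.measurable j)
    _ ≤ _ := by
      rw [ENNReal.tsum_mul_left]
      gcongr
      exact h.tsum_finiteHit_le

/-- If the particles of index `n` and `n + 1` are received by different trees, one of these trees is
finite. -/
lemma IsCollapse.le_lintegral_lastFiniteTime [TopologicalSpace G] [BorelSpace G]
    [IsTopologicalAddGroup G] [SecondCountableTopology G] (hκ : ∀ᵐ a ∂κ, 0 ≤ a) (n : ℕ) :
    (n + 1) * (∫⁻ a, ENNReal.ofReal a ∂κ) * seqLaw m {s | foot φ s n ≠ foot φ s (n + 1)}
      ≤ ∫⁻ w, lastFiniteTime φ w ∂seqLaw (κ.prod m) := by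
  set A : Set (ℕ → G) := {s | foot φ s n ≠ foot φ s (n + 1)} with hAdef
  have hA : MeasurableSet A := (measurableSet_foot_eq h.measurable n (n + 1)).compl
  have hm : ∀ j, Measurable fun w : ℕ → ℝ × G => (w j).1 := measurable_fst_eval
  have hnn : ∀ᵐ w ∂seqLaw (κ.prod m), ∀ j, 0 ≤ (w j).1 := by
    rw [ae_all_iff]
    intro j
    rw [← map_eval_seqLaw_prod κ m j] at hκ
    exact ae_of_ae_map (hm j).aemeasurable hκ
  have huniq : ∀ᵐ w ∂seqLaw (κ.prod m), ∀ j j',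
      {k | foot φ (fun i => (w i).2) k = foot φ (fun i => (w i).2) j}.Infinite →
      {k | foot φ (fun i => (w i).2) k = foot φ (fun i => (w i).2) j'}.Infinite →
        foot φ (fun i => (w i).2) j = foot φ (fun i => (w i).2) j' := by
    have h1 := h.ae_unique_infinite
    rw [← map_snd_seqLaw_prod κ m] at h1
    filter_upwards [ae_of_ae_map measurable_snd_seq.aemeasurable h1] with w hw
    exact hw.2
  have hmeas : ∀ j, Measurable fun w : ℕ → ℝ × G => ENNReal.ofReal (w j).1
      * A.indicator 1 (fun i => (w i).2) := fun j =>
    (hm j).ennreal_ofReal.mul ((measurable_one.indicator hA).comp measurable_snd_seq)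
  calc _ = ∑ j ∈ Finset.range (n + 1), ∫⁻ w, ENNReal.ofReal (w j).1
      * A.indicator 1 (fun i => (w i).2) ∂seqLaw (κ.prod m) := by
        simp_rw [lintegral_seqLaw_prod κ m ENNReal.measurable_ofReal _ hA]
        rw [Finset.sum_const, Finset.card_range, nsmul_eq_mul, Nat.cast_add, Nat.cast_one,
          mul_assoc]
    _ = ∫⁻ w, ∑ j ∈ Finset.range (n + 1), ENNReal.ofReal (w j).1
      * A.indicator 1 (fun i => (w i).2) ∂seqLaw (κ.prod m) :=
        (lintegral_finsetSum _ fun j _ => hmeas j).symm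
    _ ≤ _ := by
      refine lintegral_mono_ae ?_
      filter_upwards [hnn, huniq] with w hw hu
      rw [← Finset.sum_mul, ← ENNReal.ofReal_sum_of_nonneg fun i _ => hw i]
      by_cases hs : (fun i => (w i).2) ∈ A
      · rw [Set.indicator_of_mem hs, Pi.one_apply, mul_one]
        have hmono : ∀ l, n ≤ l →
            {k | foot φ (fun i => (w i).2) k = foot φ (fun i => (w i).2) l}.Finite →
            ENNReal.ofReal (∑ i ∈ Finset.range (n + 1), (w i).1) ≤ lastFiniteTime φ w := by
          intro l hl hfin
          refine le_trans ?_ (le_iSup₂_of_le l hfin le_rfl)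
          exact ENNReal.ofReal_le_ofReal (Finset.sum_le_sum_of_subset_of_nonneg
            (Finset.range_mono (by omega)) fun i _ _ => hw i)
        by_cases h1 : {k | foot φ (fun i => (w i).2) k = foot φ (fun i => (w i).2) n}.Finite
        · exact hmono n le_rfl h1
        · refine hmono (n + 1) n.le_succ ?_
          by_contra h2
          exact hs (hu n (n + 1) h1 h2)
      · rw [Set.indicator_of_notMem hs, mul_zero]
        exact zero_le

end

section
variable {r : ℝ} (hr : 0 < r)

lemma ae_nonneg_expMeasure : ∀ᵐ a ∂expMeasure r, 0 ≤ a := by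
  rw [ae_iff]
  simp only [not_le]
  have : {a : ℝ | a < 0} = Set.Iio 0 := rfl
  rw [this, expMeasure, gammaMeasure, withDensity_apply _ measurableSet_Iio]
  exact lintegral_gammaPDF_of_nonpos le_rfl

include hr in
lemma lintegral_ofReal_expMeasure :
    ∫⁻ a, ENNReal.ofReal a ∂expMeasure r = ENNReal.ofReal (1 / r) := by
  have h1 : ∀ a : ℝ, gammaPDF 1 r a * ENNReal.ofReal a
      = ENNReal.ofReal (1 / r) * gammaPDF 2 r a := by
    intro a
    rcases lt_or_ge a 0 with ha | ha
    · rw [gammaPDF_of_neg ha, gammaPDF_of_neg ha, zero_mul, mul_zero]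
    · rw [gammaPDF_of_nonneg ha, gammaPDF_of_nonneg ha, ← ENNReal.ofReal_mul' ha,
        ← ENNReal.ofReal_mul (by positivity)]
      congr 1
      have h2 : (2 : ℝ) - 1 = 1 := by norm_num
      have h3 : Real.Gamma 2 = 1 := Real.Gamma_two
      rw [sub_self, h2, h3, Real.Gamma_one, Real.rpow_zero, Real.rpow_one, Real.rpow_one,
        Real.rpow_two]
      field_simp
  rw [expMeasure, gammaMeasure, lintegral_withDensity_eq_lintegral_mul _
    (f := gammaPDF 1 r) (measurable_gammaPDFReal 1 r).ennreal_ofReal ENNReal.measurable_ofReal]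
  simp only [Pi.mul_apply, h1]
  rw [lintegral_const_mul' _ _ ENNReal.ofReal_ne_top, lintegral_gammaPDF_eq_one two_pos hr, mul_one]

end

/-! ### The domination time of the Poisson process -/

section
variable {N ℓ : ℝ}

lemma map_coe_cond_Ioc {T : ℝ} [hT : Fact (0 < T)] :
    (ProbabilityTheory.cond volume (Set.Ioc 0 T)).map ((↑) : ℝ → AddCircle T)
      = AddCircle.haarAddCircle := by
  have h1 := (AddCircle.measurePreserving_mk T 0).map_eq
  rw [zero_add, AddCircle.volume_eq_smul_haarAddCircle] at h1
  have hT0 : ENNReal.ofReal T ≠ 0 := by simpa using hT.out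
  rw [ProbabilityTheory.cond, Measure.map_smul, h1, Real.volume_Ioc, sub_zero, smul_smul,
    ENNReal.inv_mul_cancel hT0 ENNReal.ofReal_ne_top, one_smul]

variable {Ω : Type*} [MeasurableSpace Ω] {μ : Measure Ω} {t x : ℕ → Ω → ℝ}

/-- The waiting times and the positions on the circle form an independent sequence of independent
pairs. -/
lemma IsPoissonPoints.hasLaw [hT : Fact (0 < 2 * Real.pi * N)]
    [IsProbabilityMeasure (expMeasure (2 * Real.pi * N))] (h : IsPoissonPoints N t x μ) :
    HasLaw (fun ω n => (t (n + 1) ω - t n ω, positions N (fun k => x k ω) n))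
      (seqLaw ((expMeasure (2 * Real.pi * N)).prod
        (AddCircle.haarAddCircle (T := 2 * Real.pi * N)))) μ := by
  have hcm : Measurable ((↑) : ℝ → AddCircle (2 * Real.pi * N)) := AddCircle.measurable_mk'
  set g : ℝ × ℝ → ℝ × AddCircle (2 * Real.pi * N) := Prod.map id (↑) with hg
  have hgm : Measurable g := measurable_id.prodMap hcm
  have hne : (volume (Set.Ioc 0 (2 * Real.pi * N))) ≠ 0 := by
    rw [Real.volume_Ioc, sub_zero]; simpa using hT.out
  have : IsProbabilityMeasure (ProbabilityTheory.cond volume (Set.Ioc 0 (2 * Real.pi * N))) :=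
    cond_isProbabilityMeasure_of_finite hne (by simp)
  have hlaw : ∀ n, HasLaw (fun ω => g (t (n + 1) ω - t n ω, x (n + 1) ω))
      ((expMeasure (2 * Real.pi * N)).prod (AddCircle.haarAddCircle (T := 2 * Real.pi * N))) μ := by
    intro n
    refine ⟨hgm.comp_aemeasurable (h.law n).aemeasurable, ?_⟩
    have h1 := AEMeasurable.map_map_of_aemeasurable (g := g) hgm.aemeasurable
      (h.law n).aemeasurable
    refine h1.symm.trans ?_
    rw [(h.law n).map_eq, hg, ← Measure.map_prod_map _ _ measurable_id hcm, Measure.map_id,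
      map_coe_cond_Ioc]
  exact (h.indep.comp (fun _ => g) fun _ => hgm).hasLaw_infinitePi hlaw
    (aemeasurable_pi_iff.2 fun n => (hlaw n).aemeasurable)

lemma IsPoissonPoints.ae_positions [hT : Fact (0 < 2 * Real.pi * N)] (h : IsPoissonPoints N t x μ)
    {p : (ℕ → AddCircle (2 * Real.pi * N)) → Prop}
    (hp : ∀ᵐ s ∂seqLaw (AddCircle.haarAddCircle (T := 2 * Real.pi * N)), p s) :
    ∀ᵐ ω ∂μ, p (positions N fun k => x k ω) := by
  have := isProbabilityMeasure_expMeasure hT.out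
  rw [← map_snd_seqLaw_prod (expMeasure (2 * Real.pi * N)), ← h.hasLaw.map_eq] at hp
  exact ae_of_ae_map h.hasLaw.aemeasurable (ae_of_ae_map measurable_snd_seq.aemeasurable hp)

variable (hN : 0 < N) (hℓ : 0 < ℓ)

include hN hℓ

lemma IsPoissonPoints.ae_sameTree_iff (h : IsPoissonPoints N t x μ) :
    ∀ᵐ ω ∂μ, ∀ j k, SameTree N ℓ (fun n => x n ω) j k ↔
      foot (collapse N ℓ) (positions N fun n => x n ω) j
        = foot (collapse N ℓ) (positions N fun n => x n ω) k := by
  have : Fact (0 < 2 * Real.pi * N) := ⟨by positivity⟩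
  filter_upwards [h.ae_positions (ae_forall_cosC_ne hN hℓ)] with ω hω j k
  exact sameTree_iff hN hℓ _ (generic_of_forall_ne hN hℓ _ hω)

lemma IsPoissonPoints.ae_uniqueInfiniteTree (h : IsPoissonPoints N t x μ) :
    ∀ᵐ ω ∂μ, UniqueInfiniteTree N ℓ (fun n => x n ω) := by
  have : Fact (0 < 2 * Real.pi * N) := ⟨by positivity⟩
  filter_upwards [h.ae_sameTree_iff hN hℓ,
    h.ae_positions (isCollapse_collapse hN hℓ).ae_unique_infinite] with ω h1 ⟨⟨j, hj⟩, h2⟩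
  have h3 : ∀ j, InInfiniteTree N ℓ (fun n => x n ω) j ↔
      {k | foot (collapse N ℓ) (positions N fun n => x n ω) k
        = foot (collapse N ℓ) (positions N fun n => x n ω) j}.Infinite := by
    intro j
    simp only [InInfiniteTree, h1, eq_comm]
  exact ⟨j, (h3 j).2 hj, fun k hk => (h1 j k).2 (h2 j k hj ((h3 k).1 hk))⟩

/-- The domination time is almost surely a measurable function of the waiting times and the
positions on the circle. -/
lemma IsPoissonPoints.ae_dominationTime_eq (h : IsPoissonPoints N t x μ) :
    ∀ᵐ ω ∂μ, dominationTime N ℓ (fun n => t n ω) (fun n => x n ω)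
      = lastFiniteTime (collapse N ℓ)
        (fun n => (t (n + 1) ω - t n ω, positions N (fun k => x k ω) n)) := by
  filter_upwards [h.ae_sameTree_iff hN hℓ] with ω h1
  simp only [dominationTime, lastFiniteTime]
  refine iSup_congr fun n => ?_
  have h2 : ∑ i ∈ Finset.range (n + 1), (t (i + 1) ω - t i ω) = t (n + 1) ω := by
    rw [Finset.sum_range_sub (fun i => t i ω), h.zero, sub_zero]
  rw [h2]
  refine iSup_congr_Prop ?_ fun _ => rfl
  simp only [InInfiniteTree, h1, Set.not_infinite]
  simp only [eq_comm]

lemma IsPoissonPoints.aemeasurable_dominationTime (h : IsPoissonPoints N t x μ) :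
    AEMeasurable (fun ω => dominationTime N ℓ (fun n => t n ω) (fun n => x n ω)) μ := by
  have : Fact (0 < 2 * Real.pi * N) := ⟨by positivity⟩
  have := isProbabilityMeasure_expMeasure (r := 2 * Real.pi * N) Fact.out
  refine AEMeasurable.congr ?_ (Filter.EventuallyEq.symm (h.ae_dominationTime_eq hN hℓ))
  exact (measurable_lastFiniteTime (continuous_collapse hN hℓ).measurable).comp_aemeasurable
    h.hasLaw.aemeasurable

lemma IsPoissonPoints.lintegral_dominationTime [Fact (0 < 2 * Real.pi * N)]
    [IsProbabilityMeasure (expMeasure (2 * Real.pi * N))] (h : IsPoissonPoints N t x μ) :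
    ∫⁻ ω, dominationTime N ℓ (fun n => t n ω) (fun n => x n ω) ∂μ
      = ∫⁻ w, lastFiniteTime (collapse N ℓ) w ∂seqLaw ((expMeasure (2 * Real.pi * N)).prod
        (AddCircle.haarAddCircle (T := 2 * Real.pi * N))) := by
  rw [lintegral_congr_ae (h.ae_dominationTime_eq hN hℓ), ← h.hasLaw.map_eq,
    lintegral_map' (measurable_lastFiniteTime (continuous_collapse hN hℓ).measurable).aemeasurable
      h.hasLaw.aemeasurable]

lemma IsPoissonPoints.lintegral_dominationTime_le (h : IsPoissonPoints N t x μ) :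
    ∫⁻ ω, dominationTime N ℓ (fun n => t n ω) (fun n => x n ω) ∂μ
      ≤ ENNReal.ofReal (1 / (2 * Real.pi * N) * (5 / (slitParam N ℓ / (16 * Real.pi)) ^ 3)) := by
  have hT : 0 < 2 * Real.pi * N := by positivity
  have : Fact (0 < 2 * Real.pi * N) := ⟨hT⟩
  have := isProbabilityMeasure_expMeasure hT
  rw [h.lintegral_dominationTime hN hℓ, ENNReal.ofReal_mul (by positivity),
    ← lintegral_ofReal_expMeasure hT]
  exact (isCollapse_collapse hN hℓ).lintegral_lastFiniteTime_le

lemma IsPoissonPoints.le_lintegral_dominationTime (h : IsPoissonPoints N t x μ) (n : ℕ) :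
    ENNReal.ofReal ((n + 1) * (1 / (2 * Real.pi * N)) *
      ((1 - slitParam N ℓ ^ 2) / (2 * Real.pi) - 24 * n * slitParam N ℓ ^ 3))
      ≤ ∫⁻ ω, dominationTime N ℓ (fun n => t n ω) (fun n => x n ω) ∂μ := by
  have hT : 0 < 2 * Real.pi * N := by positivity
  have : Fact (0 < 2 * Real.pi * N) := ⟨hT⟩
  have := isProbabilityMeasure_expMeasure hT
  rw [h.lintegral_dominationTime hN hℓ]
  refine le_trans ?_ ((isCollapse_collapse hN hℓ).le_lintegral_lastFiniteTime
    (ae_nonneg_expMeasure (r := 2 * Real.pi * N)) n)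
  rw [lintegral_ofReal_expMeasure hT, ENNReal.ofReal_mul (by positivity),
    ENNReal.ofReal_mul (by positivity), ENNReal.ofReal_add (by positivity) zero_le_one,
    ENNReal.ofReal_natCast, ENNReal.ofReal_one]
  gcongr
  exact (ENNReal.ofReal_le_ofReal (le_seqLaw_foot_collapse_ne hN hℓ n)).trans
    ENNReal.ofReal_toReal_le

end

end CHL

theorem theorem1p1 (K : ℝ) (hK : 0 < K) :
    ∃ c C : ℝ, 0 < c ∧ 0 < C ∧
      ∀ (N ℓ : ℝ), 0 < N → 0 < ℓ → ℓ ≤ K * N →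
        ∀ (Ω : Type*) [MeasurableSpace Ω] (μ : Measure Ω) [IsProbabilityMeasure μ]
          (t x : ℕ → Ω → ℝ), CHL.IsPoissonPoints N t x μ →
          (∀ᵐ ω ∂μ, CHL.UniqueInfiniteTree N ℓ (fun n => x n ω)) ∧
          AEMeasurable (fun ω => CHL.dominationTime N ℓ (fun n => t n ω) (fun n => x n ω)) μ ∧
          ENNReal.ofReal (c * N ^ 2 / ℓ ^ 3) ≤
            ∫⁻ ω, CHL.dominationTime N ℓ (fun n => t n ω) (fun n => x n ω) ∂μ ∧
          ∫⁻ ω, CHL.dominationTime N ℓ (fun n => t n ω) (fun n => x n ω) ∂μ ≤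
            ENNReal.ofReal (C * N ^ 2 / ℓ ^ 3) := by
  have hpi := Real.pi_pos
  set M := 1 + Real.exp K with hM
  have hM0 : 0 < M := by positivity
  set κ := 4 / M ^ 2 with hκ
  have hκ0 : 0 < κ := by positivity
  refine ⟨κ ^ 2 / (768 * Real.pi ^ 3), 10240 * Real.pi ^ 2 * M ^ 3, by positivity, by positivity,
    fun N ℓ hN hℓ hle Ω _ μ _ t x h => ⟨h.ae_uniqueInfiniteTree hN hℓ,
      h.aemeasurable_dominationTime hN hℓ, ?_, ?_⟩⟩
  · have hδ := CHL.slitParam_pos hN hℓ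
    have hδ1 := CHL.slitParam_le hN hℓ
    have hδ2 := CHL.le_one_sub_slitParam_sq hN hℓ hle
    set δ := CHL.slitParam N ℓ
    -- the number of particles for which the two trees are still distinct with a probability of
    -- order one
    set n := ⌊κ / (96 * Real.pi * δ ^ 3)⌋₊ with hn
    have hn1 : n * δ ^ 3 ≤ κ / (96 * Real.pi) := by
      have h1 : (n : ℝ) ≤ κ / (96 * Real.pi * δ ^ 3) := Nat.floor_le (by positivity)
      rw [le_div_iff₀ (by positivity)] at h1 ⊢
      linarith
    have hn2 : κ / (96 * Real.pi * δ ^ 3) ≤ n + 1 := (Nat.lt_floor_add_one _).le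
    refine le_trans (ENNReal.ofReal_le_ofReal ?_) (h.le_lintegral_dominationTime hN hℓ n)
    have h2 : κ / (4 * Real.pi) ≤ (1 - δ ^ 2) / (2 * Real.pi) - 24 * n * δ ^ 3 := by
      have h3 : κ / (2 * Real.pi) ≤ (1 - δ ^ 2) / (2 * Real.pi) := by gcongr
      have h4 : κ / (2 * Real.pi) - 24 * (κ / (96 * Real.pi)) = κ / (4 * Real.pi) := by
        field_simp; norm_num
      linarith
    have h5 : δ ^ 3 ≤ (ℓ / N) ^ 3 := by gcongr
    calc κ ^ 2 / (768 * Real.pi ^ 3) * N ^ 2 / ℓ ^ 3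
        = κ / (96 * Real.pi * (ℓ / N) ^ 3) * (1 / (2 * Real.pi * N)) * (κ / (4 * Real.pi)) := by
          field_simp; norm_num
      _ ≤ κ / (96 * Real.pi * δ ^ 3) * (1 / (2 * Real.pi * N)) * (κ / (4 * Real.pi)) := by gcongr
      _ ≤ _ := by gcongr
  · refine (h.lintegral_dominationTime_le hN hℓ).trans (ENNReal.ofReal_le_ofReal ?_)
    have hδ := CHL.le_slitParam hN hℓ hle
    calc _ ≤ 1 / (2 * Real.pi * N) * (5 / (ℓ / N / M / (16 * Real.pi)) ^ 3) := by gcongr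
      _ = _ := by field_simp; norm_num
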